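/- Let $d\ge 2$, let $\ell\in\mathbb{R}^d$ with $\|\ell\|=1$ (Euclidean norm), and let $X=(X_n)_{n\ge0}$ be a $\mathbb{Z}^d$-valued process with $X_0=0$ a.s., adapted to a filtration $(\mathcal F_n)_{n\ge0}$ on a probability space. Assume that $X$ is a *generalized excited random walk in direction $\ell$*, that is, there are constants $K,\lambda,h,r>0$ such that: * (B) $\sup_{n\ge0}\|X_{n+1}-X_n\|\le K$ a.s.; * (C$^+$) for all $n\ge 0$, a.s., $\mathbb E(X_{n+1}-X_n\mid\mathcal F_n)=0$ on $\{X_k=X_n\text{ for some }k<n\}$, and $\mathbb E(X_{n+1}-X_n\mid\mathcal F_n)\cdot\ell\ge\lambda$ on $\{X_k\ne X_n\text{ for all }k<n\}$; * (E) for all $n\ge 0$, $\mathbb P[(X_{n+1}-X_n)\cdot\ell>r\mid\mathcal F_n]\ge h$ a.s., and for every $\ell'$ with $\|\ell'\|=1$, a.s. on $\{\mathbb E(X_{n+1}-X_n\mid\mathcal F_n)=0\}$, $\mathbb P[(X_{n+1}-X_n)\cdot\ell'>r\mid\mathcal F_n]\ge h$. Regeneration times (with $\inf\emptyset=\infty$).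 For a trajectory $x=(x_n)_{n\ge0}$ put $T_u=\inf\{k\ge1:x_k\cdot\ell\ge u\}$ and $\bar D=\inf\{m\ge0:x_m\cdot\ell<x_0\cdot\ell\}$; let $S_0=D_0=0$, $R_0=x_0\cdot\ell$ and, for $k\ge0$, $$S_{k+1}=T_{R_k+1},\qquad D_{k+1}=\bar D\circ\theta_{S_{k+1}}+S_{k+1},\qquad R_{k+1}=\sup\{x_i\cdot\ell:0\le i\le D_{k+1}\},$$ where $\theta$ is the time shift and $D_{k+1}=\infty$ if $S_{k+1}=\infty$. Let $\kappa=\inf\{n\ge0:S_n<\infty,\ D_n=\infty\}$ and $\tau_1=S_\kappa$, with $\tau_1=\infty$ if $\kappa=\infty$; for $n\ge1$ let $\tau_{n+1}=\tau_n+\tau_1(x_{\tau_n+\cdot})$, with $\tau_{n+1}=\infty$ if $\tau_n=\infty$. The $\tau_k$ of the random trajectory $X$ are its regeneration times. For $k\ge1$ let $\mathcal G_0^{(k)}$ be the $\sigma$-algebra generated by all events $\{\tau_1=n_1\}\cap\dots\cap\{\tau_k=n_k\}\cap A$ with integers $0\le n_1<\dots<n_k$ and $A\in\mathcal F_{n_k}$.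 Then there exist $C',\alpha'>0$ such that for every $n\ge1$, $$\sup_{k\ge1}\mathbb P[\tau_{k+1}-\tau_k>n\mid\mathcal G_0^{(k)}]\le C'e^{-n^{\alpha'}}\qquad\text{a.s.},$$ and, for every $k\ge1$, $\tau_k<\infty$ a.s. -/

import Mathlib

open MeasureTheory ProbabilityTheory

namespace ExcitedWalk

noncomputable section

/-- The inclusion of the lattice `ℤ^d` into `ℝ^d` with its Euclidean norm. -/
def latticeVec {d : ℕ} (x : Fin d → ℤ) : EuclideanSpace ℝ (Fin d) :=
  WithLp.toLp 2 (fun i => (x i : ℝ))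

variable {d : ℕ} {Ω : Type*} {mΩ : MeasurableSpace Ω}

/-- The jump `X_{n+1} - X_n`, as a vector of `ℝ^d`. -/
def jump (X : ℕ → Ω → Fin d → ℤ) (n : ℕ) (ω : Ω) : EuclideanSpace ℝ (Fin d) :=
  latticeVec (X (n + 1) ω - X n ω)

/-- Condition B: the jumps are bounded by a constant. -/
def ConditionB (μ : Measure Ω) (X : ℕ → Ω → Fin d → ℤ) : Prop :=
  ∃ K : ℝ, 0 < K ∧ ∀ᵐ ω ∂μ, ∀ n, ‖jump X n ω‖ ≤ K

/-- Condition C⁺ with respect to `ℓ`: no conditional drift at an already visited site, and a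
conditional drift of at least `lam` in direction `ℓ` at a site visited for the first time. -/
def ConditionCPlus (μ : Measure Ω) (ℱ : Filtration ℕ mΩ) (ℓ : EuclideanSpace ℝ (Fin d))
    (X : ℕ → Ω → Fin d → ℤ) : Prop :=
  ∃ lam : ℝ, 0 < lam ∧ ∀ n, ∀ᵐ ω ∂μ,
    ((∃ k < n, X k ω = X n ω) → (μ[jump X n | ℱ n]) ω = 0) ∧
    ((∀ k < n, X k ω ≠ X n ω) → lam ≤ inner ℝ ((μ[jump X n | ℱ n]) ω) ℓ)

/-- Condition E with respect to `ℓ` (uniform ellipticity). -/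
def ConditionE (μ : Measure Ω) (ℱ : Filtration ℕ mΩ) (ℓ : EuclideanSpace ℝ (Fin d))
    (X : ℕ → Ω → Fin d → ℤ) : Prop :=
  ∃ h r : ℝ, 0 < h ∧ 0 < r ∧ ∀ n,
    (∀ᵐ ω ∂μ, h ≤ (μ⟦{ω' | r < inner ℝ (jump X n ω') ℓ} | ℱ n⟧) ω) ∧
    ∀ ℓ' : EuclideanSpace ℝ (Fin d), ‖ℓ'‖ = 1 →
      ∀ᵐ ω ∂μ, (μ[jump X n | ℱ n]) ω = 0 →
        h ≤ (μ⟦{ω' | r < inner ℝ (jump X n ω') ℓ'} | ℱ n⟧) ω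

/-- `X` is a generalized excited random walk in direction `ℓ`, with respect to the filtration
`ℱ`, started at the origin. -/
structure IsGeneralizedExcitedWalk (μ : Measure Ω) (ℱ : Filtration ℕ mΩ)
    (ℓ : EuclideanSpace ℝ (Fin d)) (X : ℕ → Ω → Fin d → ℤ) : Prop where
  direction : ‖ℓ‖ = 1
  adapted : Adapted ℱ X
  start : ∀ᵐ ω ∂μ, X 0 ω = 0
  condB : ConditionB μ X
  condCPlus : ConditionCPlus μ ℱ ℓ X
  condE : ConditionE μ ℱ ℓ X

/-! The regeneration structure. It only depends on the real path `p n = X_n · ℓ`. All times take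
values in `ℕ∞`, where the infimum of the empty set is `⊤`. -/

/-- The path `p` seen from time `s` on. -/
def shift (s : ℕ) (p : ℕ → ℝ) : ℕ → ℝ := fun i => p (s + i)

/-- `T_u`, the first time `k ≥ 1` with `p k ≥ u`. -/
def hitTime (p : ℕ → ℝ) (u : EReal) : ℕ∞ :=
  sInf {t : ℕ∞ | ∃ k : ℕ, t = k ∧ 1 ≤ k ∧ u ≤ (p k : EReal)}

/-- `D̄`, the first time the path is strictly below its initial value. -/
def backtrackTime (p : ℕ → ℝ) : ℕ∞ :=
  sInf {t : ℕ∞ | ∃ m : ℕ, t = m ∧ p m < p 0}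

/-- The supremum of the path up to the (possibly infinite) time `t`. -/
def runningSup (p : ℕ → ℝ) (t : ℕ∞) : EReal :=
  ⨆ i : ℕ, ⨆ _ : (i : ℕ∞) ≤ t, (p i : EReal)

/-- The pair `(S_k, D_k)`: `S_0 = D_0 = 0`, and, with `R_k = sup {p i : 0 ≤ i ≤ D_k}`,
`S_{k+1} = T_{R_k + 1}` and `D_{k+1} = D̄ ∘ θ_{S_{k+1}} + S_{k+1}`
(which is `⊤` when `S_{k+1} = ⊤`). -/
def attempt (p : ℕ → ℝ) : ℕ → ℕ∞ × ℕ∞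
  | 0 => (0, 0)
  | k + 1 =>
    let S : ℕ∞ := hitTime p (runningSup p (attempt p k).2 + 1)
    (S, backtrackTime (shift S.toNat p) + S)

/-- `κ`, the first index `n` with `S_n < ∞` and `D_n = ∞`. -/
def successIndex (p : ℕ → ℝ) : ℕ∞ :=
  sInf {t : ℕ∞ | ∃ n : ℕ, t = n ∧ (attempt p n).1 < ⊤ ∧ (attempt p n).2 = ⊤}

/-- The first regeneration time `τ_1 = S_κ` of the path `p`, infinite if `κ = ∞`. -/
def firstRegeneration (p : ℕ → ℝ) : ℕ∞ :=
  if successIndex p = ⊤ then ⊤ else (attempt p (successIndex p).toNat).1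

/-- The regeneration times of the path `p`: with the convention `τ_0 = 0`, the recursion
`τ_{n+1} = τ_n + τ_1 (p (τ_n + ·))`, which is `⊤` when `τ_n = ⊤`. -/
def regeneration (p : ℕ → ℝ) : ℕ → ℕ∞
  | 0 => 0
  | n + 1 => regeneration p n + firstRegeneration (shift (regeneration p n).toNat p)

theorem regeneration_one (p : ℕ → ℝ) : regeneration p 1 = firstRegeneration p := by
  have h : shift 0 p = p := by funext i; simp [shift]
  simp [regeneration, h]

/-- The regeneration time `τ_k` of the process `X` in direction `ℓ`. -/
def regTime (ℓ : EuclideanSpace ℝ (Fin d)) (X : ℕ → Ω → Fin d → ℤ) (k : ℕ) (ω : Ω) : ℕ∞ :=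
  regeneration (fun n => inner ℝ (latticeVec (X n ω)) ℓ) k

/-- The σ-algebra `𝒢₀^(k)`, `k ≥ 1`, of the events up to the regeneration time `τ_k`: it is
generated by the events `{τ_1 = n_1} ∩ ⋯ ∩ {τ_k = n_k} ∩ A` with `n_1 < ⋯ < n_k` and
`A ∈ ℱ_{n_k}`. -/
@[reducible] def regSigma (ℱ : Filtration ℕ mΩ) (ℓ : EuclideanSpace ℝ (Fin d))
    (X : ℕ → Ω → Fin d → ℤ) (k : ℕ) : MeasurableSpace Ω :=
  MeasurableSpace.generateFrom
    {s | ∃ (n : ℕ → ℕ) (A : Set Ω), StrictMonoOn n (Set.Icc 1 k) ∧ MeasurableSet[ℱ (n k)] A ∧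
      s = {ω | ∀ i ∈ Set.Icc 1 k, regTime ℓ X i ω = n i} ∩ A}

/-! Measurability: `𝒢₀^(k)` is a sub-σ-algebra, so that conditioning on it is meaningful. -/

theorem measurable_sInf_coe {α : Type*} [MeasurableSpace α] {P : ℕ → α → Prop}
    (hP : ∀ k, MeasurableSet {a | P k a}) :
    Measurable fun a => sInf {t : ℕ∞ | ∃ k : ℕ, t = k ∧ P k a} := by
  classical
  have hb : BorelSpace ℕ∞ := ⟨by
    refine le_antisymm (fun s _ => ?_) (fun s _ => trivial)
    let _ : MeasurableSpace ℕ∞ := borel ℕ∞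
    have _ : BorelSpace ℕ∞ := ⟨rfl⟩
    exact (Set.to_countable s).measurableSet⟩
  have h : (fun a => sInf {t : ℕ∞ | ∃ k : ℕ, t = k ∧ P k a}) =
      fun a => ⨅ k : ℕ, (if P k a then (k : ℕ∞) else ⊤) := by
    funext a
    apply le_antisymm
    · refine le_iInf fun k => ?_
      split_ifs with hk
      · exact sInf_le ⟨k, rfl, hk⟩
      · exact le_top
    · refine le_sInf ?_
      rintro t ⟨k, rfl, hk⟩
      exact (iInf_le _ k).trans (by simp [hk])
  rw [h]
  exact Measurable.iInf fun k => Measurable.ite (hP k) measurable_const measurable_const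

theorem measurable_eval {α β : Type*} [MeasurableSpace α] [MeasurableSpace β] {g : α → ℕ → β}
    (hg : ∀ n, Measurable fun a => g a n) {N : α → ℕ} (hN : Measurable N) :
    Measurable fun a => g a (N a) :=
  (measurable_from_prod_countable_right (f := fun x : ℕ × α => g x.2 x.1) hg).comp
    (hN.prodMk measurable_id)

section

variable {α : Type*} [MeasurableSpace α] {f : α → ℕ → ℝ}

theorem measurable_shift (hf : ∀ n, Measurable fun a => f a n) {N : α → ℕ∞}
    (hN : Measurable N) (i : ℕ) : Measurable fun a => shift (N a).toNat (f a) i :=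
  measurable_eval hf (N := fun a => (N a).toNat + i)
    ((measurable_of_countable fun t : ℕ∞ => t.toNat + i).comp hN)

theorem measurable_attempt (hf : ∀ n, Measurable fun a => f a n) (k : ℕ) :
    Measurable fun a => attempt (f a) k := by
  induction k with
  | zero => exact measurable_const
  | succ k ih =>
    have hR : Measurable fun a => runningSup (f a) (attempt (f a) k).2 := by
      classical
      have h : (fun a => runningSup (f a) (attempt (f a) k).2) = fun a => ⨆ i : ℕ,
          if (i : ℕ∞) ≤ (attempt (f a) k).2 then (f a i : EReal) else ⊥ := by
        funext a
        refine iSup_congr fun i => ?_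
        split_ifs with hi <;> simp [hi]
      rw [h]
      exact Measurable.iSup fun i => Measurable.ite
        (ih.snd (MeasurableSet.of_discrete (s := Set.Ici (i : ℕ∞)))) (hf i).coe_real_ereal
        measurable_const
    have hS : Measurable fun a => hitTime (f a) (runningSup (f a) (attempt (f a) k).2 + 1) := by
      refine measurable_sInf_coe fun j => ?_
      refine (MeasurableSet.const _).inter (measurableSet_le ?_ (hf j).coe_real_ereal)
      exact hR.add measurable_const
    refine hS.prodMk ?_
    have hB := measurable_sInf_coe (P := fun m a =>
      shift (hitTime (f a) (runningSup (f a) (attempt (f a) k).2 + 1)).toNat (f a) m <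
      shift (hitTime (f a) (runningSup (f a) (attempt (f a) k).2 + 1)).toNat (f a) 0)
      fun m => measurableSet_lt (measurable_shift hf hS m) (measurable_shift hf hS 0)
    exact (measurable_of_countable fun x : ℕ∞ × ℕ∞ => x.1 + x.2).comp (hB.prodMk hS)

theorem measurable_firstRegeneration (hf : ∀ n, Measurable fun a => f a n) :
    Measurable fun a => firstRegeneration (f a) := by
  have hκ : Measurable fun a => successIndex (f a) := by
    refine measurable_sInf_coe fun n => ?_
    exact ((measurable_attempt hf n).fst (MeasurableSet.of_discrete (s := Set.Iio ⊤))).inter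
      ((measurable_attempt hf n).snd (MeasurableSet.of_discrete (s := {⊤})))
  refine Measurable.ite (hκ (MeasurableSet.of_discrete (s := {⊤}))) measurable_const ?_
  exact (measurable_eval (measurable_attempt hf)
    ((measurable_of_countable ENat.toNat).comp hκ)).fst

theorem measurable_regeneration (hf : ∀ n, Measurable fun a => f a n) (k : ℕ) :
    Measurable fun a => regeneration (f a) k := by
  induction k with
  | zero => exact measurable_const
  | succ k ih =>
    exact (measurable_of_countable fun x : ℕ∞ × ℕ∞ => x.1 + x.2).comp
      (ih.prodMk (measurable_firstRegeneration (measurable_shift hf ih)))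

end

theorem measurable_regTime {ℱ : Filtration ℕ mΩ} (ℓ : EuclideanSpace ℝ (Fin d))
    {X : ℕ → Ω → Fin d → ℤ} (hX : Adapted ℱ X) (k : ℕ) : Measurable (regTime ℓ X k) := by
  refine measurable_regeneration (fun n => ?_) k
  exact (measurable_of_countable fun x : Fin d → ℤ => inner ℝ (latticeVec x) ℓ).comp
    ((hX n).mono (ℱ.le n) le_rfl)

theorem regSigma_le {ℱ : Filtration ℕ mΩ} (ℓ : EuclideanSpace ℝ (Fin d))
    {X : ℕ → Ω → Fin d → ℤ} (hX : Adapted ℱ X) (k : ℕ) : regSigma ℱ ℓ X k ≤ mΩ := by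
  refine MeasurableSpace.generateFrom_le ?_
  rintro s ⟨n, A, -, hA, rfl⟩
  refine MeasurableSet.inter ?_ (ℱ.le _ A hA)
  simp only [Set.ofPred_forall]
  exact MeasurableSet.iInter fun i => MeasurableSet.iInter fun _ =>
    measurable_regTime ℓ hX i (MeasurableSet.of_discrete (s := {(n i : ℕ∞)}))

end

end ExcitedWalk

/-! The drift in direction `ℓ` is available only at fresh sites, so the key point is that the walk
meets many of them: with probability stretched-exponentially close to one it visits more than
`n^(1/2 + a)` sites in `n` steps (`WalkBounds.exists_range_bound`).

The tool is `lyap`, `f(w) = (‖w‖² + b²)^((1-ε)/2)`, applied to the displacement from a target site.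
With exponent one, convexity of the norm would make radial fluctuations harmless. Lowering the
exponent by `ε` costs at most order `ε K²`, and this is paid by the variance transverse to `w`: a
transverse direction exists since `d ≥ 2`, and ellipticity bounds the variance below at visited
sites. So `f` grows on average at visited sites, by a fixed amount at the target. At fresh sites it
may lose, but the loss decays like `‖w‖^(-ε)`, so `M` distinct sites cost only `O(M^(1-η))`
together, with `η = ε / (2d)`. Hence a walk confined to radius `ρ` with at most `ρ - 1` visited
sites sees each site about `ρ^(1-η)` times at most, with an exponential tail
(`WalkBounds.exists_visits_bound`). If the range were below `n^(1/2 + a)`, the total drift would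
have at most this order, concentration would confine the walk to radius `n^(1/2 + 2a)`, and some
site would be visited `n^(1/2 - a)` times, which is too often when `a` is small.

Sites at or above the height of a record are unvisited when the record is set. As long as the walk
stays there, each new site gives drift, and the drift of order `n^(1/2 + a)` beats the diffusive
fluctuations (`WalkBounds.exists_height_bound`). So a record is never undercut with probability at
least some `p > 0`, and a late undercut is unlikely.

The times `S_k` are stopping times and records. About `m^(1/8)` attempts, each of length at most
`m^(1/8)` if it fails, raise the running maximum by `O(m^(1/4))`, while the walk has climbed more
than `√m` by time `m`; since each attempt succeeds with probability at least `p`, this gives the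
tail of `τ_1`. Finally, an event of `𝒢₀^(k)` on `{τ_k = n}` has the form `B ∩ {no backtracking after
n}` with `B ∈ ℱ_n` (`isRegenerationEvent_of_regSigma`). Its probability is at least `p` times that
of `B`, so bounds relative to `B` carry over to later regenerations. -/

namespace ExcitedWalk
noncomputable section

/-! ### Conditional expectation -/

section CondExp

variable {Ω : Type*} {m mΩ : MeasurableSpace Ω} {μ : Measure Ω}

/-- A conditional lower bound may be integrated against a nonnegative bounded weight. -/
theorem integral_mul_le_of_le_condExp [IsProbabilityMeasure μ] (hm : m ≤ mΩ) {g φ ψ : Ω → ℝ}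
    (hg : StronglyMeasurable[m] g) (hg0 : 0 ≤ᵐ[μ] g) {C : ℝ} (hgC : ∀ᵐ ω ∂μ, g ω ≤ C)
    (hφ : Integrable φ μ) (hψ : Integrable ψ μ) (h : ψ ≤ᵐ[μ] μ[φ | m]) :
    ∫ ω, g ω * ψ ω ∂μ ≤ ∫ ω, g ω * φ ω ∂μ := by
  have hb : ∀ᵐ ω ∂μ, ‖g ω‖ ≤ C := by
    filter_upwards [hg0, hgC] with ω h0 hC
    rwa [Real.norm_of_nonneg h0]
  have hgm : AEStronglyMeasurable g μ := (hg.mono hm).aestronglyMeasurable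
  have hi : Integrable (g * φ) μ := hφ.bdd_mul hgm hb
  have e : ∫ ω, g ω * φ ω ∂μ = ∫ ω, g ω * (μ[φ | m]) ω ∂μ := by
    rw [← integral_condExp hm (f := fun ω => g ω * φ ω)]
    exact integral_congr_ae (condExp_mul_of_stronglyMeasurable_left hg hi hφ)
  rw [e]
  refine integral_mono_ae (hψ.bdd_mul hgm hb) (integrable_condExp.bdd_mul hgm hb) ?_
  filter_upwards [hg0, h] with ω h0 h1
  exact mul_le_mul_of_nonneg_left h1 h0

/-- A conditional upper bound may be integrated against a nonnegative bounded weight. -/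
theorem integral_mul_le_of_condExp_le [IsProbabilityMeasure μ] (hm : m ≤ mΩ) {g φ ψ : Ω → ℝ}
    (hg : StronglyMeasurable[m] g) (hg0 : 0 ≤ᵐ[μ] g) {C : ℝ} (hgC : ∀ᵐ ω ∂μ, g ω ≤ C)
    (hφ : Integrable φ μ) (hψ : Integrable ψ μ) (h : μ[φ | m] ≤ᵐ[μ] ψ) :
    ∫ ω, g ω * φ ω ∂μ ≤ ∫ ω, g ω * ψ ω ∂μ := by
  have := integral_mul_le_of_le_condExp hm hg hg0 hgC hφ.neg hψ.neg (by
    filter_upwards [h, condExp_neg φ m] with ω h1 h2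
    rw [h2]; simpa using h1)
  simpa [integral_neg] using this

/-- A parameter with countably many values that is measurable with respect to the conditioning
σ-algebra may be frozen. -/
theorem condExp_freeze [IsFiniteMeasure μ] {ι : Type*} [Countable ι]
    [MeasurableSpace ι] [MeasurableSingletonClass ι] {W : Ω → ι} (hW : Measurable[m] W)
    {φ : ι → Ω → ℝ} (hφ : ∀ w, Integrable (φ w) μ) (hφW : Integrable (fun ω => φ (W ω) ω) μ) :
    ∀ᵐ ω ∂μ, (μ[fun ω => φ (W ω) ω | m]) ω = (μ[φ (W ω) | m]) ω := by
  have key : ∀ w, ∀ᵐ ω ∂μ, W ω = w →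
      (μ[fun ω => φ (W ω) ω | m]) ω = (μ[φ w | m]) ω := by
    intro w
    have hs : MeasurableSet[m] (W ⁻¹' {w}) := hW (measurableSet_singleton w)
    have h1 := condExp_indicator (m := m) hφW hs
    have h2 := condExp_indicator (m := m) (hφ w) hs
    have h3 : (W ⁻¹' {w}).indicator (fun ω => φ (W ω) ω) = (W ⁻¹' {w}).indicator (φ w) := by
      ext ω
      by_cases h : W ω = w <;> simp [Set.indicator, h]
    rw [h3] at h1
    filter_upwards [h1, h2] with ω a b hw
    have : ω ∈ W ⁻¹' {w} := hw
    rw [Set.indicator_of_mem this] at a b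
    rw [← a, ← b]
  filter_upwards [ae_all_iff.2 key] with ω h
  exact h _ rfl

/-- `e^x ≤ 1 + x + x²` on `[-1, 1]`. -/
theorem exp_le_one_add_add_sq {x : ℝ} (hx : |x| ≤ 1) : Real.exp x ≤ 1 + x + x ^ 2 := by
  have := Real.abs_exp_sub_one_sub_id_le hx
  linarith [le_abs_self (Real.exp x - 1 - x)]

/-- Exponential moment of one bounded increment. -/
theorem condExp_exp_le [IsProbabilityMeasure μ] (hm : m ≤ mΩ) {ξ a : Ω → ℝ} {K θ : ℝ}
    (hξm : AEStronglyMeasurable ξ μ) (hξ : ∀ᵐ ω ∂μ, |ξ ω| ≤ K) (ha : μ[ξ | m] ≤ᵐ[μ] a)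
    (hθ : 0 ≤ θ) (hθK : θ * K ≤ 1) :
    μ[fun ω => Real.exp (θ * ξ ω) | m] ≤ᵐ[μ]
      fun ω => Real.exp (θ * a ω + θ ^ 2 * K ^ 2) := by
  have hξi : Integrable ξ μ := Integrable.of_bound hξm K hξ
  have hi : Integrable (fun ω => Real.exp (θ * ξ ω)) μ := by
    refine Integrable.of_bound (by fun_prop) (Real.exp (θ * K)) ?_
    filter_upwards [hξ] with ω h
    rw [Real.norm_of_nonneg (Real.exp_pos _).le]
    exact Real.exp_le_exp.2 (mul_le_mul_of_nonneg_left ((le_abs_self _).trans h) hθ)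
  have hc : Integrable (fun _ : Ω => (1 + θ ^ 2 * K ^ 2 : ℝ)) μ := integrable_const _
  have hle : (fun ω => Real.exp (θ * ξ ω)) ≤ᵐ[μ] (fun _ => (1 + θ ^ 2 * K ^ 2 : ℝ)) + θ • ξ := by
    filter_upwards [hξ] with ω h
    have h1 : |θ * ξ ω| ≤ θ * K := by
      rw [abs_mul, abs_of_nonneg hθ]; exact mul_le_mul_of_nonneg_left h hθ
    have h2 := exp_le_one_add_add_sq (h1.trans hθK)
    have h3 : (θ * ξ ω) ^ 2 ≤ (θ * K) ^ 2 := sq_le_sq' (by linarith [abs_le.1 h1]) (abs_le.1 h1).2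
    simp only [Pi.add_apply, Pi.smul_apply, smul_eq_mul]
    nlinarith
  filter_upwards [condExp_mono (m := m) hi (hc.add (hξi.smul θ)) hle,
    condExp_add hc (hξi.smul θ) m, condExp_smul θ ξ m (μ := μ), ha] with ω h1 h2 h3 h4
  rw [h2, Pi.add_apply, h3, condExp_const hm, Pi.smul_apply, smul_eq_mul] at h1
  have h5 := Real.add_one_le_exp (θ * a ω + θ ^ 2 * K ^ 2)
  nlinarith [mul_le_mul_of_nonneg_left h4 hθ]

end CondExp

/-! ### A concentration inequality -/

section Azuma

variable {Ω : Type*} {mΩ : MeasurableSpace Ω} {μ : Measure Ω} [IsProbabilityMeasure μ]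
  {ℱ : Filtration ℕ mΩ}

theorem measurable_sum_of_adapted {ξ : ℕ → Ω → ℝ} (hξ : ∀ n, Measurable[ℱ (n + 1)] (ξ n))
    (s n : ℕ) : Measurable[ℱ (s + n)] fun ω => ∑ i ∈ Finset.range n, ξ (s + i) ω := by
  refine Finset.measurable_sum _ fun i hi => ?_
  have : s + i + 1 ≤ s + n := by have := Finset.mem_range.1 hi; omega
  exact (hξ (s + i)).mono (ℱ.mono this) le_rfl

variable {ξ a : ℕ → Ω → ℝ} {K Ka θ : ℝ}

/-- By `condExp_exp_le` each factor of the exponential has conditional expectation at most one, so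
the products form a supermartingale started at time `s`. The indicator of `A` makes the bound
relative to every event of the past. -/
theorem integral_exp_sum_le (hξm : ∀ n, Measurable[ℱ (n + 1)] (ξ n))
    (hξ : ∀ᵐ ω ∂μ, ∀ n, |ξ n ω| ≤ K) (ham : ∀ n, Measurable[ℱ n] (a n))
    (haK : ∀ n ω, |a n ω| ≤ Ka) (ha : ∀ n, μ[ξ n | ℱ n] ≤ᵐ[μ] a n)
    (hθ : 0 ≤ θ) (hθK : θ * K ≤ 1) {s : ℕ} {A : Set Ω} (hA : MeasurableSet[ℱ s] A) (n : ℕ) :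
    ∫ ω, A.indicator 1 ω * Real.exp (∑ i ∈ Finset.range n,
      (θ * ξ (s + i) ω - θ * a (s + i) ω - θ ^ 2 * K ^ 2)) ∂μ ≤ μ.real A := by
  induction n with
  | zero => simp [integral_indicator_one (ℱ.le s A hA)]
  | succ n ih =>
    refine le_trans ?_ ih
    set Sn : Ω → ℝ := fun ω => ∑ i ∈ Finset.range n,
      (θ * ξ (s + i) ω - θ * a (s + i) ω - θ ^ 2 * K ^ 2) with hSn
    have hSm : Measurable[ℱ (s + n)] Sn :=
      measurable_sum_of_adapted (ℱ := ℱ)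
        (ξ := fun i ω => θ * ξ i ω - θ * a i ω - θ ^ 2 * K ^ 2) (fun i => by
        have h1 := hξm i
        have h2 := (ham i).mono (ℱ.mono (Nat.le_succ i)) le_rfl
        exact ((h1.const_mul θ).sub (h2.const_mul θ)).sub_const _) s n
    have hAm : Measurable[ℱ (s + n)] (A.indicator (1 : Ω → ℝ)) :=
      Measurable.indicator measurable_const (ℱ.mono (Nat.le_add_right s n) _ hA)
    -- Of the last factor, everything except `exp (θ ξ)` is known at time `s + n` and goes into the
    -- weight `g`.
    set g : Ω → ℝ := fun ω => A.indicator 1 ω *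
      Real.exp (Sn ω - θ * a (s + n) ω - θ ^ 2 * K ^ 2) with hg
    have hgm : Measurable[ℱ (s + n)] g :=
      hAm.mul (Real.measurable_exp.comp ((hSm.sub ((ham (s + n)).const_mul θ)).sub_const _))
    have hK0 : ∀ᵐ ω ∂μ, ∀ i, θ * ξ i ω - θ * a i ω - θ ^ 2 * K ^ 2 ≤ θ * K + θ * Ka := by
      filter_upwards [hξ] with ω h i
      have h1 := mul_le_mul_of_nonneg_left ((le_abs_self _).trans (h i)) hθ
      have h2 := mul_le_mul_of_nonneg_left ((neg_abs_le (a i ω)).trans' (neg_le_neg (haK i ω))) hθ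
      nlinarith [sq_nonneg (θ * K)]
    have hSb : ∀ᵐ ω ∂μ, Sn ω ≤ n * (θ * K + θ * Ka) := by
      filter_upwards [hK0] with ω h
      calc Sn ω ≤ ∑ i ∈ Finset.range n, (θ * K + θ * Ka) := Finset.sum_le_sum fun i _ => h _
        _ = _ := by simp [mul_add]
    have hgb : ∀ᵐ ω ∂μ, g ω ≤ Real.exp (n * (θ * K + θ * Ka) + θ * Ka) := by
      filter_upwards [hSb] with ω h
      have h2 := mul_le_mul_of_nonneg_left
        ((neg_abs_le (a (s + n) ω)).trans' (neg_le_neg (haK (s + n) ω))) hθ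
      by_cases hω : ω ∈ A
      · simp only [hg, Set.indicator_of_mem hω, Pi.one_apply, one_mul]
        exact Real.exp_le_exp.2 (by nlinarith [sq_nonneg (θ * K)])
      · simp only [hg, Set.indicator_of_notMem hω, zero_mul]; positivity
    have hg0 : 0 ≤ᵐ[μ] g := by
      refine Filter.Eventually.of_forall fun ω => ?_
      simp only [hg, Pi.zero_apply]
      exact mul_nonneg (Set.indicator_nonneg (fun _ _ => zero_le_one) _) (Real.exp_pos _).le
    have hξM : Measurable (ξ (s + n)) := (hξm _).mono (ℱ.le _) le_rfl
    have haM : Measurable (a (s + n)) := (ham _).mono (ℱ.le _) le_rfl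
    have hξn : ∀ᵐ ω ∂μ, |ξ (s + n) ω| ≤ K := by filter_upwards [hξ] with ω h using h _
    have hi : Integrable (fun ω => Real.exp (θ * ξ (s + n) ω)) μ := by
      refine Integrable.of_bound (by fun_prop) (Real.exp (θ * K)) ?_
      filter_upwards [hξn] with ω h
      rw [Real.norm_of_nonneg (Real.exp_pos _).le]
      exact Real.exp_le_exp.2 (mul_le_mul_of_nonneg_left ((le_abs_self _).trans h) hθ)
    have hia : Integrable (fun ω => Real.exp (θ * a (s + n) ω + θ ^ 2 * K ^ 2)) μ := by
      refine Integrable.of_bound (by fun_prop) (Real.exp (θ * Ka + θ ^ 2 * K ^ 2)) ?_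
      refine Filter.Eventually.of_forall fun ω => ?_
      rw [Real.norm_of_nonneg (Real.exp_pos _).le]
      exact Real.exp_le_exp.2 (by
        have := mul_le_mul_of_nonneg_left ((le_abs_self _).trans (haK (s + n) ω)) hθ
        linarith)
    have := integral_mul_le_of_condExp_le (ℱ.le (s + n)) hgm.stronglyMeasurable hg0 hgb hi hia
      (condExp_exp_le (ℱ.le _) hξM.aestronglyMeasurable hξn (ha (s + n)) hθ hθK)
    refine le_trans (le_of_eq ?_) (this.trans (le_of_eq ?_))
    · refine integral_congr_ae (Filter.Eventually.of_forall fun ω => ?_)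
      simp only [hg, hSn, Finset.sum_range_succ, mul_assoc, ← Real.exp_add]
      congr 2; ring
    · refine integral_congr_ae (Filter.Eventually.of_forall fun ω => ?_)
      simp only [hg, mul_assoc, ← Real.exp_add]
      congr 2; ring

/-- Chernoff bound for a sum of bounded increments with controlled conditional means. -/
theorem measureReal_sum_ge_le (hξm : ∀ n, Measurable[ℱ (n + 1)] (ξ n))
    (hξ : ∀ᵐ ω ∂μ, ∀ n, |ξ n ω| ≤ K) (ham : ∀ n, Measurable[ℱ n] (a n))
    (haK : ∀ n ω, |a n ω| ≤ Ka) (ha : ∀ n, μ[ξ n | ℱ n] ≤ᵐ[μ] a n)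
    (hθ : 0 ≤ θ) (hθK : θ * K ≤ 1) {s : ℕ} {A : Set Ω} (hA : MeasurableSet[ℱ s] A) (n : ℕ)
    (x : ℝ) :
    μ.real (A ∩ {ω | ∑ i ∈ Finset.range n, a (s + i) ω + x ≤
      ∑ i ∈ Finset.range n, ξ (s + i) ω}) ≤
      Real.exp (-(θ * x) + n * (θ ^ 2 * K ^ 2)) * μ.real A := by
  set E := A ∩ {ω | ∑ i ∈ Finset.range n, a (s + i) ω + x ≤ ∑ i ∈ Finset.range n, ξ (s + i) ω}
  set F : Ω → ℝ := fun ω => A.indicator 1 ω * Real.exp (∑ i ∈ Finset.range n,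
      (θ * ξ (s + i) ω - θ * a (s + i) ω - θ ^ 2 * K ^ 2)) with hF
  have hAM := ℱ.le s A hA
  have hξM : ∀ i, Measurable (ξ i) := fun i => (hξm _).mono (ℱ.le _) le_rfl
  have haM : ∀ i, Measurable (a i) := fun i => (ham _).mono (ℱ.le _) le_rfl
  have hEm : MeasurableSet E := by
    refine hAM.inter (measurableSet_le ?_ ?_)
    · exact (Finset.measurable_sum _ fun i _ => haM _).add_const _
    · exact Finset.measurable_sum _ fun i _ => hξM _
  have hFm : Measurable F := by
    refine (measurable_one.indicator hAM).mul (Real.measurable_exp.comp ?_)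
    exact Finset.measurable_sum _ fun i _ =>
      (((hξM _).const_mul θ).sub ((haM _).const_mul θ)).sub_const _
  have hFi : Integrable F μ := by
    refine Integrable.of_bound hFm.aestronglyMeasurable (Real.exp (n * (θ * K + θ * Ka))) ?_
    filter_upwards [hξ] with ω h
    by_cases hω : ω ∈ A
    · simp only [hF, Set.indicator_of_mem hω, Pi.one_apply, one_mul]
      rw [Real.norm_of_nonneg (Real.exp_pos _).le]
      refine Real.exp_le_exp.2 ?_
      calc _ ≤ ∑ i ∈ Finset.range n, (θ * K + θ * Ka) := Finset.sum_le_sum fun i _ => by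
            have h1 := mul_le_mul_of_nonneg_left ((le_abs_self _).trans (h (s + i))) hθ
            have h2 := mul_le_mul_of_nonneg_left
              ((neg_abs_le (a (s + i) ω)).trans' (neg_le_neg (haK (s + i) ω))) hθ
            nlinarith [sq_nonneg (θ * K)]
        _ = _ := by simp [mul_add]
    · simp only [hF, Set.indicator_of_notMem hω, zero_mul]
      simp; positivity
  have key := integral_exp_sum_le hξm hξ ham haK ha hθ hθK hA n
  have h1 : ∫ ω, E.indicator (fun _ => Real.exp (θ * x - n * (θ ^ 2 * K ^ 2))) ω ∂μ ≤
      ∫ ω, F ω ∂μ := by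
    refine integral_mono ((integrable_const _).indicator hEm) hFi fun ω => ?_
    by_cases hω : ω ∈ E
    · have hωA : ω ∈ A := hω.1
      have hω2 : ∑ i ∈ Finset.range n, a (s + i) ω + x ≤ ∑ i ∈ Finset.range n, ξ (s + i) ω := hω.2
      simp only [hF, Set.indicator_of_mem hω, Set.indicator_of_mem hωA, Pi.one_apply, one_mul]
      refine Real.exp_le_exp.2 ?_
      simp only [Finset.sum_sub_distrib, ← Finset.mul_sum, Finset.sum_const, Finset.card_range,
        nsmul_eq_mul]
      have := mul_le_mul_of_nonneg_left hω2 hθ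
      rw [mul_add] at this
      linarith
    · rw [Set.indicator_of_notMem hω]
      exact mul_nonneg (Set.indicator_nonneg (fun _ _ => zero_le_one) _) (Real.exp_pos _).le
  rw [integral_indicator_const _ hEm, smul_eq_mul] at h1
  have h2 := h1.trans key
  have h3 : Real.exp (-(θ * x) + n * (θ ^ 2 * K ^ 2)) =
      (Real.exp (θ * x - n * (θ ^ 2 * K ^ 2)))⁻¹ := by rw [← Real.exp_neg]; congr 1; ring
  rw [h3, inv_mul_eq_div, le_div_iff₀ (Real.exp_pos _)]
  exact h2

end Azuma

end
end ExcitedWalk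

namespace ExcitedWalk
noncomputable section

/-! ### The Lyapunov function -/

/-- Write `(1 + t)^p = exp (p log (1 + t))` and expand both the logarithm and the exponential to
second order; all cubic errors fit into `3 |t|³`. -/
theorem one_add_rpow_ge {p t : ℝ} (hp0 : 0 ≤ p) (hp : p ≤ 1 / 2) (ht : |t| ≤ 1 / 2) :
    1 + p * t - p * (1 - p) / 2 * t ^ 2 - 3 * |t| ^ 3 ≤ (1 + t) ^ p := by
  have ht1 := abs_le.1 ht
  have hpos : 0 < 1 + t := by linarith
  have ht0 := abs_nonneg t
  set τ := |t| with hτ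
  have hsq : t ^ 2 = τ ^ 2 := (sq_abs t).symm
  obtain ⟨e, he, hlog⟩ : ∃ e, |e| ≤ 2 * τ ^ 3 ∧ Real.log (1 + t) = t - t ^ 2 / 2 + e := by
    refine ⟨Real.log (1 + t) - t + t ^ 2 / 2, ?_, by ring⟩
    have := Real.abs_log_sub_add_sum_range_le (x := -t) (by rw [abs_neg]; linarith) 2
    simp only [Finset.sum_range_succ, Finset.sum_range_zero, abs_neg, ← hτ] at this
    norm_num at this
    have h2 : τ ^ 3 / (1 - τ) ≤ 2 * τ ^ 3 := by
      rw [div_le_iff₀ (by linarith)]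
      nlinarith [pow_nonneg ht0 3]
    refine le_trans (le_of_eq ?_) (this.trans h2)
    congr 1; ring
  rw [Real.rpow_def_of_pos hpos, hlog]
  -- `δ` is the part of the exponent beyond first order. It enters linearly through a lower bound,
  -- while `|δ| ≤ t²` makes its product with `p t` cubic.
  set δ := p * (-(t ^ 2) / 2 + e) with hδ
  have hy : (t - t ^ 2 / 2 + e) * p = p * t + δ := by rw [hδ]; ring
  rw [hy]
  have hτ3 : τ ^ 3 ≤ τ ^ 2 / 2 := by nlinarith [sq_nonneg τ]
  have he' := abs_le.1 he
  have hδabs : |δ| ≤ τ ^ 2 := by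
    rw [hδ, abs_mul, abs_of_nonneg hp0]
    have h1 : |(-(t ^ 2) / 2 + e)| ≤ 2 * τ ^ 2 := by
      rw [abs_le, hsq]; constructor <;> nlinarith
    nlinarith [abs_nonneg (-(t ^ 2) / 2 + e)]
  have hδlow : -(p * t ^ 2 / 2) - τ ^ 3 ≤ δ := by
    rw [hδ]; nlinarith [pow_nonneg ht0 3]
  have hyabs : |p * t + δ| ≤ τ := by
    calc |p * t + δ| ≤ |p * t| + |δ| := abs_add_le _ _
      _ ≤ p * τ + τ ^ 2 := by rw [abs_mul, abs_of_nonneg hp0]; linarith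
      _ ≤ τ := by nlinarith
  have hexp := Real.exp_bound (x := p * t + δ) (by linarith) (n := 3) (by norm_num)
  simp only [Finset.sum_range_succ, Finset.sum_range_zero] at hexp
  norm_num [Nat.factorial] at hexp
  have h3 : |p * t + δ| ^ 3 ≤ τ ^ 3 := pow_le_pow_left₀ (abs_nonneg _) hyabs 3
  have h4 := (abs_le.1 hexp).1
  have h5 : -(τ ^ 3) ≤ 2 * (p * t) * δ := by
    have : |2 * (p * t) * δ| ≤ τ ^ 3 := by
      rw [abs_mul, abs_mul, abs_mul, abs_of_nonneg hp0, abs_two]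
      calc 2 * (p * τ) * |δ| ≤ 1 * τ * τ ^ 2 := by
            refine mul_le_mul ?_ hδabs (abs_nonneg _) (by positivity)
            nlinarith
        _ = τ ^ 3 := by ring
    exact (abs_le.1 this).1
  nlinarith [sq_nonneg δ]

variable {E : Type*} [NormedAddCommGroup E] [InnerProductSpace ℝ E]

/-- The function `(‖w‖² + b²)^((1-ε)/2)`. -/
def lyap (ε b : ℝ) (w : E) : ℝ := (‖w‖ ^ 2 + b ^ 2) ^ ((1 - ε) / 2)

/-- The second order coefficient of `lyap`. -/
def lyapCoeff (ε b : ℝ) (w : E) : ℝ :=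
  (1 - ε) / 2 * (‖w‖ ^ 2 + b ^ 2) ^ ((1 - ε) / 2 - 1)

/-- Subtract from `ξ` its component along `u`: this does not change the inner product with `w`, and
Cauchy–Schwarz applies to what is left. -/
theorem inner_sq_add_inner_sq_le {w ξ u : E} {g : ℝ} (hg : 0 < g) (hwg : ‖w‖ ^ 2 ≤ g)
    (hu : ‖u‖ = 1) (huw : inner ℝ u w = 0) :
    inner ℝ w ξ ^ 2 / g + inner ℝ u ξ ^ 2 ≤ ‖ξ‖ ^ 2 := by
  set c := inner ℝ u ξ with hc
  have h1 : inner ℝ w (ξ - c • u) = inner ℝ w ξ := by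
    rw [inner_sub_right, inner_smul_right, (real_inner_comm u w).trans huw]; simp
  have h2 : ‖ξ - c • u‖ ^ 2 = ‖ξ‖ ^ 2 - c ^ 2 := by
    rw [norm_sub_sq_real, inner_smul_right, norm_smul, hu, real_inner_comm, ← hc]
    simp; ring
  have h3 := abs_real_inner_le_norm w (ξ - c • u)
  rw [h1] at h3
  have h4 : inner ℝ w ξ ^ 2 ≤ ‖w‖ ^ 2 * ‖ξ - c • u‖ ^ 2 := by
    rw [← sq_abs, ← mul_pow]
    exact pow_le_pow_left₀ (abs_nonneg _) h3 2
  have h5 : inner ℝ w ξ ^ 2 / g ≤ ‖ξ - c • u‖ ^ 2 := by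
    rw [div_le_iff₀ hg]
    nlinarith [sq_nonneg ‖ξ - c • u‖]
  linarith

/-- Here `y`, `q`, `s` stand for `⟨w, ξ⟩`, `‖ξ‖²` and `√(‖w‖² + b²)`, so that `(2y + q) / s²` is the
relative change of `s²`. Apart from the radial variance `y² / s²`, the second and third order terms
are `O(1/s)`. -/
theorem lyap_scalar_bounds {K y q s : ℝ} (hK : 1 ≤ K) (h6 : 6 * K ≤ s) (hyb : |y| ≤ s * K)
    (hq0 : 0 ≤ q) (hqK : q ≤ K ^ 2) :
    |(2 * y + q) / s ^ 2| ≤ 3 * K / s ∧ y ^ 2 / s ^ 2 ≤ K ^ 2 ∧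
    s ^ 2 * ((2 * y + q) / s ^ 2) ^ 2 / 4 ≤ y ^ 2 / s ^ 2 + 2 * K ^ 3 / s ∧
    s ^ 2 * |(2 * y + q) / s ^ 2| ^ 3 ≤ 27 * K ^ 3 / s := by
  have hspos : 0 < s := by linarith
  have hgpos : 0 < s ^ 2 := by positivity
  have hnum : |2 * y + q| ≤ 3 * K * s := by
    rw [abs_le] at hyb ⊢
    constructor <;> nlinarith
  have htabs : |(2 * y + q) / s ^ 2| ≤ 3 * K / s := by
    rw [abs_div, abs_of_pos hgpos, div_le_div_iff₀ hgpos hspos]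
    nlinarith [mul_le_mul_of_nonneg_right hnum hspos.le]
  refine ⟨htabs, ?_, ?_, ?_⟩
  · rw [div_le_iff₀ hgpos, ← mul_pow, mul_comm, ← sq_abs]
    exact pow_le_pow_left₀ (abs_nonneg _) hyb 2
  · have h1 : s ^ 2 * ((2 * y + q) / s ^ 2) ^ 2 / 4 =
        y ^ 2 / s ^ 2 + (y * q + q ^ 2 / 4) / s ^ 2 := by
      field_simp; ring
    have h2 : (y * q + q ^ 2 / 4) / s ^ 2 ≤ 2 * K ^ 3 / s := by
      rw [div_le_div_iff₀ hgpos hspos]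
      have h3 : y * q ≤ s * K * K ^ 2 :=
        mul_le_mul ((le_abs_self _).trans hyb) hqK hq0 (by positivity)
      have h4 : q ^ 2 ≤ K ^ 4 := by nlinarith
      have h5 : K ^ 4 ≤ K ^ 3 * s := by nlinarith [pow_pos (by linarith : 0 < K) 3]
      have h6 : y * q + q ^ 2 / 4 ≤ 2 * K ^ 3 * s := by nlinarith
      nlinarith [mul_le_mul_of_nonneg_right h6 hspos.le]
    linarith
  · calc s ^ 2 * |(2 * y + q) / s ^ 2| ^ 3 ≤ s ^ 2 * (3 * K / s) ^ 3 := by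
          gcongr
      _ = 27 * K ^ 3 / s := by field_simp; ring

/-- `z` stands for the squared transverse increment. The second order term of the power charges the
radial variance `y² / s²` with weight `1 + ε`; `hort` pays weight one out of `q` and leaves `z`, so
only `ε y² / s² ≤ ε K²` is lost. -/
theorem lyap_scalar {ε K δ y q z s : ℝ} (hK : 1 ≤ K) (hε : 0 < ε) (hε2 : ε ≤ 1 / 2)
    (hεK : ε * K ^ 2 ≤ δ / 4) (h6 : 6 * K ≤ s) (hbK : 328 * K ^ 3 ≤ δ / 4 * s)
    (hyb : |y| ≤ s * K) (hq0 : 0 ≤ q) (hqK : q ≤ K ^ 2) (hort : y ^ 2 / s ^ 2 + z ≤ q) :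
    (1 - ε) / 2 / s ^ 2 * (2 * y + z - δ / 2) ≤
      (1 + (2 * y + q) / s ^ 2) ^ ((1 - ε) / 2) - 1 := by
  have hspos : 0 < s := by linarith
  have hgpos : 0 < s ^ 2 := by positivity
  obtain ⟨htabs, hyg, hgt2, hgt3⟩ := lyap_scalar_bounds hK h6 hyb hq0 hqK
  set t := (2 * y + q) / s ^ 2 with ht
  have htg : s ^ 2 * t = 2 * y + q := by rw [ht]; field_simp
  have ht2 : |t| ≤ 1 / 2 := htabs.trans (by rw [div_le_iff₀ hspos]; linarith)
  have htay := one_add_rpow_ge (p := (1 - ε) / 2) (by linarith) (by linarith) ht2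
  -- `328 = 4 + 27 * 12`: the quadratic and cubic remainders share one `δ / 4`, the other `δ / 4`
  -- being spent on `ε * K ^ 2`.
  have hzs : ∀ c : ℝ, 0 ≤ c → c * K ^ 3 / s ≤ c / 328 * (δ / 4) := fun c hc => by
    rw [div_le_iff₀ hspos]
    have := mul_le_mul_of_nonneg_left hbK hc
    linarith
  have h1 : (1 + ε) / 4 * (s ^ 2 * t ^ 2) ≤ y ^ 2 / s ^ 2 + ε * K ^ 2 + 4 * K ^ 3 / s := by
    have h := mul_le_mul_of_nonneg_left hgt2 (by linarith : 0 ≤ 1 + ε)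
    have h0 : 0 ≤ 2 * K ^ 3 / s := by positivity
    have e4 : 4 * K ^ 3 / s = 2 * (2 * K ^ 3 / s) := by ring
    have h2 := mul_le_mul_of_nonneg_left hyg hε.le
    have h3 : ε * (2 * K ^ 3 / s) ≤ 1 * (2 * K ^ 3 / s) :=
      mul_le_mul_of_nonneg_right (by linarith) h0
    rw [e4]
    linarith
  have h2 := hzs 4 (by norm_num)
  have h3 := hzs (27 * 12) (by norm_num)
  have e5 : 27 * 12 * K ^ 3 / s = 12 * (27 * K ^ 3 / s) := by ring
  rw [e5] at h3
  have hmain : 2 * y + z - δ / 2 ≤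
      s ^ 2 * t - (1 + ε) / 4 * (s ^ 2 * t ^ 2) - 12 * (s ^ 2 * |t| ^ 3) := by
    rw [htg]; linarith
  have h0 : 0 < (1 - ε) / 2 / s ^ 2 := div_pos (by linarith) hgpos
  have h4 := mul_le_mul_of_nonneg_left hmain h0.le
  have h5 : (1 - ε) / 2 / s ^ 2 *
      (s ^ 2 * t - (1 + ε) / 4 * (s ^ 2 * t ^ 2) - 12 * (s ^ 2 * |t| ^ 3)) =
      (1 - ε) / 2 * t - (1 - ε) / 2 * (1 + ε) / 4 * t ^ 2 - 12 * ((1 - ε) / 2) * |t| ^ 3 := by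
    field_simp
  have h6 : (1 - ε) / 2 * (1 - (1 - ε) / 2) / 2 = (1 - ε) / 2 * (1 + ε) / 4 := by ring
  rw [h6] at htay
  -- The exponent `(1 - ε) / 2` is at least `1 / 4`, so the factor 12 survives having the exponent
  -- pulled out of the cubic term.
  have h7 : 3 * |t| ^ 3 ≤ 12 * ((1 - ε) / 2) * |t| ^ 3 :=
    mul_le_mul_of_nonneg_right (by linarith) (pow_nonneg (abs_nonneg t) 3)
  linarith

/-- Second order expansion of `lyap`: when the increment `ξ` is centred, the quadratic variation
in a direction orthogonal to `w` makes `lyap` a submartingale. -/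
theorem lyap_add_sub_ge {ε b K δ : ℝ} (hK : 1 ≤ K) (hε : 0 < ε) (hε2 : ε ≤ 1 / 2)
    (hεK : ε * K ^ 2 ≤ δ / 4) (hb : 6 * K ≤ b) (hbK : 328 * K ^ 3 ≤ δ / 4 * b)
    {w ξ u : E} (hu : ‖u‖ = 1) (huw : inner ℝ u w = 0) (hξ : ‖ξ‖ ≤ K) :
    lyapCoeff ε b w * (2 * inner ℝ w ξ + inner ℝ u ξ ^ 2 - δ / 2) ≤
      lyap ε b (w + ξ) - lyap ε b w := by
  have hbpos : 0 < b := by linarith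
  have hgpos : 0 < ‖w‖ ^ 2 + b ^ 2 := by positivity
  set s := Real.sqrt (‖w‖ ^ 2 + b ^ 2) with hs
  have hs2 : s ^ 2 = ‖w‖ ^ 2 + b ^ 2 := Real.sq_sqrt hgpos.le
  have hbs : b ≤ s := Real.le_sqrt_of_sq_le (by nlinarith [sq_nonneg ‖w‖])
  have hws : ‖w‖ ≤ s := Real.le_sqrt_of_sq_le (by nlinarith [sq_nonneg b])
  have hspos : 0 < s := by linarith
  have hyb : |inner ℝ w ξ| ≤ s * K :=
    (abs_real_inner_le_norm w ξ).trans (mul_le_mul hws hξ (norm_nonneg _) hspos.le)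
  have hqK : ‖ξ‖ ^ 2 ≤ K ^ 2 := pow_le_pow_left₀ (norm_nonneg _) hξ 2
  have hδ : 0 ≤ δ / 4 := le_trans (by positivity) hεK
  have hort := inner_sq_add_inner_sq_le (ξ := ξ) hgpos (by nlinarith [sq_nonneg b]) hu huw
  rw [← hs2] at hort
  have h6 : 6 * K ≤ s := hb.trans hbs
  have hsc := lyap_scalar hK hε hε2 hεK h6
    (hbK.trans (mul_le_mul_of_nonneg_left hbs hδ)) hyb (sq_nonneg _) hqK hort
  have htabs := (lyap_scalar_bounds hK h6 hyb (sq_nonneg ‖ξ‖) hqK).1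
  have ht2 : |(2 * inner ℝ w ξ + ‖ξ‖ ^ 2) / s ^ 2| ≤ 1 / 2 :=
    htabs.trans (by rw [div_le_iff₀ hspos]; linarith)
  have hexp : lyap ε b (w + ξ) = (s ^ 2) ^ ((1 - ε) / 2) *
      (1 + (2 * inner ℝ w ξ + ‖ξ‖ ^ 2) / s ^ 2) ^ ((1 - ε) / 2) := by
    rw [lyap, ← Real.mul_rpow (sq_nonneg s) (by linarith [(abs_le.1 ht2).1]), norm_add_sq_real]
    congr 1
    field_simp
    rw [hs2]; ring
  have hcoef : lyapCoeff ε b w = (1 - ε) / 2 * ((s ^ 2) ^ ((1 - ε) / 2) / s ^ 2) := by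
    rw [lyapCoeff, Real.rpow_sub_one hgpos.ne', hs2]
  have hl : lyap ε b w = (s ^ 2) ^ ((1 - ε) / 2) := by rw [hs2]; rfl
  rw [hexp, hcoef, hl]
  have hgp : 0 ≤ (s ^ 2) ^ ((1 - ε) / 2) := Real.rpow_nonneg (sq_nonneg s) _
  have := mul_le_mul_of_nonneg_left hsc hgp
  calc _ = (s ^ 2) ^ ((1 - ε) / 2) *
        ((1 - ε) / 2 / s ^ 2 * (2 * inner ℝ w ξ + inner ℝ u ξ ^ 2 - δ / 2)) := by ring
    _ ≤ _ := this
    _ = _ := by ring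

end
end ExcitedWalk

namespace ExcitedWalk
noncomputable section

/-! ### The lattice -/

section Lattice

variable {d : ℕ}

theorem latticeVec_add (x y : Fin d → ℤ) : latticeVec (x + y) = latticeVec x + latticeVec y := by
  ext i; simp [latticeVec]

theorem latticeVec_sub (x y : Fin d → ℤ) : latticeVec (x - y) = latticeVec x - latticeVec y := by
  ext i; simp [latticeVec]

theorem latticeVec_zero : latticeVec (0 : Fin d → ℤ) = 0 := by
  ext i; simp [latticeVec]

theorem abs_le_norm_latticeVec (x : Fin d → ℤ) (i : Fin d) : |(x i : ℝ)| ≤ ‖latticeVec x‖ := by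
  have := PiLp.norm_apply_le (latticeVec x) i
  simpa [latticeVec] using this

theorem exists_finset_norm_le {ρ : ℝ} (hρ : 1 ≤ ρ) : ∃ Z : Finset (Fin d → ℤ),
    (∀ z, z ∈ Z ↔ ‖latticeVec z‖ ≤ ρ) ∧ (Z.card : ℝ) ≤ (3 * ρ) ^ d := by
  classical
  set m := ⌊ρ⌋₊ with hm
  set B : Finset (Fin d → ℤ) := Fintype.piFinset fun _ : Fin d => Finset.Icc (-(m : ℤ)) m
  refine ⟨B.filter fun z => ‖latticeVec z‖ ≤ ρ, fun z => ?_, ?_⟩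
  · rw [Finset.mem_filter, and_iff_right_iff_imp, Fintype.mem_piFinset]
    intro hz i
    have h1 := (abs_le_norm_latticeVec z i).trans hz
    have h2 : |z i| ≤ (m : ℤ) := by
      have h3 : ((z i).natAbs : ℝ) ≤ ρ := by rwa [Nat.cast_natAbs, Int.cast_abs]
      have h4 : (z i).natAbs ≤ m := Nat.le_floor h3
      rw [Int.abs_eq_natAbs]; exact_mod_cast h4
    rw [Finset.mem_Icc]
    exact abs_le.1 h2
  · have hc := Finset.card_filter_le B fun z => ‖latticeVec z‖ ≤ ρ
    rw [Fintype.card_piFinset] at hc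
    simp only [Int.card_Icc, Finset.prod_const, Finset.card_univ, Fintype.card_fin] at hc
    have h5 : ((m : ℤ) + 1 - -(m : ℤ)).toNat = 2 * m + 1 := by omega
    rw [h5] at hc
    have h6 : (m : ℝ) ≤ ρ := Nat.floor_le (by linarith)
    calc ((B.filter fun z => ‖latticeVec z‖ ≤ ρ).card : ℝ) ≤ ((2 * m + 1 : ℕ) : ℝ) ^ d := by
          exact_mod_cast hc
      _ ≤ (3 * ρ) ^ d := by
          refine pow_le_pow_left₀ (by positivity) ?_ d
          push_cast; linarith

theorem card_filter_norm_lt_le (F : Finset (Fin d → ℤ)) {ρ : ℝ} (hρ : 1 ≤ ρ) :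
    ((F.filter fun x => ‖latticeVec x‖ < ρ).card : ℝ) ≤ (3 * ρ) ^ d := by
  obtain ⟨Z, hZ, hc⟩ := exists_finset_norm_le (d := d) hρ
  refine le_trans ?_ hc
  exact_mod_cast Finset.card_le_card fun x hx => (hZ x).2 (le_of_lt (Finset.mem_filter.1 hx).2)

/-- A decaying function summed over `M` lattice points is of lower order than `M`. -/
theorem sum_le_of_decay {pen : EuclideanSpace ℝ (Fin d) → ℝ} {c ε : ℝ} (hd : 1 ≤ d)
    (hε1 : ε ≤ 1) (hc0 : 0 ≤ c) (hc : ∀ w, pen w ≤ c)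
    (hpen : ∀ (ρ : ℝ) (v : EuclideanSpace ℝ (Fin d)), 1 ≤ ρ → ρ ≤ ‖v‖ →
      pen v ≤ c * ρ ^ (-ε)) {M : ℝ} (hM : 1 ≤ M) (F : Finset (Fin d → ℤ)) (hF : (F.card : ℝ) ≤ M) :
    ∑ x ∈ F, pen (latticeVec x) ≤ c * (3 ^ d + 1) * M ^ (1 - ε / (2 * d)) := by
  have hd0 : (0 : ℝ) < d := by exact_mod_cast hd
  have hd1 : (1 : ℝ) ≤ d := by exact_mod_cast hd
  have hM0 : 0 < M := by linarith
  -- At this radius the ball holds only `O(√M)` sites, where the crude bound `c` suffices; outside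
  -- it each term is at most `c * M^(-ε/(2d))`.
  set ρ := M ^ (1 / (2 * (d : ℝ))) with hρ
  have hρ1 : 1 ≤ ρ := Real.one_le_rpow hM (by positivity)
  rw [← Finset.sum_filter_add_sum_filter_not F (fun x => ‖latticeVec x‖ < ρ)]
  have hexp : 1 / 2 ≤ 1 - ε / (2 * d) := by
    have : ε / (2 * d) ≤ 1 / 2 := by
      rw [div_le_div_iff₀ (by positivity) (by norm_num)]; nlinarith
    linarith
  have h1 : ∑ x ∈ F.filter (fun x => ‖latticeVec x‖ < ρ), pen (latticeVec x) ≤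
      c * 3 ^ d * M ^ (1 - ε / (2 * d)) := by
    calc _ ≤ ∑ x ∈ F.filter (fun x => ‖latticeVec x‖ < ρ), c := Finset.sum_le_sum fun x _ => hc _
      _ = (F.filter (fun x => ‖latticeVec x‖ < ρ)).card * c := by simp
      _ ≤ (3 * ρ) ^ d * c := mul_le_mul_of_nonneg_right (card_filter_norm_lt_le F hρ1) hc0
      _ = c * 3 ^ d * M ^ (1 / 2 : ℝ) := by
          rw [mul_pow, hρ, ← Real.rpow_natCast (M ^ _), ← Real.rpow_mul hM0.le]
          have : 1 / (2 * (d : ℝ)) * d = 1 / 2 := by field_simp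
          rw [this]; ring
      _ ≤ _ := mul_le_mul_of_nonneg_left (Real.rpow_le_rpow_of_exponent_le hM hexp) (by positivity)
  have h2 : ∑ x ∈ F.filter (fun x => ¬ ‖latticeVec x‖ < ρ), pen (latticeVec x) ≤
      c * M ^ (1 - ε / (2 * d)) := by
    calc _ ≤ ∑ x ∈ F.filter (fun x => ¬ ‖latticeVec x‖ < ρ), c * ρ ^ (-ε) :=
          Finset.sum_le_sum fun x hx =>
            hpen _ _ hρ1 (not_lt.1 (Finset.mem_filter.1 hx).2)
      _ = (F.filter (fun x => ¬ ‖latticeVec x‖ < ρ)).card * (c * ρ ^ (-ε)) := by simp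
      _ ≤ M * (c * ρ ^ (-ε)) := by
          refine mul_le_mul_of_nonneg_right (le_trans ?_ hF) (by positivity)
          exact_mod_cast Finset.card_filter_le _ _
      _ = c * M ^ (1 - ε / (2 * d)) := by
          rw [hρ, ← Real.rpow_mul hM0.le, sub_eq_add_neg, Real.rpow_add hM0, Real.rpow_one]
          have : 1 / (2 * (d : ℝ)) * -ε = -(ε / (2 * d)) := by ring
          rw [this]; ring
  calc _ ≤ c * 3 ^ d * M ^ (1 - ε / (2 * d)) + c * M ^ (1 - ε / (2 * d)) := add_le_add h1 h2
    _ = _ := by ring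

/-- The source of the assumption `d ≥ 2`: the span of one vector is then not the whole space. The
case `w = 0` is included. -/
theorem exists_unit_orthogonal (hd : 2 ≤ d) (w : EuclideanSpace ℝ (Fin d)) :
    ∃ u : EuclideanSpace ℝ (Fin d), ‖u‖ = 1 ∧ inner ℝ u w = 0 := by
  have hne : (Submodule.span ℝ {w})ᗮ ≠ ⊥ := by
    intro h
    have h1 := (Submodule.span ℝ {w}).finrank_add_finrank_orthogonal
    rw [h, finrank_bot, finrank_euclideanSpace_fin] at h1
    have h2 := finrank_span_le_card (R := ℝ) ({w} : Set (EuclideanSpace ℝ (Fin d)))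
    rw [Set.toFinset_singleton, Finset.card_singleton] at h2
    omega
  obtain ⟨v, hv, hv0⟩ := Submodule.exists_mem_ne_zero_of_ne_bot hne
  have hn : ‖v‖ ≠ 0 := norm_ne_zero_iff.2 hv0
  refine ⟨‖v‖⁻¹ • v, ?_, ?_⟩
  · rw [norm_smul, norm_inv, norm_norm, inv_mul_cancel₀ hn]
  · rw [inner_smul_left, real_inner_comm,
      (Submodule.mem_orthogonal_singleton_iff_inner_right).1 hv, mul_zero]

end Lattice

/-! ### The penalty term -/

section Lyap

variable {E : Type*} [NormedAddCommGroup E]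

/-- The possible loss of `lyap` in a step with drift. -/
def lyapPenalty (ε b K δ : ℝ) (w : E) : ℝ := lyapCoeff ε b w * (2 * K * ‖w‖ + δ)

variable {ε b K δ : ℝ}

theorem lyapCoeff_nonneg (hε : ε ≤ 1) (w : E) : 0 ≤ lyapCoeff ε b w :=
  mul_nonneg (by linarith) (Real.rpow_nonneg (by positivity) _)

theorem lyapPenalty_nonneg (hε : ε ≤ 1) (hK : 0 ≤ K) (hδ : 0 ≤ δ) (w : E) :
    0 ≤ lyapPenalty ε b K δ w := mul_nonneg (lyapCoeff_nonneg hε w) (by positivity)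

theorem lyap_nonneg (w : E) : 0 ≤ lyap ε b w := Real.rpow_nonneg (by positivity) _

/-- With `g = ‖w‖² + b²`, the coefficient has order `g^(-(1+ε)/2)` and the linear factor is at most
`3 K √g`. The surplus `ε` in the exponent is what makes the penalty decay. -/
theorem lyapPenalty_le (hε0 : 0 ≤ ε) (hK : 1 ≤ K) (hδ : 0 ≤ δ) (hb : 1 ≤ b)
    (hδb : δ ≤ b) (w : E) :
    lyapPenalty ε b K δ w ≤ 3 * K * (‖w‖ ^ 2 + b ^ 2) ^ (-(ε / 2)) := by
  have hg : 0 < ‖w‖ ^ 2 + b ^ 2 := by positivity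
  have hbs : b ≤ √(‖w‖ ^ 2 + b ^ 2) := Real.le_sqrt_of_sq_le (by nlinarith [sq_nonneg ‖w‖])
  have hws : ‖w‖ ≤ √(‖w‖ ^ 2 + b ^ 2) := Real.le_sqrt_of_sq_le (by nlinarith [sq_nonneg b])
  have h1 : 2 * K * ‖w‖ + δ ≤ 3 * K * (‖w‖ ^ 2 + b ^ 2) ^ (1 / 2 : ℝ) := by
    rw [← Real.sqrt_eq_rpow]; nlinarith
  have h2 : lyapCoeff ε b w ≤ (‖w‖ ^ 2 + b ^ 2) ^ ((1 - ε) / 2 - 1) := by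
    have := Real.rpow_nonneg hg.le ((1 - ε) / 2 - 1)
    unfold lyapCoeff; nlinarith
  calc lyapPenalty ε b K δ w ≤ (‖w‖ ^ 2 + b ^ 2) ^ ((1 - ε) / 2 - 1) *
        (3 * K * (‖w‖ ^ 2 + b ^ 2) ^ (1 / 2 : ℝ)) :=
        mul_le_mul h2 h1 (by positivity) (by positivity)
    _ = 3 * K * (‖w‖ ^ 2 + b ^ 2) ^ (-(ε / 2)) := by
        rw [mul_comm, mul_assoc, ← Real.rpow_add hg]; congr 2; ring

theorem lyapPenalty_le_const (hε0 : 0 ≤ ε) (hK : 1 ≤ K) (hδ : 0 ≤ δ) (hb : 1 ≤ b)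
    (hδb : δ ≤ b) (w : E) : lyapPenalty ε b K δ w ≤ 3 * K := by
  refine (lyapPenalty_le hε0 hK hδ hb hδb w).trans ?_
  have h1 : (‖w‖ ^ 2 + b ^ 2) ^ (-(ε / 2)) ≤ 1 :=
    Real.rpow_le_one_of_one_le_of_nonpos (by nlinarith [sq_nonneg ‖w‖]) (by linarith)
  nlinarith

theorem lyapPenalty_le_rpow (hε0 : 0 ≤ ε) (hK : 1 ≤ K) (hδ : 0 ≤ δ) (hb : 1 ≤ b)
    (hδb : δ ≤ b) (w : E) {ρ : ℝ} (hρ : 1 ≤ ρ) (hw : ρ ≤ ‖w‖) :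
    lyapPenalty ε b K δ w ≤ 3 * K * ρ ^ (-ε) := by
  refine (lyapPenalty_le hε0 hK hδ hb hδb w).trans ?_
  have h1 : (‖w‖ ^ 2 + b ^ 2) ^ (-(ε / 2)) ≤ (ρ ^ 2) ^ (-(ε / 2)) :=
    Real.rpow_le_rpow_of_nonpos (by positivity) (by nlinarith [sq_nonneg b]) (by linarith)
  have h2 : (ρ ^ 2) ^ (-(ε / 2)) = ρ ^ (-ε) := by
    rw [← Real.rpow_natCast ρ 2, ← Real.rpow_mul (by linarith)]; congr 1; push_cast; ring
  rw [← h2]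
  exact mul_le_mul_of_nonneg_left h1 (by linarith)

theorem lyap_mono (hε : ε ≤ 1) {w : E} {ρ : ℝ} (hw : ‖w‖ ≤ ρ) :
    lyap ε b w ≤ (ρ ^ 2 + b ^ 2) ^ ((1 - ε) / 2) := by
  refine Real.rpow_le_rpow (by positivity) ?_ (by linarith)
  have := pow_le_pow_left₀ (norm_nonneg w) hw 2
  linarith

end Lyap

/-! ### Walks -/

variable {d : ℕ} {Ω : Type*} {mΩ : MeasurableSpace Ω}

/-- The event that the site `X n` is visited for the first time at time `n`. -/
def fresh (X : ℕ → Ω → Fin d → ℤ) (n : ℕ) : Set Ω := {ω | ∀ k < n, X k ω ≠ X n ω}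

/-- The quantitative form of the properties of a generalized excited random walk. -/
structure WalkBounds (μ : Measure Ω) (ℱ : Filtration ℕ mΩ) (ℓ : EuclideanSpace ℝ (Fin d))
    (X : ℕ → Ω → Fin d → ℤ) (K lam h r : ℝ) : Prop where
  direction : ‖ℓ‖ = 1
  adapted : Adapted ℱ X
  one_le_K : 1 ≤ K
  lam_pos : 0 < lam
  h_pos : 0 < h
  r_pos : 0 < r
  bound : ∀ᵐ ω ∂μ, ∀ n, ‖jump X n ω‖ ≤ K
  drift_zero : ∀ n, ∀ᵐ ω ∂μ, ω ∉ fresh X n → (μ[jump X n | ℱ n]) ω = 0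
  drift_pos : ∀ n, ∀ᵐ ω ∂μ, ω ∈ fresh X n → lam ≤ inner ℝ ((μ[jump X n | ℱ n]) ω) ℓ
  elliptic : ∀ n, ∀ᵐ ω ∂μ, h ≤ (μ⟦{ω' | r < inner ℝ (jump X n ω') ℓ} | ℱ n⟧) ω
  elliptic_zero : ∀ n, ∀ u : EuclideanSpace ℝ (Fin d), ‖u‖ = 1 → ∀ᵐ ω ∂μ, ω ∉ fresh X n →
    h ≤ (μ⟦{ω' | r < inner ℝ (jump X n ω') u} | ℱ n⟧) ω

theorem IsGeneralizedExcitedWalk.exists_walkBounds {μ : Measure Ω} {ℱ : Filtration ℕ mΩ}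
    {ℓ : EuclideanSpace ℝ (Fin d)} {X : ℕ → Ω → Fin d → ℤ}
    (hX : IsGeneralizedExcitedWalk μ ℱ ℓ X) : ∃ K lam h r, WalkBounds μ ℱ ℓ X K lam h r := by
  obtain ⟨K, hK0, hK⟩ := hX.condB
  obtain ⟨lam, hlam, hC⟩ := hX.condCPlus
  obtain ⟨h, r, hh, hr, hE⟩ := hX.condE
  have hz : ∀ n, ∀ᵐ ω ∂μ, ω ∉ fresh X n → (μ[jump X n | ℱ n]) ω = 0 := by
    intro n
    filter_upwards [hC n] with ω hω hf
    simp only [fresh, Set.mem_ofPred_eq, not_forall, not_not] at hf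
    obtain ⟨k, hk, e⟩ := hf
    exact hω.1 ⟨k, hk, e⟩
  refine ⟨max K 1, lam, h, r, hX.direction, hX.adapted, le_max_right _ _, hlam, hh, hr, ?_, hz, ?_,
    fun n => (hE n).1, ?_⟩
  · filter_upwards [hK] with ω hω n using (hω n).trans (le_max_left _ _)
  · intro n
    filter_upwards [hC n] with ω hω hf using hω.2 hf
  · intro n u hu
    filter_upwards [hz n, (hE n).2 u hu] with ω h1 h2 hf using h2 (h1 hf)

theorem measurableSet_fresh {ℱ : Filtration ℕ mΩ} {X : ℕ → Ω → Fin d → ℤ} (hX : Adapted ℱ X)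
    (n : ℕ) : MeasurableSet[ℱ n] (fresh X n) := by
  have : fresh X n = ⋂ k : ℕ, ⋂ _ : k < n, {ω | X k ω ≠ X n ω} := by
    ext ω; simp [fresh]
  rw [this]
  refine MeasurableSet.iInter fun k => MeasurableSet.iInter fun hk => ?_
  have h1 : Measurable[ℱ n] fun ω => (X k ω, X n ω) :=
    ((hX k).mono (ℱ.mono hk.le) le_rfl).prodMk (hX n)
  exact h1 (MeasurableSet.of_discrete (s := {p : (Fin d → ℤ) × (Fin d → ℤ) | p.1 ≠ p.2}))

/-! ### The one-step drift of the Lyapunov function -/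

section OneStep

variable {μ : Measure Ω} {ℱ : Filtration ℕ mΩ} {ℓ : EuclideanSpace ℝ (Fin d)}
  {X : ℕ → Ω → Fin d → ℤ} {K lam h r : ℝ}

theorem measurable_latticeVec : Measurable (latticeVec : (Fin d → ℤ) → _) :=
  measurable_of_countable _

theorem measurable_jump (hX : Adapted ℱ X) (n : ℕ) : Measurable[ℱ (n + 1)] (jump X n) :=
  measurable_latticeVec.comp ((hX (n + 1)).sub ((hX n).mono (ℱ.mono (Nat.le_succ n)) le_rfl))

theorem WalkBounds.integrable_jump [IsProbabilityMeasure μ] (hw : WalkBounds μ ℱ ℓ X K lam h r)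
    (n : ℕ) : Integrable (jump X n) μ := by
  refine Integrable.of_bound (((measurable_jump hw.adapted n).mono (ℱ.le _) le_rfl)
    |>.aestronglyMeasurable) K ?_
  filter_upwards [hw.bound] with ω h using h n

theorem WalkBounds.condExp_inner_jump [IsProbabilityMeasure μ]
    (hw : WalkBounds μ ℱ ℓ X K lam h r) (n : ℕ) (v : EuclideanSpace ℝ (Fin d)) :
    μ[fun ω => inner ℝ v (jump X n ω) | ℱ n] =ᵐ[μ] fun ω => inner ℝ v ((μ[jump X n | ℱ n]) ω) :=
  ((innerSL ℝ v).comp_condExp_comm (hw.integrable_jump n) (m := ℱ n)).symm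

/-- The conditional expectation of the increment of `lyap`. -/
theorem WalkBounds.condExp_lyap_ge [IsProbabilityMeasure μ] (hd : 2 ≤ d)
    (hw : WalkBounds μ ℱ ℓ X K lam h r) {ε b : ℝ} (hε : 0 < ε) (hε2 : ε ≤ 1 / 2)
    (hεK : ε * K ^ 2 ≤ h * r ^ 2 / 4) (hb : 6 * K ≤ b) (hbK : 328 * K ^ 3 ≤ h * r ^ 2 / 4 * b)
    (n : ℕ) (w : EuclideanSpace ℝ (Fin d)) :
    ∀ᵐ ω ∂μ, lyapCoeff ε b w * (h * r ^ 2 / 2) -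
        (fresh X n).indicator (fun _ => lyapPenalty ε b K (h * r ^ 2) w) ω ≤
      (μ[fun ω => lyap ε b (w + jump X n ω) - lyap ε b w | ℱ n]) ω := by
  obtain ⟨u, hu, huw⟩ := exists_unit_orthogonal hd w
  have hK := hw.one_le_K
  have hκ : 0 ≤ lyapCoeff ε b w := lyapCoeff_nonneg (by linarith) w
  set κ := lyapCoeff ε b w with hκd
  set δ := h * r ^ 2 with hδ
  have hδ0 : 0 < δ := mul_pos hw.h_pos (pow_pos hw.r_pos 2)
  have hjm : Measurable (jump X n) := (measurable_jump hw.adapted n).mono (ℱ.le _) le_rfl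
  have hjb : ∀ᵐ ω ∂μ, ‖jump X n ω‖ ≤ K := by filter_upwards [hw.bound] with ω h using h n
  have hSm : MeasurableSet {ω' | r < inner ℝ (jump X n ω') u} :=
    measurableSet_lt measurable_const (hjm.inner_const)
  have hDi : Integrable (fun ω => lyap ε b (w + jump X n ω) - lyap ε b w) μ := by
    refine (Integrable.of_bound (C := ((‖w‖ + K) ^ 2 + b ^ 2) ^ ((1 - ε) / 2)) ?_ ?_).sub
      (integrable_const _)
    · refine Measurable.aestronglyMeasurable ?_
      unfold lyap
      fun_prop
    · filter_upwards [hjb] with ω h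
      rw [Real.norm_of_nonneg (lyap_nonneg _)]
      exact lyap_mono (by linarith) ((norm_add_le _ _).trans (by linarith))
  have hpt : ∀ᵐ ω ∂μ, κ * (2 * inner ℝ w (jump X n ω) + inner ℝ u (jump X n ω) ^ 2 - δ / 2) ≤
      lyap ε b (w + jump X n ω) - lyap ε b w := by
    filter_upwards [hjb] with ω h
    exact lyap_add_sub_ge hK hε hε2 hεK hb hbK hu huw h
  -- the fresh case
  have hfr : ∀ᵐ ω ∂μ, -(κ * (2 * K * ‖w‖ + δ / 2)) ≤
      (μ[fun ω => lyap ε b (w + jump X n ω) - lyap ε b w | ℱ n]) ω := by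
    have h1 : (fun _ => -(κ * (2 * K * ‖w‖ + δ / 2))) ≤ᵐ[μ]
        fun ω => lyap ε b (w + jump X n ω) - lyap ε b w := by
      filter_upwards [hpt, hjb] with ω h1 h2
      refine le_trans ?_ h1
      have h3 := abs_real_inner_le_norm w (jump X n ω)
      have h4 : ‖w‖ * ‖jump X n ω‖ ≤ ‖w‖ * K := mul_le_mul_of_nonneg_left h2 (norm_nonneg _)
      have h5 := (abs_le.1 h3).1
      rw [← mul_neg]
      refine mul_le_mul_of_nonneg_left ?_ hκ
      nlinarith [sq_nonneg (inner ℝ u (jump X n ω))]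
    have h2 := condExp_mono (m := ℱ n) (integrable_const _) hDi h1
    rwa [condExp_const (ℱ.le n)] at h2
  -- the visited case
  have hvis : ∀ᵐ ω ∂μ, ω ∉ fresh X n → κ * (δ / 2) ≤
      (μ[fun ω => lyap ε b (w + jump X n ω) - lyap ε b w | ℱ n]) ω := by
    set S := {ω' | r < inner ℝ (jump X n ω') u} with hS
    have hf1 : Integrable (fun ω => inner ℝ w (jump X n ω)) μ :=
      (hw.integrable_jump n).const_inner w
    have hf2 : Integrable (S.indicator fun _ => (1 : ℝ)) μ := (integrable_const _).indicator hSm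
    -- At a visited site the linear term has conditional mean zero, and the squared transverse
    -- increment is at least `r²` on an event of conditional probability at least `h`.
    have h1 : (((2 * κ) • fun ω => inner ℝ w (jump X n ω)) +
        (κ * r ^ 2) • (S.indicator fun _ => (1 : ℝ))) + (fun _ => -(κ * (δ / 2))) ≤ᵐ[μ]
        fun ω => lyap ε b (w + jump X n ω) - lyap ε b w := by
      filter_upwards [hpt] with ω h1
      refine le_trans ?_ h1
      have h3 : r ^ 2 * S.indicator (fun _ => (1 : ℝ)) ω ≤ inner ℝ u (jump X n ω) ^ 2 := by
        by_cases hω : ω ∈ S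
        · rw [Set.indicator_of_mem hω, mul_one, real_inner_comm]
          exact pow_le_pow_left₀ hw.r_pos.le (le_of_lt hω) 2
        · rw [Set.indicator_of_notMem hω, mul_zero]; positivity
      simp only [Pi.add_apply, Pi.smul_apply, smul_eq_mul]
      have := mul_le_mul_of_nonneg_left h3 hκ
      linarith
    have h2 := condExp_mono (m := ℱ n) (((hf1.smul (2 * κ)).add (hf2.smul (κ * r ^ 2))).add
      (integrable_const _)) hDi h1
    filter_upwards [h2, condExp_add ((hf1.smul (2 * κ)).add (hf2.smul (κ * r ^ 2)))
      (integrable_const (-(κ * (δ / 2)))) (ℱ n),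
      condExp_add (hf1.smul (2 * κ)) (hf2.smul (κ * r ^ 2)) (ℱ n),
      condExp_smul (2 * κ) (fun ω => inner ℝ w (jump X n ω)) (ℱ n) (μ := μ),
      condExp_smul (κ * r ^ 2) (S.indicator fun _ => (1 : ℝ)) (ℱ n) (μ := μ),
      hw.condExp_inner_jump n w, hw.drift_zero n, hw.elliptic_zero n u hu] with
      ω a1 a2 a3 a4 a5 a6 a7 a8 hω
    rw [a2, Pi.add_apply, a3, Pi.add_apply, a4, a5, condExp_const (ℱ.le n), Pi.smul_apply,
      Pi.smul_apply, a6, a7 hω, inner_zero_right, smul_zero, zero_add, smul_eq_mul] at a1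
    have h3 := mul_le_mul_of_nonneg_left (a8 hω) (mul_nonneg hκ (sq_nonneg r))
    have h4 : κ * δ = κ * r ^ 2 * h := by rw [hδ]; ring
    linarith
  filter_upwards [hfr, hvis] with ω h1 h2
  by_cases hω : ω ∈ fresh X n
  · rw [Set.indicator_of_mem hω]
    refine le_trans (le_of_eq ?_) h1
    -- The `δ` in `lyapPenalty` covers both the claimed gain `δ / 2` and the expansion error `δ /
    -- 2`.
    rw [lyapPenalty, ← hκd]; ring
  · rw [Set.indicator_of_notMem hω, sub_zero]
    exact h2 hω

end OneStep

end
end ExcitedWalk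

namespace ExcitedWalk
noncomputable section

/-! ### Functionals of the trajectory -/

variable {d : ℕ} {Ω : Type*} {mΩ : MeasurableSpace Ω}

/-- The trajectory of the process. -/
def traj (X : ℕ → Ω → Fin d → ℤ) (ω : Ω) : ℕ → Fin d → ℤ := fun n => X n ω

/-- The site occupied at time `n` was not visited before. -/
def IsFresh (x : ℕ → Fin d → ℤ) (n : ℕ) : Prop := ∀ k < n, x k ≠ x n

/-- The sites visited during `[s, s + n)`. -/
def siteRange (x : ℕ → Fin d → ℤ) (s n : ℕ) : Finset (Fin d → ℤ) :=
  (Finset.range n).image fun i => x (s + i)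

open Classical in
/-- The number of visits to `x s + z` during `[s, s + n)`. -/
def visits (x : ℕ → Fin d → ℤ) (s : ℕ) (z : Fin d → ℤ) (n : ℕ) : ℕ :=
  ((Finset.range n).filter fun i => x (s + i) - x s = z).card

open Classical in
/-- The times in `[s, s + n)`, relative to `s`, at which a site is visited for the first time. -/
def freshTimes (x : ℕ → Fin d → ℤ) (s n : ℕ) : Finset ℕ :=
  (Finset.range n).filter fun i => IsFresh x (s + i)

/-- A functional of the trajectory up to time `n` is `ℱ n`-measurable. -/
theorem measurable_of_path {ℱ : Filtration ℕ mΩ} {X : ℕ → Ω → Fin d → ℤ} (hX : Adapted ℱ X)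
    {β : Type*} [MeasurableSpace β] (n : ℕ) {F : (ℕ → Fin d → ℤ) → β}
    (hF : ∀ x y, (∀ i ≤ n, x i = y i) → F x = F y) :
    Measurable[ℱ n] fun ω => F (traj X ω) := by
  have h1 : Measurable[ℱ n] fun ω => (fun i : Fin (n + 1) => X i ω) :=
    @measurable_pi_lambda _ _ _ (ℱ n) _ _ fun i =>
      (hX i).mono (ℱ.mono (Nat.lt_succ_iff.1 i.2)) le_rfl
  -- Finite lattice paths are countable, so any function of them is measurable; the continuation by
  -- zero is irrelevant because `F` ignores times after `n`.
  set F' : (Fin (n + 1) → Fin d → ℤ) → β := fun v =>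
    F fun i => if h : i < n + 1 then v ⟨i, h⟩ else 0
  have h2 : (fun ω => F (traj X ω)) = F' ∘ fun ω => (fun i : Fin (n + 1) => X i ω) := by
    funext ω
    refine hF _ _ fun i hi => ?_
    simp [traj, Nat.lt_succ_iff.2 hi]
  rw [h2]
  exact (measurable_of_countable F').comp h1

theorem measurableSet_of_path {ℱ : Filtration ℕ mΩ} {X : ℕ → Ω → Fin d → ℤ} (hX : Adapted ℱ X)
    (n : ℕ) {P : (ℕ → Fin d → ℤ) → Prop}
    (hP : ∀ x y, (∀ i ≤ n, x i = y i) → (P x ↔ P y)) :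
    MeasurableSet[ℱ n] {ω | P (traj X ω)} := by
  have := measurable_of_path hX n (F := P) fun x y h => propext (hP x y h)
  exact this (MeasurableSet.of_discrete (s := {p : Prop | p}))

/-! ### Dependence on the past only -/

section Congr

variable {x y : ℕ → Fin d → ℤ}

theorem isFresh_congr {n : ℕ} (h : ∀ i ≤ n, x i = y i) : IsFresh x n ↔ IsFresh y n := by
  unfold IsFresh
  refine forall₂_congr fun k hk => ?_
  rw [h k hk.le, h n le_rfl]

theorem siteRange_congr {s n : ℕ} (h : ∀ i < s + n, x i = y i) :
    siteRange x s n = siteRange y s n := by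
  refine Finset.image_congr fun i hi => ?_
  have := Finset.mem_range.1 hi
  exact h _ (by omega)

theorem visits_congr {s n : ℕ} {z : Fin d → ℤ} (h : ∀ i < s + n, x i = y i) :
    visits x s z n = visits y s z n := by
  unfold visits
  congr 1
  refine Finset.filter_congr fun i hi => ?_
  have := Finset.mem_range.1 hi
  rw [h (s + i) (by omega), h s (by omega)]

theorem freshTimes_congr {s n : ℕ} (h : ∀ i < s + n, x i = y i) :
    freshTimes x s n = freshTimes y s n := by
  classical
  refine Finset.filter_congr fun i hi => ?_
  have := Finset.mem_range.1 hi
  exact isFresh_congr fun j hj => h j (by omega)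

end Congr

theorem siteRange_succ (x : ℕ → Fin d → ℤ) (s n : ℕ) :
    siteRange x s (n + 1) = insert (x (s + n)) (siteRange x s n) := by
  simp [siteRange, Finset.range_add_one, Finset.image_insert]

/-- Positions at distinct fresh times are distinct, so a sum over fresh times is part of a sum over
visited sites. -/
theorem sum_freshTimes_le (x : ℕ → Fin d → ℤ) (s n : ℕ) {φ : (Fin d → ℤ) → ℝ}
    (hφ : ∀ v, 0 ≤ φ v) :
    ∑ i ∈ freshTimes x s n, φ (x (s + i)) ≤ ∑ v ∈ siteRange x s n, φ v := by
  classical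
  have hinj : Set.InjOn (fun i => x (s + i)) (freshTimes x s n : Set ℕ) := by
    intro i hi j hj hij
    have hi' := (Finset.mem_filter.1 (Finset.mem_coe.1 hi)).2
    have hj' := (Finset.mem_filter.1 (Finset.mem_coe.1 hj)).2
    rcases lt_trichotomy i j with h | h | h
    · exact absurd hij (hj' _ (by omega))
    · exact h
    · exact absurd hij.symm (hi' _ (by omega))
  rw [← Finset.sum_image hinj]
  refine Finset.sum_le_sum_of_subset_of_nonneg ?_ fun v _ _ => hφ v
  exact Finset.image_subset_image (Finset.filter_subset _ _)

theorem card_freshTimes_le (x : ℕ → Fin d → ℤ) (s n : ℕ) :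
    (freshTimes x s n).card ≤ (siteRange x s n).card := by
  have := sum_freshTimes_le x s n (φ := fun _ => 1) fun _ => zero_le_one
  simp only [Finset.sum_const, nsmul_eq_mul, mul_one] at this
  exact_mod_cast this

/-- The accumulated penalty at first visits. -/
def penaltySum (pen : EuclideanSpace ℝ (Fin d) → ℝ) (x : ℕ → Fin d → ℤ) (s : ℕ) (z : Fin d → ℤ)
    (n : ℕ) : ℝ :=
  ∑ i ∈ freshTimes x s n, pen (latticeVec (x (s + i) - x s - z))

theorem penaltySum_nonneg {pen : EuclideanSpace ℝ (Fin d) → ℝ} (h : ∀ w, 0 ≤ pen w)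
    (x : ℕ → Fin d → ℤ) (s : ℕ) (z : Fin d → ℤ) (n : ℕ) : 0 ≤ penaltySum pen x s z n :=
  Finset.sum_nonneg fun _ _ => h _

theorem penaltySum_congr {pen : EuclideanSpace ℝ (Fin d) → ℝ} {x y : ℕ → Fin d → ℤ} {s n : ℕ}
    {z : Fin d → ℤ} (h : ∀ i < s + n, x i = y i) :
    penaltySum pen x s z n = penaltySum pen y s z n := by
  classical
  unfold penaltySum
  rw [freshTimes_congr h]
  refine Finset.sum_congr rfl fun i hi => ?_
  have := Finset.mem_range.1 (Finset.mem_filter.1 hi).1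
  rw [h (s + i) (by omega), h s (by omega)]

/-- Recentring at the target is injective, so the penalties are those of at most `M` distinct
lattice points. -/
theorem penaltySum_le {pen : EuclideanSpace ℝ (Fin d) → ℝ} (h : ∀ w, 0 ≤ pen w) {H : ℝ} {M : ℕ}
    (hH : ∀ F : Finset (Fin d → ℤ), F.card ≤ M → ∑ v ∈ F, pen (latticeVec v) ≤ H)
    (x : ℕ → Fin d → ℤ) (s : ℕ) (z : Fin d → ℤ) (n : ℕ) (hM : (siteRange x s n).card ≤ M) :
    penaltySum pen x s z n ≤ H := by
  have h1 := sum_freshTimes_le x s n (φ := fun v => pen (latticeVec (v - x s - z))) fun _ => h _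
  refine h1.trans ?_
  have hinj : Set.InjOn (fun v : Fin d → ℤ => v - x s - z) (siteRange x s n : Set (Fin d → ℤ)) := by
    intro a _ b _ hab
    simpa using hab
  rw [← Finset.sum_image (f := fun v => pen (latticeVec v)) hinj]
  exact hH _ (Finset.card_image_le.trans hM)

theorem penaltySum_succ (pen : EuclideanSpace ℝ (Fin d) → ℝ) (x : ℕ → Fin d → ℤ) (s : ℕ)
    (z : Fin d → ℤ) (n : ℕ) : penaltySum pen x s z (n + 1) = penaltySum pen x s z n +
      {y | IsFresh y (s + n)}.indicator (fun _ => pen (latticeVec (x (s + n) - x s - z))) x := by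
  classical
  unfold penaltySum freshTimes
  rw [Finset.range_add_one, Finset.filter_insert]
  by_cases h : IsFresh x (s + n)
  · rw [if_pos h, Finset.sum_insert (by simp), Set.indicator_of_mem (by exact h), add_comm]
  · rw [if_neg h, Set.indicator_of_notMem (by exact h), add_zero]

theorem visits_succ (x : ℕ → Fin d → ℤ) (s : ℕ) (z : Fin d → ℤ) (n : ℕ) :
    visits x s z (n + 1) = visits x s z n +
      {y : ℕ → Fin d → ℤ | y (s + n) - y s = z}.indicator (fun _ => 1) x := by
  classical
  unfold visits
  rw [Finset.range_add_one, Finset.filter_insert]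
  by_cases h : x (s + n) - x s = z
  · rw [if_pos h, Finset.card_insert_of_notMem (by simp), Set.indicator_of_mem (by exact h)]
  · rw [if_neg h, Set.indicator_of_notMem (by exact h), add_zero]

theorem visits_le (x : ℕ → Fin d → ℤ) (s : ℕ) (z : Fin d → ℤ) (n : ℕ) : visits x s z n ≤ n := by
  exact (Finset.card_filter_le _ _).trans_eq (Finset.card_range n)

theorem latticeVec_traj_succ (X : ℕ → Ω → Fin d → ℤ) (ω : Ω) (n : ℕ) (v : Fin d → ℤ) :
    latticeVec (traj X ω (n + 1) - v) = latticeVec (traj X ω n - v) + jump X n ω := by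
  simp only [jump, traj, ← latticeVec_add]
  congr 1; abel

theorem norm_disp_le {X : ℕ → Ω → Fin d → ℤ} {ω : Ω} {K : ℝ} (h : ∀ n, ‖jump X n ω‖ ≤ K)
    (s n : ℕ) : ‖latticeVec (traj X ω (s + n) - traj X ω s)‖ ≤ n * K := by
  induction n with
  | zero => simp [latticeVec_zero]
  | succ n ih =>
    rw [← add_assoc, latticeVec_traj_succ]
    refine (norm_add_le _ _).trans ?_
    push_cast
    linarith [h (s + n)]

/-! ### The number of visits to a site -/

section LocalTime

/-- The walk has stayed within distance `ρ` and visited at most `M` sites. -/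
def Confined (x : ℕ → Fin d → ℤ) (s : ℕ) (ρ : ℝ) (M n : ℕ) : Prop :=
  (∀ i ≤ n, ‖latticeVec (x (s + i) - x s)‖ ≤ ρ) ∧ (siteRange x s n).card ≤ M

theorem confined_congr {x y : ℕ → Fin d → ℤ} {s M n : ℕ} {ρ : ℝ} (h : ∀ i ≤ s + n, x i = y i) :
    Confined x s ρ M n ↔ Confined y s ρ M n := by
  unfold Confined
  rw [siteRange_congr fun i hi => h i hi.le]
  refine and_congr_left' (forall₂_congr fun i hi => ?_)
  rw [h (s + i) (by omega), h s (by omega)]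

theorem Confined.of_succ {x : ℕ → Fin d → ℤ} {s M n : ℕ} {ρ : ℝ}
    (h : Confined x s ρ M (n + 1)) : Confined x s ρ M n := by
  refine ⟨fun i hi => h.1 i (by omega), le_trans (Finset.card_le_card ?_) h.2⟩
  rw [siteRange_succ]
  exact Finset.subset_insert _ _

open Classical in
/-- The functional of the trajectory which is a supermartingale. -/
def localTimeFun (f pen : EuclideanSpace ℝ (Fin d) → ℝ) (θ H ρ : ℝ) (M s : ℕ) (z : Fin d → ℤ)
    (n : ℕ) (x : ℕ → Fin d → ℤ) : ℝ :=
  if Confined x s ρ M n then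
    Real.exp (θ * visits x s z n) *
      (2 * H - f (latticeVec (x (s + n) - x s - z)) - penaltySum pen x s z n)
  else 0

variable {μ : Measure Ω} {ℱ : Filtration ℕ mΩ} {X : ℕ → Ω → Fin d → ℤ}
  {f pen c : EuclideanSpace ℝ (Fin d) → ℝ} {K H H1 H2 ρ : ℝ} {M : ℕ}

/-- Since `f` plus the accumulated penalty is a submartingale, the bracket in `localTimeFun`
decreases on average. At a visit to the target it loses `c 0 = θ * (2 * H)`, which is at least `θ`
times its value and pays for the new factor `exp θ`. Losing confinement sets the functional to zero;
this can only lower it, as the bracket is still nonnegative one step after confinement. That extra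
step is why `hf1` allows radius `2 * ρ + K` and `hp2` allows `M + 1` sites. -/
theorem localTimeFun_step [IsProbabilityMeasure μ] (hX : Adapted ℱ X)
    (hjump : ∀ᵐ ω ∂μ, ∀ n, ‖jump X n ω‖ ≤ K) (hK : 0 ≤ K)
    (hf0 : ∀ w, 0 ≤ f w) (hfB : ∀ R, ∃ B, ∀ w, ‖w‖ ≤ R → f w ≤ B)
    (hpen0 : ∀ w, 0 ≤ pen w) {Cp : ℝ} (hpenC : ∀ w, pen w ≤ Cp)
    (hc0 : ∀ w, 0 ≤ c w) {Cc : ℝ} (hcC : ∀ w, c w ≤ Cc)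
    (hstep : ∀ n w, ∀ᵐ ω ∂μ, c w - (fresh X n).indicator (fun _ => pen w) ω ≤
      (μ[fun ω => f (w + jump X n ω) - f w | ℱ n]) ω)
    (hH : H = H1 + H2) (hc : 0 < c 0) (hH0 : 0 < H)
    (hf1 : ∀ w, ‖w‖ ≤ 2 * ρ + K → f w ≤ H1)
    (hp2 : ∀ F : Finset (Fin d → ℤ), F.card ≤ M + 1 → ∑ v ∈ F, pen (latticeVec v) ≤ H2)
    {s : ℕ} {A : Set Ω} (hA : MeasurableSet[ℱ s] A) {z : Fin d → ℤ} (hz : ‖latticeVec z‖ ≤ ρ)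
    (n : ℕ) :
    Integrable (fun ω => A.indicator 1 ω *
      localTimeFun f pen (c 0 / (2 * H)) H ρ M s z n (traj X ω)) μ ∧
    ∫ ω, A.indicator 1 ω * localTimeFun f pen (c 0 / (2 * H)) H ρ M s z (n + 1) (traj X ω) ∂μ ≤
      ∫ ω, A.indicator 1 ω * localTimeFun f pen (c 0 / (2 * H)) H ρ M s z n (traj X ω) ∂μ := by
  classical
  set θ := c 0 / (2 * H) with hθ
  have hθ0 : 0 < θ := by positivity
  -- the site relative to the target
  set W : ℕ → Ω → Fin d → ℤ := fun k ω => traj X ω (s + k) - traj X ω s - z with hW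
  have hWm : ∀ k, Measurable[ℱ (s + k)] (W k) := fun k =>
    measurable_of_path hX (s + k) (F := fun x => x (s + k) - x s - z) fun x y h => by
      simp only [h (s + k) le_rfl, h s (by omega)]
  have hWsucc : ∀ ω, latticeVec (W (n + 1) ω) = latticeVec (W n ω) + jump X (s + n) ω := by
    intro ω
    simp only [hW, sub_sub]
    exact latticeVec_traj_succ X ω (s + n) _
  have hWb : ∀ k, ∀ᵐ ω ∂μ, ‖latticeVec (W k ω)‖ ≤ k * K + ρ := by
    intro k
    filter_upwards [hjump] with ω h
    simp only [hW]
    rw [latticeVec_sub]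
    exact (norm_sub_le _ _).trans (add_le_add (norm_disp_le h s k) hz)
  have hfi : ∀ (g : Ω → EuclideanSpace ℝ (Fin d)), (∃ R, ∀ᵐ ω ∂μ, ‖g ω‖ ≤ R) →
      AEStronglyMeasurable (fun ω => f (g ω)) μ → Integrable (fun ω => f (g ω)) μ := by
    rintro g ⟨R, hR⟩ hm
    obtain ⟨B, hB⟩ := hfB R
    refine Integrable.of_bound hm B ?_
    filter_upwards [hR] with ω h
    rw [Real.norm_of_nonneg (hf0 _)]
    exact hB _ h
  have hfW : ∀ k, Integrable (fun ω => f (latticeVec (W k ω))) μ := fun k =>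
    hfi _ ⟨_, hWb k⟩ (((measurable_of_countable fun v => f (latticeVec v)).comp
      ((hWm k).mono (ℱ.le _) le_rfl)).aestronglyMeasurable)
  -- the increment
  set φ : (Fin d → ℤ) → Ω → ℝ := fun v ω =>
    f (latticeVec v + jump X (s + n) ω) - f (latticeVec v) with hφ
  have hφi : ∀ v, Integrable (φ v) μ := by
    intro v
    refine (hfi (fun ω => latticeVec v + jump X (s + n) ω) ⟨‖latticeVec v‖ + K, ?_⟩ ?_).sub
      (integrable_const _)
    · filter_upwards [hjump] with ω h
      exact (norm_add_le _ _).trans (by linarith [h (s + n)])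
    · have h1 : (fun ω => f (latticeVec v + jump X (s + n) ω)) =
          (fun y => f (latticeVec v + latticeVec y)) ∘ fun ω => X (s + n + 1) ω - X (s + n) ω := rfl
      rw [h1]
      refine (Measurable.comp (measurable_of_countable _) ?_).aestronglyMeasurable
      exact ((hX _).mono (ℱ.le _) le_rfl).sub ((hX _).mono (ℱ.le _) le_rfl)
  have hφW : (fun ω => φ (W n ω) ω) =
      fun ω => f (latticeVec (W (n + 1) ω)) - f (latticeVec (W n ω)) := by
    funext ω; simp only [hφ, hWsucc]
  have hφWi : Integrable (fun ω => φ (W n ω) ω) μ := by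
    rw [hφW]; exact (hfW (n + 1)).sub (hfW n)
  set ψ : Ω → ℝ := fun ω => c (latticeVec (W n ω)) -
    (fresh X (s + n)).indicator (fun ω => pen (latticeVec (W n ω))) ω with hψ
  have hψle : ψ ≤ᵐ[μ] μ[fun ω => φ (W n ω) ω | ℱ (s + n)] := by
    -- The one-step bound has an exceptional null set for each fixed displacement. There are
    -- countably many displacements, so the random one, known at time `s + n`, may be inserted.
    have hall : ∀ᵐ ω ∂μ, ∀ v : Fin d → ℤ,
        c (latticeVec v) - (fresh X (s + n)).indicator (fun _ => pen (latticeVec v)) ω ≤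
          (μ[φ v | ℱ (s + n)]) ω := ae_all_iff.2 fun v => hstep (s + n) (latticeVec v)
    filter_upwards [condExp_freeze (hWm n) hφi hφWi, hall] with ω h1 h2
    rw [h1]
    refine le_trans (le_of_eq ?_) (h2 (W n ω))
    by_cases hω : ω ∈ fresh X (s + n) <;> simp [hψ, hω]
  have hfreshm : MeasurableSet (fresh X (s + n)) := ℱ.le _ _ (measurableSet_fresh hX _)
  have hψi : Integrable ψ μ := by
    have hWM : Measurable (W n) := (hWm n).mono (ℱ.le _) le_rfl
    refine Integrable.sub ?_ (Integrable.indicator ?_ hfreshm)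
    · refine Integrable.of_bound ((measurable_of_countable fun v => c (latticeVec v)).comp
        hWM).aestronglyMeasurable Cc (Filter.Eventually.of_forall fun ω => ?_)
      rw [Real.norm_of_nonneg (hc0 _)]; exact hcC _
    · refine Integrable.of_bound ((measurable_of_countable fun v => pen (latticeVec v)).comp
        hWM).aestronglyMeasurable Cp (Filter.Eventually.of_forall fun ω => ?_)
      rw [Real.norm_of_nonneg (hpen0 _)]; exact hpenC _
  -- the weight
  set g0 : (ℕ → Fin d → ℤ) → ℝ := fun x =>
    if Confined x s ρ M n then Real.exp (θ * visits x s z (n + 1)) else 0 with hg0d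
  have hg0b : ∀ x, 0 ≤ g0 x ∧ g0 x ≤ Real.exp (θ * (n + 1)) := by
    intro x
    simp only [hg0d]
    split_ifs
    · refine ⟨(Real.exp_pos _).le, Real.exp_le_exp.2 (mul_le_mul_of_nonneg_left ?_ hθ0.le)⟩
      exact_mod_cast visits_le x s z (n + 1)
    · exact ⟨le_rfl, (Real.exp_pos _).le⟩
  -- The weight includes the visit at time `s + n`, which is known before the jump out of that
  -- position.
  set g : Ω → ℝ := fun ω => A.indicator 1 ω * g0 (traj X ω) with hgd
  have hind : ∀ ω, 0 ≤ A.indicator (1 : Ω → ℝ) ω ∧ A.indicator (1 : Ω → ℝ) ω ≤ 1 := fun ω => by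
    by_cases h : ω ∈ A <;> simp [h]
  have hAm : Measurable[ℱ (s + n)] (A.indicator (1 : Ω → ℝ)) :=
    Measurable.indicator measurable_const (ℱ.mono (Nat.le_add_right s n) _ hA)
  have hgm : Measurable[ℱ (s + n)] g := by
    refine hAm.mul (measurable_of_path hX (s + n) (F := g0) fun x y h => ?_)
    simp only [hg0d, confined_congr h,
      visits_congr (z := z) (s := s) (n := n + 1) fun i hi => h i (by omega)]
  have hgb : ∀ ω, 0 ≤ g ω ∧ g ω ≤ Real.exp (θ * (n + 1)) := fun ω => by
    have h1 := hind ω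
    have h2 := hg0b (traj X ω)
    exact ⟨mul_nonneg h1.1 h2.1, (mul_le_of_le_one_left h2.1 h1.2).trans h2.2⟩
  have hgn : ∀ᵐ ω ∂μ, ‖g ω‖ ≤ Real.exp (θ * (n + 1)) := Filter.Eventually.of_forall fun ω => by
    rw [Real.norm_of_nonneg (hgb ω).1]; exact (hgb ω).2
  have hgM : AEStronglyMeasurable g μ := (hgm.mono (ℱ.le _) le_rfl).aestronglyMeasurable
  have hkey := integral_mul_le_of_le_condExp (ℱ.le (s + n)) hgm.stronglyMeasurable
    (Filter.Eventually.of_forall fun ω => (hgb ω).1) (Filter.Eventually.of_forall fun ω => (hgb ω).2)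
    hφWi hψi hψle
  -- the predictable part
  have hpm : ∀ k, Measurable[ℱ (s + k)] fun ω => penaltySum pen (traj X ω) s z k := fun k =>
    measurable_of_path hX (s + k) (F := fun x => penaltySum pen x s z k) fun x y h =>
      penaltySum_congr fun i hi => h i hi.le
  have hpb : ∀ k x, penaltySum pen x s z k ≤ k * Cp := fun k x => by
    have hCp : 0 ≤ Cp := (hpen0 0).trans (hpenC 0)
    calc penaltySum pen x s z k ≤ ∑ i ∈ freshTimes x s k, Cp := Finset.sum_le_sum fun _ _ => hpenC _
      _ = (freshTimes x s k).card * Cp := by simp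
      _ ≤ k * Cp := by
        refine mul_le_mul_of_nonneg_right ?_ hCp
        have : (freshTimes x s k).card ≤ k := by
          simpa [freshTimes] using Finset.card_filter_le (Finset.range k) _
        exact_mod_cast this
  have hpi : ∀ k, Integrable (fun ω => penaltySum pen (traj X ω) s z k) μ := fun k =>
    Integrable.of_bound ((hpm k).mono (ℱ.le _) le_rfl).aestronglyMeasurable (k * Cp)
      (Filter.Eventually.of_forall fun ω => by
        rw [Real.norm_of_nonneg (penaltySum_nonneg hpen0 _ _ _ _)]; exact hpb k _)
  -- Likewise the penalty sum already contains the term of time `s + n`; only `f` is still evaluated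
  -- before the jump.
  set V : Ω → ℝ := fun ω => 2 * H - f (latticeVec (W n ω)) - penaltySum pen (traj X ω) s z (n + 1)
    with hV
  have hVi : Integrable V μ := ((integrable_const _).sub (hfW n)).sub (hpi (n + 1))
  have hgVi : Integrable (fun ω => g ω * V ω) μ := hVi.bdd_mul hgM hgn
  have hgφi : Integrable (fun ω => g ω * φ (W n ω) ω) μ := hφWi.bdd_mul hgM hgn
  have hgψi : Integrable (fun ω => g ω * ψ ω) μ := hψi.bdd_mul hgM hgn
  -- measurability and integrability of the functional itself
  have hZm : ∀ k, Measurable fun ω => localTimeFun f pen θ H ρ M s z k (traj X ω) := fun k => by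
    refine (measurable_of_path hX (s + k) (F := localTimeFun f pen θ H ρ M s z k)
      fun x y h => ?_).mono (ℱ.le _) le_rfl
    simp only [localTimeFun, confined_congr h, visits_congr (z := z) fun i hi => h i (le_of_lt hi),
      penaltySum_congr (z := z) fun i hi => h i (le_of_lt hi), h (s + k) le_rfl,
      h s (Nat.le_add_right s k)]
  have hAM : Measurable (A.indicator (1 : Ω → ℝ)) := hAm.mono (ℱ.le _) le_rfl
  have hZi : ∀ k, Integrable
      (fun ω => A.indicator 1 ω * localTimeFun f pen θ H ρ M s z k (traj X ω)) μ := fun k => by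
    have h1 : Integrable (fun ω => 2 * H - f (latticeVec (W k ω)) -
        penaltySum pen (traj X ω) s z k) μ := ((integrable_const _).sub (hfW k)).sub (hpi k)
    refine (h1.norm.const_mul (Real.exp (θ * k))).mono' (hAM.mul (hZm k)).aestronglyMeasurable ?_
    refine Filter.Eventually.of_forall fun ω => ?_
    rw [norm_mul, Real.norm_of_nonneg (hind ω).1]
    refine (mul_le_of_le_one_left (norm_nonneg _) (hind ω).2).trans ?_
    unfold localTimeFun
    split_ifs
    · rw [norm_mul, Real.norm_of_nonneg (Real.exp_pos _).le]
      refine mul_le_mul_of_nonneg_right (Real.exp_le_exp.2 ?_) (norm_nonneg _)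
      refine mul_le_mul_of_nonneg_left ?_ hθ0.le
      exact_mod_cast visits_le _ s z k
    · rw [norm_zero]; positivity
  have hfirst : ∫ ω, A.indicator 1 ω * localTimeFun f pen θ H ρ M s z (n + 1) (traj X ω) ∂μ ≤
      ∫ ω, (g ω * V ω - g ω * φ (W n ω) ω) ∂μ := by
    refine integral_mono_ae (hZi (n + 1)) (hgVi.sub hgφi) ?_
    filter_upwards [hjump] with ω hjω
    simp only [hgd, mul_assoc, ← mul_sub]
    refine mul_le_mul_of_nonneg_left ?_ (hind ω).1
    have hd : V ω - φ (W n ω) ω = 2 * H - f (latticeVec (W (n + 1) ω)) -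
        penaltySum pen (traj X ω) s z (n + 1) := by
      have := congrFun hφW ω
      rw [this, hV]; ring
    rw [hd]
    by_cases hn : Confined (traj X ω) s ρ M n
    · have hr1 : (siteRange (traj X ω) s (n + 1)).card ≤ M + 1 := by
        rw [siteRange_succ]
        exact (Finset.card_insert_le _ _).trans (by linarith [hn.2])
      have h1 := penaltySum_le hpen0 hp2 (traj X ω) s z (n + 1) hr1
      have h2 : f (latticeVec (W (n + 1) ω)) ≤ H1 := by
        refine hf1 _ ?_
        rw [hWsucc]
        refine (norm_add_le _ _).trans ?_
        have h3 := hn.1 n le_rfl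
        have h4 := hjω (s + n)
        simp only [hW]
        rw [latticeVec_sub]
        linarith [norm_sub_le (latticeVec (traj X ω (s + n) - traj X ω s)) (latticeVec z)]
      simp only [hg0d, if_pos hn]
      unfold localTimeFun
      split_ifs
      · exact le_rfl
      · exact mul_nonneg (Real.exp_pos _).le (by linarith)
    · have hn' : ¬ Confined (traj X ω) s ρ M (n + 1) := fun h => hn h.of_succ
      simp [hg0d, localTimeFun, hn, hn']
  have hlast : ∫ ω, (g ω * V ω - g ω * ψ ω) ∂μ ≤
      ∫ ω, A.indicator 1 ω * localTimeFun f pen θ H ρ M s z n (traj X ω) ∂μ := by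
    refine integral_mono (hgVi.sub hgψi) (hZi n) fun ω => ?_
    simp only [hgd, mul_assoc, ← mul_sub]
    refine mul_le_mul_of_nonneg_left ?_ (hind ω).1
    by_cases hn : Confined (traj X ω) s ρ M n
    · simp only [hg0d, localTimeFun, if_pos hn]
      set T := 2 * H - f (latticeVec (W n ω)) - penaltySum pen (traj X ω) s z n with hT
      -- The penalty newly added to the sum cancels the loss allowed in `ψ`, so that only the gain
      -- `c` remains.
      have hd : V ω - ψ ω = T - c (latticeVec (W n ω)) := by
        have h1 := penaltySum_succ pen (traj X ω) s z n
        have h2 : {y | IsFresh y (s + n)}.indicator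
            (fun _ => pen (latticeVec (traj X ω (s + n) - traj X ω s - z))) (traj X ω) =
            (fresh X (s + n)).indicator (fun ω => pen (latticeVec (W n ω))) ω := by
          by_cases h : ω ∈ fresh X (s + n)
          · rw [Set.indicator_of_mem h, Set.indicator_of_mem (by exact h)]
          · rw [Set.indicator_of_notMem h, Set.indicator_of_notMem (by exact h)]
        rw [h2] at h1
        simp only [hV, hψ, hT, h1]; ring
      rw [hd, visits_succ]
      have hT2 : T ≤ 2 * H := by
        have h1 := hf0 (latticeVec (W n ω))
        have h2 := penaltySum_nonneg hpen0 (traj X ω) s z n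
        linarith
      have hT0 : 0 ≤ T := by
        have h1 := penaltySum_le hpen0 hp2 (traj X ω) s z n (hn.2.trans (Nat.le_succ M))
        have h2 : f (latticeVec (W n ω)) ≤ H1 := by
          refine hf1 _ ?_
          have h3 := hn.1 n le_rfl
          simp only [hW]
          rw [latticeVec_sub]
          linarith [norm_sub_le (latticeVec (traj X ω (s + n) - traj X ω s)) (latticeVec z)]
        linarith
      by_cases hv : traj X ω (s + n) - traj X ω s = z
      · have hW0 : latticeVec (W n ω) = 0 := by simp only [hW, hv, sub_self, latticeVec_zero]
        rw [Set.indicator_of_mem (by exact hv), hW0]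
        push_cast
        rw [mul_add, mul_one, Real.exp_add, mul_assoc]
        refine mul_le_mul_of_nonneg_left ?_ (Real.exp_pos _).le
        have h1 : c 0 = θ * (2 * H) := by rw [hθ]; field_simp
        have h2 : θ * T ≤ c 0 := by rw [h1]; exact mul_le_mul_of_nonneg_left hT2 hθ0.le
        have h3 := Real.add_one_le_exp (-θ)
        have h4 : T - c 0 ≤ Real.exp (-θ) * T := by nlinarith
        calc Real.exp θ * (T - c 0) ≤ Real.exp θ * (Real.exp (-θ) * T) :=
              mul_le_mul_of_nonneg_left h4 (Real.exp_pos _).le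
          _ = T := by rw [← mul_assoc, ← Real.exp_add]; simp
      · rw [Set.indicator_of_notMem (by exact hv), add_zero]
        refine mul_le_mul_of_nonneg_left ?_ (Real.exp_pos _).le
        linarith [hc0 (latticeVec (W n ω))]
    · simp [hg0d, localTimeFun, hn]
  refine ⟨hZi n, hfirst.trans (le_trans ?_ hlast)⟩
  rw [integral_sub hgVi hgφi, integral_sub hgVi hgψi]
  linarith

/-- Markov's inequality for the supermartingale: it starts at most at `2 * H`, and under confinement
its bracket is at least `H`, so on the event it is at least `H * exp (θ * l)`. The bound does not
depend on the horizon `n`. -/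
theorem measureReal_visits_le [IsProbabilityMeasure μ] (hX : Adapted ℱ X)
    (hjump : ∀ᵐ ω ∂μ, ∀ n, ‖jump X n ω‖ ≤ K) (hK : 0 ≤ K)
    (hf0 : ∀ w, 0 ≤ f w) (hfB : ∀ R, ∃ B, ∀ w, ‖w‖ ≤ R → f w ≤ B)
    (hpen0 : ∀ w, 0 ≤ pen w) {Cp : ℝ} (hpenC : ∀ w, pen w ≤ Cp)
    (hc0 : ∀ w, 0 ≤ c w) {Cc : ℝ} (hcC : ∀ w, c w ≤ Cc)
    (hstep : ∀ n w, ∀ᵐ ω ∂μ, c w - (fresh X n).indicator (fun _ => pen w) ω ≤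
      (μ[fun ω => f (w + jump X n ω) - f w | ℱ n]) ω)
    (hH : H = H1 + H2) (hc : 0 < c 0) (hH0 : 0 < H)
    (hf1 : ∀ w, ‖w‖ ≤ 2 * ρ + K → f w ≤ H1)
    (hp2 : ∀ F : Finset (Fin d → ℤ), F.card ≤ M + 1 → ∑ v ∈ F, pen (latticeVec v) ≤ H2)
    {s : ℕ} {A : Set Ω} (hA : MeasurableSet[ℱ s] A) {z : Fin d → ℤ} (hz : ‖latticeVec z‖ ≤ ρ)
    (n : ℕ) (l : ℝ) :
    μ.real (A ∩ {ω | Confined (traj X ω) s ρ M n ∧ l ≤ visits (traj X ω) s z n}) ≤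
      2 * Real.exp (-(c 0 / (2 * H) * l)) * μ.real A := by
  have step := localTimeFun_step hX hjump hK hf0 hfB hpen0 hpenC hc0 hcC hstep hH hc hH0 hf1 hp2 hA hz
  set θ := c 0 / (2 * H) with hθ
  have hθ0 : 0 < θ := by positivity
  set Z : ℕ → Ω → ℝ := fun k ω => A.indicator 1 ω * localTimeFun f pen θ H ρ M s z k (traj X ω)
    with hZ
  have hle : ∀ k, ∫ ω, Z k ω ∂μ ≤ ∫ ω, Z 0 ω ∂μ := fun k => by
    induction k with
    | zero => exact le_rfl
    | succ k ih => exact (step k).2.trans ih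
  have hAM := ℱ.le s A hA
  have h0 : ∫ ω, Z 0 ω ∂μ ≤ 2 * H * μ.real A := by
    calc ∫ ω, Z 0 ω ∂μ ≤ ∫ ω, A.indicator (fun _ => 2 * H) ω ∂μ := by
          refine integral_mono (step 0).1 ((integrable_const _).indicator hAM) fun ω => ?_
          by_cases hω : ω ∈ A
          · simp only [hZ, Set.indicator_of_mem hω, Pi.one_apply, one_mul, localTimeFun]
            split_ifs
            · have h1 := hf0 (latticeVec (traj X ω (s + 0) - traj X ω s - z))
              have h2 := penaltySum_nonneg hpen0 (traj X ω) s z 0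
              have h3 : visits (traj X ω) s z 0 = 0 := Nat.le_zero.1 (visits_le _ _ _ _)
              rw [h3]
              simp only [Nat.cast_zero, mul_zero, Real.exp_zero, one_mul]
              linarith
            · linarith
          · simp [hZ, hω]
      _ = 2 * H * μ.real A := by rw [integral_indicator_const _ hAM, smul_eq_mul, mul_comm]
  set E := A ∩ {ω | Confined (traj X ω) s ρ M n ∧ l ≤ visits (traj X ω) s z n} with hE
  have hEm : MeasurableSet E := by
    refine hAM.inter (ℱ.le (s + n) _ (measurableSet_of_path hX (s + n)
      (P := fun x => Confined x s ρ M n ∧ l ≤ visits x s z n) fun x y h => ?_))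
    rw [confined_congr h, visits_congr fun i hi => h i (le_of_lt hi)]
  have hlow : ∀ ω, Confined (traj X ω) s ρ M n → H ≤ 2 * H -
      f (latticeVec (traj X ω (s + n) - traj X ω s - z)) - penaltySum pen (traj X ω) s z n := by
    intro ω hn
    have h1 := penaltySum_le hpen0 hp2 (traj X ω) s z n (hn.2.trans (Nat.le_succ M))
    have h2 : f (latticeVec (traj X ω (s + n) - traj X ω s - z)) ≤ H1 := by
      refine hf1 _ ?_
      have h3 := hn.1 n le_rfl
      rw [latticeVec_sub]
      linarith [norm_sub_le (latticeVec (traj X ω (s + n) - traj X ω s)) (latticeVec z)]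
    linarith
  have h1 : ∫ ω, E.indicator (fun _ => Real.exp (θ * l) * H) ω ∂μ ≤ ∫ ω, Z n ω ∂μ := by
    refine integral_mono ((integrable_const _).indicator hEm) (step n).1 fun ω => ?_
    by_cases hω : ω ∈ E
    · have h2 := hlow ω hω.2.1
      simp only [hZ, Set.indicator_of_mem hω, Set.indicator_of_mem hω.1, Pi.one_apply, one_mul,
        localTimeFun, if_pos hω.2.1]
      exact mul_le_mul (Real.exp_le_exp.2 (mul_le_mul_of_nonneg_left hω.2.2 hθ0.le)) h2 hH0.le
        (Real.exp_pos _).le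
    · rw [Set.indicator_of_notMem hω]
      refine mul_nonneg (Set.indicator_nonneg (fun _ _ => zero_le_one) _) ?_
      unfold localTimeFun
      split_ifs with hn
      · exact mul_nonneg (Real.exp_pos _).le (hH0.le.trans (hlow ω hn))
      · exact le_rfl
  rw [integral_indicator_const _ hEm, smul_eq_mul] at h1
  have h2 := h1.trans ((hle n).trans h0)
  have h3 : μ.real E * Real.exp (θ * l) ≤ 2 * μ.real A := by
    refine le_of_mul_le_mul_right ?_ hH0
    linarith
  rw [Real.exp_neg]
  calc μ.real E = μ.real E * Real.exp (θ * l) * (Real.exp (θ * l))⁻¹ := by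
        rw [mul_assoc, mul_inv_cancel₀ (Real.exp_pos _).ne', mul_one]
    _ ≤ 2 * μ.real A * (Real.exp (θ * l))⁻¹ :=
        mul_le_mul_of_nonneg_right h3 (inv_nonneg.2 (Real.exp_pos _).le)
    _ = _ := by ring

end LocalTime

end
end ExcitedWalk

namespace ExcitedWalk
noncomputable section

/-! ### Asymptotics -/

open Filter Topology in
-- Half of the exponent absorbs the polynomial prefactor, the other half exceeds `n ^ γ'`.
theorem eventually_mul_rpow_mul_exp_le (C m : ℝ) {c γ γ' : ℝ} (hc : 0 < c) (hγ' : 0 < γ')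
    (hγ : γ' < γ) :
    ∀ᶠ n : ℕ in atTop, C * (n : ℝ) ^ m * Real.exp (-(c * (n : ℝ) ^ γ)) ≤
      Real.exp (-(n : ℝ) ^ γ') := by
  have hγ0 : 0 < γ := hγ'.trans hγ
  have hn : Tendsto (fun n : ℕ => (n : ℝ)) atTop atTop := tendsto_natCast_atTop_atTop
  have h1 : Tendsto (fun n : ℕ => (n : ℝ) ^ γ) atTop atTop := (tendsto_rpow_atTop hγ0).comp hn
  have h2 : Tendsto (fun n : ℕ => (n : ℝ) ^ (γ - γ')) atTop atTop :=
    (tendsto_rpow_atTop (by linarith)).comp hn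
  have h3 := ((tendsto_rpow_mul_exp_neg_mul_atTop_nhds_zero (m / γ) (c / 2)
    (by positivity)).comp h1).const_mul |C|
  rw [mul_zero] at h3
  filter_upwards [h2.eventually_ge_atTop (2 / c), h3.eventually (gt_mem_nhds zero_lt_one),
    eventually_ge_atTop 1] with n a1 a2 a3
  have hn0 : (0 : ℝ) < n := by exact_mod_cast a3
  simp only [Function.comp_apply] at a2
  rw [← Real.rpow_mul hn0.le, mul_div_cancel₀ _ hγ0.ne'] at a2
  have hs : (n : ℝ) ^ γ' * (2 / c) ≤ (n : ℝ) ^ γ := by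
    have : (n : ℝ) ^ γ = (n : ℝ) ^ γ' * (n : ℝ) ^ (γ - γ') := by
      rw [← Real.rpow_add hn0]; congr 1; ring
    rw [this]
    exact mul_le_mul_of_nonneg_left a1 (by positivity)
  have hs2 : (n : ℝ) ^ γ' ≤ c / 2 * (n : ℝ) ^ γ := by
    rw [mul_div_assoc', div_le_iff₀ hc] at hs
    linarith
  have e : Real.exp (-(c * (n : ℝ) ^ γ)) =
      Real.exp (-(c / 2 * (n : ℝ) ^ γ)) * Real.exp (-(c / 2 * (n : ℝ) ^ γ)) := by
    rw [← Real.exp_add]; congr 1; ring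
  have hC : C * ((n : ℝ) ^ m * Real.exp (-(c / 2 * (n : ℝ) ^ γ))) ≤ 1 := by
    refine le_trans (mul_le_mul_of_nonneg_right (le_abs_self C) (by positivity)) ?_
    have : -(c / 2) * (n : ℝ) ^ γ = -(c / 2 * (n : ℝ) ^ γ) := by ring
    rw [this] at a2
    exact a2.le
  calc C * (n : ℝ) ^ m * Real.exp (-(c * (n : ℝ) ^ γ))
      = C * ((n : ℝ) ^ m * Real.exp (-(c / 2 * (n : ℝ) ^ γ))) *
          Real.exp (-(c / 2 * (n : ℝ) ^ γ)) := by rw [e]; ring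
    _ ≤ 1 * Real.exp (-(c / 2 * (n : ℝ) ^ γ)) :=
        mul_le_mul_of_nonneg_right hC (Real.exp_pos _).le
    _ ≤ Real.exp (-(n : ℝ) ^ γ') := by rw [one_mul]; exact Real.exp_le_exp.2 (by linarith)

open Filter in
theorem eventually_mul_rpow_le (C : ℝ) {a b : ℝ} (hab : a < b) :
    ∀ᶠ n : ℕ in atTop, C * (n : ℝ) ^ a ≤ (n : ℝ) ^ b := by
  have h2 : Tendsto (fun n : ℕ => (n : ℝ) ^ (b - a)) atTop atTop :=
    (tendsto_rpow_atTop (by linarith)).comp tendsto_natCast_atTop_atTop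
  filter_upwards [h2.eventually_ge_atTop C, eventually_ge_atTop 1] with n h1 h2
  have hn0 : (0 : ℝ) < n := by exact_mod_cast h2
  have : (n : ℝ) ^ b = (n : ℝ) ^ (b - a) * (n : ℝ) ^ a := by
    rw [← Real.rpow_add hn0]; congr 1; ring
  rw [this]
  exact mul_le_mul_of_nonneg_right h1 (by positivity)

variable {d : ℕ} {Ω : Type*} {mΩ : MeasurableSpace Ω} {μ : Measure Ω} [IsProbabilityMeasure μ]
  {ℱ : Filtration ℕ mΩ} {ℓ : EuclideanSpace ℝ (Fin d)} {X : ℕ → Ω → Fin d → ℤ} {K lam h r : ℝ}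

/-! ### Concentration of linear functionals of the walk -/

theorem sum_inner_jump (X : ℕ → Ω → Fin d → ℤ) (v : EuclideanSpace ℝ (Fin d)) (ω : Ω) (s n : ℕ) :
    ∑ i ∈ Finset.range n, inner ℝ v (jump X (s + i) ω) =
      inner ℝ v (latticeVec (traj X ω (s + n) - traj X ω s)) := by
  induction n with
  | zero => simp [latticeVec_zero]
  | succ n ih =>
    rw [Finset.sum_range_succ, ih, ← add_assoc, latticeVec_traj_succ, inner_add_right]

theorem sum_indicator_fresh (X : ℕ → Ω → Fin d → ℤ) (q : ℝ) (ω : Ω) (s n : ℕ) :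
    ∑ i ∈ Finset.range n, (fresh X (s + i)).indicator (fun _ => q) ω =
      q * (freshTimes (traj X ω) s n).card := by
  classical
  have h1 : ∀ i, (fresh X (s + i)).indicator (fun _ => q) ω =
      if IsFresh (traj X ω) (s + i) then q else 0 := fun i => rfl
  simp only [h1, ← Finset.sum_filter]
  rw [Finset.sum_const, nsmul_eq_mul, mul_comm]
  congr 3

/-- Drift occurs only at fresh times, so their number bounds the compensator. Used with `q = K` for
arbitrary directions and with `q = -lam`, `v = -ℓ` for the upward drift. -/
theorem WalkBounds.measureReal_inner_ge_le (hw : WalkBounds μ ℱ ℓ X K lam h r)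
    {v : EuclideanSpace ℝ (Fin d)} (hv : ‖v‖ ≤ 1) {q : ℝ}
    (hq : ∀ n, ∀ᵐ ω ∂μ, ω ∈ fresh X n → inner ℝ v ((μ[jump X n | ℱ n]) ω) ≤ q) {θ : ℝ}
    (hθ : 0 ≤ θ) (hθK : θ * K ≤ 1) {s : ℕ} {A : Set Ω} (hA : MeasurableSet[ℱ s] A) (n : ℕ)
    (x : ℝ) :
    μ.real (A ∩ {ω | q * (freshTimes (traj X ω) s n).card + x ≤
      inner ℝ v (latticeVec (traj X ω (s + n) - traj X ω s))}) ≤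
      Real.exp (-(θ * x) + n * (θ ^ 2 * K ^ 2)) * μ.real A := by
  have key := measureReal_sum_ge_le (μ := μ) (ℱ := ℱ) (K := K) (Ka := |q|) (θ := θ)
    (ξ := fun n ω => inner ℝ v (jump X n ω))
    (a := fun n ω => (fresh X n).indicator (fun _ => q) ω)
    (fun n => (measurable_jump hw.adapted n).const_inner)
    (by
      filter_upwards [hw.bound] with ω h n
      refine (abs_real_inner_le_norm _ _).trans ?_
      have := h n
      nlinarith [norm_nonneg v, norm_nonneg (jump X n ω)])
    (fun n => Measurable.indicator measurable_const (measurableSet_fresh hw.adapted n))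
    (fun n ω => by
      by_cases hω : ω ∈ fresh X n
      · rw [Set.indicator_of_mem hω]
      · rw [Set.indicator_of_notMem hω, abs_zero]; exact abs_nonneg q)
    (fun n => by
      filter_upwards [hw.condExp_inner_jump n v, hw.drift_zero n, hq n] with ω h1 h2 h3
      rw [h1]
      by_cases hω : ω ∈ fresh X n
      · rw [Set.indicator_of_mem hω]; exact h3 hω
      · rw [Set.indicator_of_notMem hω, h2 hω, inner_zero_right])
    hθ hθK hA n x
  simpa only [sum_inner_jump, sum_indicator_fresh] using key

/-- The displacement in a given direction, up to the contribution of the drift. -/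
theorem WalkBounds.measureReal_disp_ge_le (hw : WalkBounds μ ℱ ℓ X K lam h r)
    {v : EuclideanSpace ℝ (Fin d)} (hv : ‖v‖ ≤ 1) {θ : ℝ}
    (hθ : 0 ≤ θ) (hθK : θ * K ≤ 1) {s : ℕ} {A : Set Ω} (hA : MeasurableSet[ℱ s] A) (n : ℕ)
    (x : ℝ) :
    μ.real (A ∩ {ω | K * (freshTimes (traj X ω) s n).card + x ≤
      inner ℝ v (latticeVec (traj X ω (s + n) - traj X ω s))}) ≤
      Real.exp (-(θ * x) + n * (θ ^ 2 * K ^ 2)) * μ.real A := by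
  refine hw.measureReal_inner_ge_le hv (fun n => ?_) hθ hθK hA n x
  have h1 : (fun ω => inner ℝ v (jump X n ω)) ≤ᵐ[μ] fun _ => K := by
    filter_upwards [hw.bound] with ω h
    refine (real_inner_le_norm _ _).trans ?_
    have := h n
    nlinarith [norm_nonneg v, norm_nonneg (jump X n ω)]
  have h2 := condExp_mono (m := ℱ n) ((hw.integrable_jump n).const_inner v)
    (integrable_const K) h1
  rw [condExp_const (ℱ.le n)] at h2
  filter_upwards [h2, hw.condExp_inner_jump n v] with ω a1 a2 _
  rwa [← a2]

/-- The drift at first visits pushes the walk in direction `ℓ`. -/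
theorem WalkBounds.measureReal_height_le_le (hw : WalkBounds μ ℱ ℓ X K lam h r) {θ : ℝ}
    (hθ : 0 ≤ θ) (hθK : θ * K ≤ 1) {s : ℕ} {A : Set Ω} (hA : MeasurableSet[ℱ s] A) (n : ℕ)
    (x : ℝ) :
    μ.real (A ∩ {ω | inner ℝ (latticeVec (traj X ω (s + n) - traj X ω s)) ℓ ≤
      lam * (freshTimes (traj X ω) s n).card - x}) ≤
      Real.exp (-(θ * x) + n * (θ ^ 2 * K ^ 2)) * μ.real A := by
  have key := hw.measureReal_inner_ge_le (v := -ℓ) (q := -lam)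
    (by rw [norm_neg, hw.direction]) (fun n => by
      filter_upwards [hw.drift_pos n] with ω h1 h2
      rw [inner_neg_left, real_inner_comm]
      linarith [h1 h2]) hθ hθK hA n x
  refine le_trans (measureReal_mono ?_) key
  rintro ω ⟨h1, h2⟩
  refine ⟨h1, ?_⟩
  simp only [Set.mem_ofPred_eq] at h2 ⊢
  rw [inner_neg_left, real_inner_comm]
  linarith

/-- A choice of the free parameter which is good for deviations of order larger than `√n`. -/
theorem exists_theta (hK : 1 ≤ K) {n : ℕ} (hn : 1 ≤ n) {i : ℕ} (hi : i ≤ n) (x : ℝ) :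
    ∃ θ : ℝ, 0 ≤ θ ∧ θ * K ≤ 1 ∧
      Real.exp (-(θ * x) + i * (θ ^ 2 * K ^ 2)) ≤
        3 * Real.exp (-(K⁻¹ * ((n : ℝ) ^ (-(1 / 2) : ℝ) * x))) := by
  have hn1 : (1 : ℝ) ≤ n := by exact_mod_cast hn
  have hK0 : 0 < K := by linarith
  -- This size makes the quadratic term at most one for every `i ≤ n`; the factor 3 in the bound
  -- comes from `e ≤ 3`.
  refine ⟨K⁻¹ * (n : ℝ) ^ (-(1 / 2) : ℝ), by positivity, ?_, ?_⟩
  · rw [mul_comm, ← mul_assoc, mul_inv_cancel₀ hK0.ne', one_mul]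
    exact Real.rpow_le_one_of_one_le_of_nonpos hn1 (by norm_num)
  · have h1 : (i : ℝ) * ((K⁻¹ * (n : ℝ) ^ (-(1 / 2) : ℝ)) ^ 2 * K ^ 2) ≤ 1 := by
      have e : (K⁻¹ * (n : ℝ) ^ (-(1 / 2) : ℝ)) ^ 2 * K ^ 2 = (n : ℝ)⁻¹ := by
        rw [mul_pow, ← Real.rpow_natCast ((n : ℝ) ^ _), ← Real.rpow_mul (by linarith)]
        norm_num
        rw [Real.rpow_neg_one]
        field_simp
      rw [e, ← div_eq_mul_inv, div_le_one (by linarith)]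
      exact_mod_cast hi
    calc _ ≤ Real.exp (1 + -(K⁻¹ * ((n : ℝ) ^ (-(1 / 2) : ℝ) * x))) :=
          Real.exp_le_exp.2 (by rw [← mul_assoc]; linarith)
      _ ≤ _ := by
        rw [Real.exp_add]
        exact mul_le_mul_of_nonneg_right (by linarith [Real.exp_one_lt_d9]) (Real.exp_pos _).le

/-! ### The number of visited sites -/

/-- The number of visits to a site by a walk that is confined. -/
theorem WalkBounds.exists_visits_bound (hd : 2 ≤ d) (hw : WalkBounds μ ℱ ℓ X K lam h r) :
    ∃ c η : ℝ, 0 < c ∧ 0 < η ∧ η ≤ 1 / 2 ∧ ∀ (ρ : ℝ) (M : ℕ), (M : ℝ) + 1 ≤ ρ →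
      ∀ (s : ℕ) (A : Set Ω), MeasurableSet[ℱ s] A → ∀ z : Fin d → ℤ, ‖latticeVec z‖ ≤ ρ →
      ∀ (n : ℕ) (l : ℝ), 0 ≤ l →
      μ.real (A ∩ {ω | Confined (traj X ω) s ρ M n ∧ l ≤ visits (traj X ω) s z n}) ≤
        2 * Real.exp (-(c * (ρ ^ (-(1 - η)) * l))) * μ.real A := by
  set δ := h * r ^ 2 with hδ
  have hδ0 : 0 < δ := mul_pos hw.h_pos (pow_pos hw.r_pos 2)
  have hK := hw.one_le_K
  have hK0 : 0 < K := by linarith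
  -- `ε` is small enough for the transverse variance `δ` to pay for it, and `b` below is so large
  -- that the Taylor remainders are negligible everywhere.
  set ε := min (1 / 2) (δ / (4 * K ^ 2)) with hε
  have hε0 : 0 < ε := lt_min (by norm_num) (by positivity)
  have hε2 : ε ≤ 1 / 2 := min_le_left _ _
  have hεK : ε * K ^ 2 ≤ δ / 4 := by
    calc ε * K ^ 2 ≤ δ / (4 * K ^ 2) * K ^ 2 :=
          mul_le_mul_of_nonneg_right (min_le_right _ _) (sq_nonneg K)
      _ = δ / 4 := by field_simp
  set b := max (max (6 * K) δ) (328 * K ^ 3 * 4 / δ) with hb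
  have hb6 : 6 * K ≤ b := (le_max_left _ _).trans (le_max_left _ _)
  have hδb : δ ≤ b := (le_max_right _ _).trans (le_max_left _ _)
  have hbK : 328 * K ^ 3 ≤ δ / 4 * b := by
    have := mul_le_mul_of_nonneg_left (le_max_right (max (6 * K) δ) (328 * K ^ 3 * 4 / δ))
      (by positivity : 0 ≤ δ / 4)
    refine le_trans (le_of_eq ?_) this
    field_simp
  have hb1 : 1 ≤ b := by linarith
  have hd1 : (2 : ℝ) ≤ d := by exact_mod_cast hd
  -- The exponent lost in `sum_le_of_decay`. It is smaller than `ε`, so the size `ρ^(1 - ε)` of `f`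
  -- on the ball is dominated as well.
  set η := ε / (2 * d) with hη
  have hη0 : 0 < η := by positivity
  have hηε : η ≤ ε := by
    rw [hη, div_le_iff₀ (by positivity)]; nlinarith
  -- The two summands bound `f` near the confinement ball and the total penalty, both in units of
  -- `ρ^(1 - η)`.
  set C := (2 + K + b) + 3 * K * (3 ^ d + 1) with hC
  have hC0 : 0 < C := by positivity
  set c1 := lyapCoeff ε b (0 : EuclideanSpace ℝ (Fin d)) * (δ / 2) with hc1
  have hc1pos : 0 < c1 := by
    refine mul_pos (mul_pos (by linarith) (Real.rpow_pos_of_pos ?_ _)) (by positivity)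
    positivity
  refine ⟨c1 / (2 * C), η, by positivity, hη0, by linarith, ?_⟩
  intro ρ M hM s A hA z hz n l hl
  have hρ1 : 1 ≤ ρ := by
    have : (0 : ℝ) ≤ M := Nat.cast_nonneg M
    linarith
  have hρ0 : 0 < ρ := by linarith
  have hrpos : 0 < ρ ^ (1 - η) := Real.rpow_pos_of_pos hρ0 _
  have key := measureReal_visits_le (μ := μ) (ℱ := ℱ) (X := X) (K := K)
    (f := lyap ε b) (pen := lyapPenalty ε b K δ) (c := fun w => lyapCoeff ε b w * (δ / 2))
    (H := C * ρ ^ (1 - η)) (H1 := (2 + K + b) * ρ ^ (1 - η))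
    (H2 := 3 * K * (3 ^ d + 1) * ρ ^ (1 - η)) (ρ := ρ) (M := M) (Cp := 3 * K) (Cc := δ / 2)
    hw.adapted hw.bound hK0.le lyap_nonneg
    (fun R => ⟨_, fun w h => lyap_mono (by linarith) h⟩)
    (fun w => lyapPenalty_nonneg (by linarith) hK0.le hδ0.le w)
    (fun w => lyapPenalty_le_const hε0.le hK hδ0.le hb1 hδb w)
    (fun w => mul_nonneg (lyapCoeff_nonneg (by linarith) w) (by positivity))
    (fun w => by
      refine mul_le_of_le_one_left (by positivity) ?_
      have h1 : (‖w‖ ^ 2 + b ^ 2) ^ ((1 - ε) / 2 - 1) ≤ 1 :=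
        Real.rpow_le_one_of_one_le_of_nonpos (by nlinarith [sq_nonneg ‖w‖]) (by linarith)
      have h2 : 0 ≤ (‖w‖ ^ 2 + b ^ 2) ^ ((1 - ε) / 2 - 1) := by positivity
      unfold lyapCoeff
      nlinarith)
    (fun n w => hw.condExp_lyap_ge hd hε0 hε2 hεK hb6 hbK n w)
    (by rw [hC]; ring) hc1pos (by positivity)
    (fun w hwn => by
      refine (lyap_mono (by linarith) hwn).trans ?_
      have h1 : (2 * ρ + K) ^ 2 + b ^ 2 ≤ ((2 + K + b) * ρ) ^ 2 := by
        have h2 : 2 * ρ + K + b ≤ (2 + K + b) * ρ := by nlinarith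
        have h3 := pow_le_pow_left₀ (by positivity) h2 2
        nlinarith [mul_pos (by positivity : 0 < 2 * ρ + K) (by linarith : 0 < b)]
      calc _ ≤ (((2 + K + b) * ρ) ^ 2) ^ ((1 - ε) / 2) :=
            Real.rpow_le_rpow (by positivity) h1 (by linarith)
        _ = ((2 + K + b) * ρ) ^ (1 - ε) := by
            rw [← Real.rpow_natCast _ 2, ← Real.rpow_mul (by positivity)]; congr 1; push_cast; ring
        _ = (2 + K + b) ^ (1 - ε) * ρ ^ (1 - ε) := Real.mul_rpow (by positivity) hρ0.le
        _ ≤ (2 + K + b) * ρ ^ (1 - η) := by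
            refine mul_le_mul ?_ (Real.rpow_le_rpow_of_exponent_le hρ1 (by linarith))
              (by positivity) (by positivity)
            calc (2 + K + b) ^ (1 - ε) ≤ (2 + K + b) ^ (1 : ℝ) :=
                  Real.rpow_le_rpow_of_exponent_le (by linarith) (by linarith)
              _ = _ := Real.rpow_one _)
    (fun F hF => by
      refine (sum_le_of_decay (c := 3 * K) (ε := ε) (by omega) (by linarith) (by positivity)
        (fun w => lyapPenalty_le_const hε0.le hK hδ0.le hb1 hδb w)
        (fun ρ v h1 h2 => lyapPenalty_le_rpow hε0.le hK hδ0.le hb1 hδb v h1 h2) hρ1 F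
        (le_trans (by exact_mod_cast hF) hM)).trans (le_of_eq rfl))
    hA hz n l
  refine key.trans (le_of_eq ?_)
  congr 4
  rw [Real.rpow_neg hρ0.le]
  simp only [← hc1]
  field_simp

end
end ExcitedWalk

namespace ExcitedWalk
noncomputable section

variable {d : ℕ} {Ω : Type*} {mΩ : MeasurableSpace Ω} {μ : Measure Ω} [IsProbabilityMeasure μ]
  {ℱ : Filtration ℕ mΩ} {ℓ : EuclideanSpace ℝ (Fin d)} {X : ℕ → Ω → Fin d → ℤ} {K lam h r : ℝ}

theorem siteRange_mono (x : ℕ → Fin d → ℤ) (s : ℕ) {m n : ℕ} (hmn : m ≤ n) :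
    siteRange x s m ⊆ siteRange x s n :=
  Finset.image_subset_image (Finset.range_mono hmn)

theorem sum_visits (x : ℕ → Fin d → ℤ) (s n : ℕ) :
    ∑ v ∈ siteRange x s n, visits x s (v - x s) n = n := by
  classical
  have h1 := Finset.card_eq_sum_card_fiberwise (s := Finset.range n) (t := siteRange x s n)
    (f := fun i => x (s + i)) fun i hi => Finset.mem_coe.2 (Finset.mem_image_of_mem _ hi)
  rw [Finset.card_range] at h1
  refine Eq.trans (Finset.sum_congr rfl fun v _ => ?_) h1.symm
  unfold visits
  congr 1
  refine Finset.filter_congr fun i _ => ?_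
  exact sub_left_inj

/-- Some site is visited at least as often as the average. -/
theorem exists_visits_ge (x : ℕ → Fin d → ℤ) (s : ℕ) {n : ℕ} (hn : 1 ≤ n) {M l : ℝ}
    (hM : ((siteRange x s n).card : ℝ) ≤ M) (hMl : M * l ≤ n) (hl : 0 ≤ l) :
    ∃ i < n, l ≤ visits x s (x (s + i) - x s) n := by
  by_contra! hcon
  have h1 : ∑ v ∈ siteRange x s n, (visits x s (v - x s) n : ℝ) < ∑ v ∈ siteRange x s n, l := by
    refine Finset.sum_lt_sum_of_nonempty ?_ fun v hv => ?_
    · exact ⟨x (s + 0), Finset.mem_image_of_mem _ (Finset.mem_range.2 hn)⟩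
    · obtain ⟨i, hi, rfl⟩ := Finset.mem_image.1 hv
      exact hcon i (Finset.mem_range.1 hi)
  rw [Finset.sum_const, nsmul_eq_mul, ← Nat.cast_sum, sum_visits] at h1
  have := mul_le_mul_of_nonneg_right hM hl
  linarith

theorem exists_coord_ge (w : Fin d → ℤ) {ρ : ℝ} (hρ : 0 < ρ) (hw : ρ < ‖latticeVec w‖) :
    ∃ j, ρ / d ≤ |(w j : ℝ)| := by
  by_contra! hcon
  rcases Nat.eq_zero_or_pos d with rfl | hd
  · have : ‖latticeVec w‖ = 0 := by
      rw [norm_eq_zero]; ext i; exact i.elim0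
    linarith
  have hd1 : (1 : ℝ) ≤ d := by exact_mod_cast hd
  have h1 : ‖latticeVec w‖ ^ 2 ≤ ρ ^ 2 := by
    rw [EuclideanSpace.norm_sq_eq]
    calc ∑ i, ‖(latticeVec w) i‖ ^ 2 ≤ ∑ _i : Fin d, (ρ / d) ^ 2 :=
          Finset.sum_le_sum fun i _ => pow_le_pow_left₀ (norm_nonneg _) (hcon i).le 2
      _ = ρ ^ 2 / d := by
          rw [Finset.sum_const, Finset.card_univ, Fintype.card_fin, nsmul_eq_mul]; field_simp
      _ ≤ ρ ^ 2 := div_le_self (sq_nonneg ρ) hd1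
  exact absurd (pow_le_pow_iff_left₀ (norm_nonneg _) hρ.le two_ne_zero |>.1 h1) (not_le.2 hw)

/-- The walk is unlikely to go far while visiting few sites. -/
theorem WalkBounds.measureReal_far_le (hw : WalkBounds μ ℱ ℓ X K lam h r) {n : ℕ} (hn : 1 ≤ n)
    {ρ M x : ℝ} (hρ : 0 < ρ) (hx : K * M + x ≤ ρ / d) {s : ℕ} {A : Set Ω}
    (hA : MeasurableSet[ℱ s] A) :
    μ.real (A ∩ {ω | ((siteRange (traj X ω) s n).card : ℝ) ≤ M ∧
      ∃ i ≤ n, ρ < ‖latticeVec (traj X ω (s + i) - traj X ω s)‖}) ≤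
      (n + 1) * d * 2 * (3 * Real.exp (-(K⁻¹ * ((n : ℝ) ^ (-(1 / 2) : ℝ) * x)))) * μ.real A := by
  classical
  -- A large displacement has a large coordinate, so a union bound over times, coordinates and the
  -- two signs suffices.
  set σ : Bool → ℝ := fun b => if b then 1 else -1 with hσ
  set E : ℕ × Fin d × Bool → Set Ω := fun t =>
    A ∩ {ω | K * (freshTimes (traj X ω) s t.1).card + x ≤
      inner ℝ (EuclideanSpace.single t.2.1 (σ t.2.2)) (latticeVec (traj X ω (s + t.1) - traj X ω s))}
    with hE
  set T : Finset (ℕ × Fin d × Bool) := Finset.range (n + 1) ×ˢ Finset.univ with hT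
  have hK := hw.one_le_K
  have hsub : A ∩ {ω | ((siteRange (traj X ω) s n).card : ℝ) ≤ M ∧
      ∃ i ≤ n, ρ < ‖latticeVec (traj X ω (s + i) - traj X ω s)‖} ⊆ ⋃ t ∈ T, E t := by
    rintro ω ⟨hωA, hM, i, hi, hfar⟩
    obtain ⟨j, hj⟩ := exists_coord_ge _ hρ hfar
    -- The range over all `n` steps bounds the fresh times up to any earlier `i`, so drift
    -- contributes at most `K * M` throughout.
    have hcard : ((freshTimes (traj X ω) s i).card : ℝ) ≤ M := by
      refine le_trans ?_ hM
      exact_mod_cast (card_freshTimes_le _ s i).trans (Finset.card_le_card (siteRange_mono _ s hi))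
    have hbig : K * (freshTimes (traj X ω) s i).card + x ≤
        |((traj X ω (s + i) - traj X ω s) j : ℝ)| := by
      have := mul_le_mul_of_nonneg_left hcard (by linarith : 0 ≤ K)
      linarith
    obtain ⟨b, hb⟩ : ∃ b, σ b * ((traj X ω (s + i) - traj X ω s) j : ℝ) =
        |((traj X ω (s + i) - traj X ω s) j : ℝ)| := by
      rcases abs_cases ((traj X ω (s + i) - traj X ω s) j : ℝ) with h | h
      · exact ⟨true, by rw [h.1]; simp [hσ]⟩
      · exact ⟨false, by rw [h.1]; simp [hσ]⟩
    simp only [Set.mem_iUnion]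
    refine ⟨(i, j, b), ?_, hωA, ?_⟩
    · simp [hT, Nat.lt_succ_iff.2 hi]
    · simp only [Set.mem_ofPred_eq]
      rw [EuclideanSpace.inner_single_left]
      refine hbig.trans (le_of_eq ?_)
      rw [← hb]
      simp [latticeVec]
  have hEle : ∀ t ∈ T, μ.real (E t) ≤
      3 * Real.exp (-(K⁻¹ * ((n : ℝ) ^ (-(1 / 2) : ℝ) * x))) * μ.real A := by
    rintro ⟨i, j, b⟩ ht
    have hi : i ≤ n := by simpa [hT, Nat.lt_succ_iff] using ht
    obtain ⟨θ, h0, h1, h2⟩ := exists_theta hK hn hi x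
    refine (hw.measureReal_disp_ge_le ?_ h0 h1 hA i x).trans
      (mul_le_mul_of_nonneg_right h2 measureReal_nonneg)
    cases b <;> simp [hσ]
  calc _ ≤ μ.real (⋃ t ∈ T, E t) := measureReal_mono hsub (measure_ne_top _ _)
    _ ≤ ∑ t ∈ T, μ.real (E t) := measureReal_biUnion_finset_le _ _
    _ ≤ ∑ t ∈ T, 3 * Real.exp (-(K⁻¹ * ((n : ℝ) ^ (-(1 / 2) : ℝ) * x))) * μ.real A :=
        Finset.sum_le_sum hEle
    _ = _ := by
        rw [Finset.sum_const, nsmul_eq_mul, hT, Finset.card_product, Finset.card_range,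
          Finset.card_univ, Fintype.card_prod, Fintype.card_fin, Fintype.card_bool]
        push_cast; ring

open Filter in
/-- The walk is unlikely to visit only `n^(1/2 + a)` sites in `n` steps. -/
theorem WalkBounds.exists_range_bound (hd : 2 ≤ d) (hw : WalkBounds μ ℱ ℓ X K lam h r) :
    ∃ a γ : ℝ, 0 < a ∧ a < 1 / 2 ∧ 0 < γ ∧ ∀ᶠ n : ℕ in atTop, ∀ (s : ℕ) (A : Set Ω),
      MeasurableSet[ℱ s] A →
      μ.real (A ∩ {ω | ((siteRange (traj X ω) s n).card : ℝ) ≤ (n : ℝ) ^ (1 / 2 + a)}) ≤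
        Real.exp (-(n : ℝ) ^ γ) * μ.real A := by
  obtain ⟨c, η, hc, hη0, hη, hvis⟩ := hw.exists_visits_bound hd
  have hK := hw.one_le_K
  have hK0 : 0 < K := by linarith
  -- With this choice `(1/2 + 2a)(1 - η) + a ≤ 1/2 - a`: the number of visits forced by a small
  -- range exceeds the typical number by a factor of at least `n ^ a`.
  set a := η / 16 with ha
  have ha0 : 0 < a := by positivity
  refine ⟨a, a / 2, ha0, by linarith, by positivity, ?_⟩
  filter_upwards [eventually_mul_rpow_mul_exp_le (2 * (12 * d)) 1 (inv_pos.2 hK0) (half_pos ha0)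
      (half_lt_self ha0),
    eventually_mul_rpow_mul_exp_le (2 * (2 * 3 ^ d)) d hc (half_pos ha0) (half_lt_self ha0),
    eventually_mul_rpow_le (d * (K + 1)) (by linarith : 1 / 2 + a < 1 / 2 + 2 * a),
    eventually_mul_rpow_le 2 (by linarith : 1 / 2 + a < 1 / 2 + 2 * a), eventually_ge_atTop 1]
    with n e1 e2 e3 e4 hn s A hA
  have hd0 : (0 : ℝ) < d := by exact_mod_cast (by omega : 0 < d)
  have hn1 : (1 : ℝ) ≤ n := by exact_mod_cast hn
  have hn0 : (0 : ℝ) < n := by linarith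
  set M := ⌊(n : ℝ) ^ (1 / 2 + a)⌋₊ with hM
  set ρ := (n : ℝ) ^ (1 / 2 + 2 * a) with hρ
  set l := (n : ℝ) ^ (1 / 2 - a) with hl
  have hMle : (M : ℝ) ≤ (n : ℝ) ^ (1 / 2 + a) := Nat.floor_le (by positivity)
  have hMn1 : 1 ≤ (n : ℝ) ^ (1 / 2 + a) := Real.one_le_rpow hn1 (by linarith)
  have hρ1 : 1 ≤ ρ := Real.one_le_rpow hn1 (by linarith)
  have hMρ : (M : ℝ) + 1 ≤ ρ := by linarith
  obtain ⟨Z, hZ, hZc⟩ := exists_finset_norm_le (d := d) hρ1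
  set E1 := A ∩ {ω | ((siteRange (traj X ω) s n).card : ℝ) ≤ (n : ℝ) ^ (1 / 2 + a) ∧
      ∃ i ≤ n, ρ < ‖latticeVec (traj X ω (s + i) - traj X ω s)‖} with hE1
  set E2 : (Fin d → ℤ) → Set Ω := fun z =>
    A ∩ {ω | Confined (traj X ω) s ρ M n ∧ l ≤ visits (traj X ω) s z n} with hE2
  -- Either the walk leaves the ball of radius `ρ` in spite of its small range, or by pigeonhole one
  -- of the sites in the ball is visited at least `n / n^(1/2 + a) = l` times.
  have hsub : A ∩ {ω | ((siteRange (traj X ω) s n).card : ℝ) ≤ (n : ℝ) ^ (1 / 2 + a)} ⊆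
      E1 ∪ ⋃ z ∈ Z, E2 z := by
    rintro ω ⟨hωA, hω⟩
    by_cases hfar : ∃ i ≤ n, ρ < ‖latticeVec (traj X ω (s + i) - traj X ω s)‖
    · exact Or.inl ⟨hωA, hω, hfar⟩
    · right
      push Not at hfar
      have hconf : Confined (traj X ω) s ρ M n := ⟨hfar, Nat.le_floor hω⟩
      obtain ⟨i, hi, hil⟩ := exists_visits_ge (traj X ω) s hn hω (l := l) (by
        rw [hl, ← Real.rpow_add hn0]
        have : 1 / 2 + a + (1 / 2 - a) = 1 := by ring
        rw [this, Real.rpow_one]) (by positivity)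
      simp only [Set.mem_iUnion]
      exact ⟨_, (hZ _).2 (hfar i hi.le), hωA, hconf, hil⟩
  have hb1 : μ.real E1 ≤ Real.exp (-(n : ℝ) ^ (a / 2)) / 2 * μ.real A := by
    refine (hw.measureReal_far_le hn (x := (n : ℝ) ^ (1 / 2 + a)) (by linarith) ?_ hA).trans ?_
    · rw [le_div_iff₀ hd0]; linarith
    · refine mul_le_mul_of_nonneg_right ?_ measureReal_nonneg
      have h1 : (n : ℝ) ^ (-(1 / 2) : ℝ) * (n : ℝ) ^ (1 / 2 + a) = (n : ℝ) ^ a := by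
        rw [← Real.rpow_add hn0]; congr 1; ring
      rw [h1]
      rw [Real.rpow_one] at e1
      have h2 : ((n : ℝ) + 1) * d * 2 * 3 ≤ 12 * d * n := by nlinarith
      have h3 := mul_le_mul_of_nonneg_right h2 (Real.exp_pos (-(K⁻¹ * (n : ℝ) ^ a))).le
      linarith
  have hb2 : ∀ z ∈ Z, μ.real (E2 z) ≤ 2 * Real.exp (-(c * (n : ℝ) ^ a)) * μ.real A := by
    intro z hz
    refine (hvis ρ M hMρ s A hA z ((hZ z).1 hz) n l (by positivity)).trans ?_
    refine mul_le_mul_of_nonneg_right ?_ measureReal_nonneg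
    refine mul_le_mul_of_nonneg_left (Real.exp_le_exp.2 (neg_le_neg ?_)) (by norm_num)
    refine mul_le_mul_of_nonneg_left ?_ hc.le
    rw [hρ, hl, ← Real.rpow_mul hn0.le, ← Real.rpow_add hn0]
    refine Real.rpow_le_rpow_of_exponent_le hn1 ?_
    have : η = 16 * a := by rw [ha]; ring
    rw [this]
    nlinarith
  have hb3 : μ.real (⋃ z ∈ Z, E2 z) ≤ Real.exp (-(n : ℝ) ^ (a / 2)) / 2 * μ.real A := by
    calc μ.real (⋃ z ∈ Z, E2 z) ≤ ∑ z ∈ Z, μ.real (E2 z) := measureReal_biUnion_finset_le _ _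
      _ ≤ ∑ z ∈ Z, 2 * Real.exp (-(c * (n : ℝ) ^ a)) * μ.real A := Finset.sum_le_sum hb2
      _ = Z.card * (2 * Real.exp (-(c * (n : ℝ) ^ a)) * μ.real A) := by
          rw [Finset.sum_const, nsmul_eq_mul]
      _ ≤ 3 ^ d * (n : ℝ) ^ (d : ℝ) * (2 * Real.exp (-(c * (n : ℝ) ^ a)) * μ.real A) := by
          refine mul_le_mul_of_nonneg_right (hZc.trans ?_)
            (mul_nonneg (by positivity) measureReal_nonneg)
          rw [mul_pow, Real.rpow_natCast]
          refine mul_le_mul_of_nonneg_left ?_ (by positivity)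
          refine pow_le_pow_left₀ (by positivity) ?_ d
          calc ρ ≤ (n : ℝ) ^ (1 : ℝ) := Real.rpow_le_rpow_of_exponent_le hn1 (by linarith)
            _ = n := Real.rpow_one _
      _ ≤ _ := by
          rw [← mul_assoc]
          refine mul_le_mul_of_nonneg_right ?_ measureReal_nonneg
          linarith
  calc _ ≤ μ.real (E1 ∪ ⋃ z ∈ Z, E2 z) := measureReal_mono hsub (measure_ne_top _ _)
    _ ≤ μ.real E1 + μ.real (⋃ z ∈ Z, E2 z) := measureReal_union_le _ _
    _ ≤ _ := by linarith

open Filter in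
/-- If all but `m` of the visited sites gave a drift, then the walk moves by more than `√n` in
direction `ℓ` with high probability. -/
theorem WalkBounds.exists_height_bound (hd : 2 ≤ d) (hw : WalkBounds μ ℱ ℓ X K lam h r) :
    ∃ a γ : ℝ, 0 < a ∧ a < 1 / 2 ∧ 0 < γ ∧ ∀ᶠ n : ℕ in atTop, ∀ (s : ℕ) (A : Set Ω),
      MeasurableSet[ℱ s] A → ∀ m : ℕ, 2 * (m : ℝ) ≤ (n : ℝ) ^ (1 / 2 + a) →
      μ.real (A ∩ {ω | (siteRange (traj X ω) s n).card ≤ (freshTimes (traj X ω) s n).card + m ∧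
        inner ℝ (latticeVec (traj X ω (s + n) - traj X ω s)) ℓ ≤ √n}) ≤
        Real.exp (-(n : ℝ) ^ γ) * μ.real A := by
  obtain ⟨a, γ, ha0, ha, hγ, hrange⟩ := hw.exists_range_bound hd
  have hK := hw.one_le_K
  have hK0 : 0 < K := by linarith
  set γ' := min (a / 4) (γ / 2) with hγ'
  have hγ'0 : 0 < γ' := lt_min (by positivity) (by positivity)
  refine ⟨a, γ', ha0, ha, hγ'0, ?_⟩
  filter_upwards [hrange,
    eventually_mul_rpow_mul_exp_le 2 0 one_pos hγ'0
      (lt_of_le_of_lt (min_le_right _ _) (half_lt_self hγ)),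
    eventually_mul_rpow_mul_exp_le (2 * 3) 0 (inv_pos.2 hK0) hγ'0
      (lt_of_le_of_lt (min_le_left (a / 4) (γ / 2)) (by linarith : a / 4 < a / 2)),
    eventually_mul_rpow_le (4 / lam) (by linarith : 1 / 2 + a / 2 < 1 / 2 + a),
    eventually_ge_atTop 1] with n e1 e2 e3 e4 hn s A hA m hm
  have hn1 : (1 : ℝ) ≤ n := by exact_mod_cast hn
  have hn0 : (0 : ℝ) < n := by linarith
  -- A scale between the fluctuations `√n` and the drift `lam * n^(1/2 + a) / 2`.
  set x := (n : ℝ) ^ (1 / 2 + a / 2) with hx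
  set E1 := A ∩ {ω | ((siteRange (traj X ω) s n).card : ℝ) ≤ (n : ℝ) ^ (1 / 2 + a)} with hE1
  set E2 := A ∩ {ω | inner ℝ (latticeVec (traj X ω (s + n) - traj X ω s)) ℓ ≤
      lam * (freshTimes (traj X ω) s n).card - x} with hE2
  have hlam := hw.lam_pos
  have hsub : A ∩ {ω | (siteRange (traj X ω) s n).card ≤ (freshTimes (traj X ω) s n).card + m ∧
        inner ℝ (latticeVec (traj X ω (s + n) - traj X ω s)) ℓ ≤ √n} ⊆ E1 ∪ E2 := by
    rintro ω ⟨hωA, h1, h2⟩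
    by_cases hω : ((siteRange (traj X ω) s n).card : ℝ) ≤ (n : ℝ) ^ (1 / 2 + a)
    · exact Or.inl ⟨hωA, hω⟩
    · right
      refine ⟨hωA, h2.trans ?_⟩
      push Not at hω
      have h3 : ((siteRange (traj X ω) s n).card : ℝ) ≤ (freshTimes (traj X ω) s n).card + m := by
        exact_mod_cast h1
      have h4 : (n : ℝ) ^ (1 / 2 + a) / 2 ≤ (freshTimes (traj X ω) s n).card := by linarith
      have h5 := mul_le_mul_of_nonneg_left h4 hlam.le
      have h6 : √(n : ℝ) ≤ x := by
        rw [Real.sqrt_eq_rpow]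
        exact Real.rpow_le_rpow_of_exponent_le hn1 (by linarith)
      rw [div_mul_eq_mul_div, div_le_iff₀ hlam] at e4
      linarith
  have hb1 : μ.real E1 ≤ Real.exp (-(n : ℝ) ^ γ') / 2 * μ.real A := by
    refine (e1 s A hA).trans (mul_le_mul_of_nonneg_right ?_ measureReal_nonneg)
    rw [Real.rpow_zero, one_mul] at e2
    linarith
  have hb2 : μ.real E2 ≤ Real.exp (-(n : ℝ) ^ γ') / 2 * μ.real A := by
    obtain ⟨θ, h0, h1, h2⟩ := exists_theta hK hn le_rfl x
    refine (hw.measureReal_height_le_le h0 h1 hA n x).trans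
      (mul_le_mul_of_nonneg_right (h2.trans ?_) measureReal_nonneg)
    have h3 : (n : ℝ) ^ (-(1 / 2) : ℝ) * x = (n : ℝ) ^ (a / 2) := by
      rw [hx, ← Real.rpow_add hn0]; congr 1; ring
    rw [h3]
    rw [Real.rpow_zero] at e3
    linarith
  calc _ ≤ μ.real (E1 ∪ E2) := measureReal_mono hsub (measure_ne_top _ _)
    _ ≤ μ.real E1 + μ.real E2 := measureReal_union_le _ _
    _ ≤ _ := by linarith

end
end ExcitedWalk

namespace ExcitedWalk
noncomputable section

variable {d : ℕ} {Ω : Type*} {mΩ : MeasurableSpace Ω} {μ : Measure Ω} [IsProbabilityMeasure μ]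
  {ℱ : Filtration ℕ mΩ} {ℓ : EuclideanSpace ℝ (Fin d)} {X : ℕ → Ω → Fin d → ℤ} {K lam h r : ℝ}

/-! ### Backtracking -/

theorem measureReal_iUnion_le_tsum {E : ℕ → Set Ω} {b : ℕ → ℝ} (hb : Summable b)
    (h : ∀ j, μ.real (E j) ≤ b j) : μ.real (⋃ j, E j) ≤ ∑' j, b j := by
  have hb0 : ∀ j, 0 ≤ b j := fun j => measureReal_nonneg.trans (h j)
  refine ENNReal.toReal_le_of_le_ofReal (tsum_nonneg hb0) ?_
  rw [ENNReal.ofReal_tsum_of_nonneg hb0 hb]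
  refine (measure_iUnion_le E).trans (ENNReal.tsum_le_tsum fun j => ?_)
  rw [← ofReal_measureReal (measure_ne_top μ (E j))]
  exact ENNReal.ofReal_le_ofReal (h j)

theorem summable_exp_neg_rpow {c γ : ℝ} (hc : 0 < c) (hγ : 0 < γ) :
    Summable fun j : ℕ => Real.exp (-(c * (j : ℝ) ^ γ)) := by
  refine Summable.of_norm_bounded_eventually_nat (g := fun j : ℕ => ((j : ℝ) ^ 2)⁻¹)
    (Real.summable_nat_pow_inv.2 one_lt_two) ?_
  filter_upwards [eventually_mul_rpow_mul_exp_le 1 2 hc (half_pos hγ) (half_lt_self hγ),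
    Filter.eventually_ge_atTop 1] with j h1 hj
  have hj0 : (0 : ℝ) < j := by exact_mod_cast hj
  have h2 : Real.exp (-(j : ℝ) ^ (γ / 2)) ≤ 1 := Real.exp_le_one_iff.2 (by
    have : 0 ≤ (j : ℝ) ^ (γ / 2) := by positivity
    linarith)
  rw [Real.norm_of_nonneg (Real.exp_pos _).le, ← one_div, le_div_iff₀ (by positivity), mul_comm]
  rw [one_mul, Real.rpow_two] at h1
  exact h1.trans h2

/-- The height of a trajectory in direction `ℓ`. -/
def height (ℓ : EuclideanSpace ℝ (Fin d)) (x : ℕ → Fin d → ℤ) (n : ℕ) : ℝ :=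
  inner ℝ (latticeVec (x n)) ℓ

theorem height_sub (ℓ : EuclideanSpace ℝ (Fin d)) (x : ℕ → Fin d → ℤ) (m n : ℕ) :
    inner ℝ (latticeVec (x m - x n)) ℓ = height ℓ x m - height ℓ x n := by
  rw [latticeVec_sub, inner_sub_left]; rfl

theorem height_congr {x y : ℕ → Fin d → ℤ} {n : ℕ} (h : x n = y n) :
    height ℓ x n = height ℓ y n := by rw [height, height, h]

/-- All earlier positions are strictly below the position at time `s`. -/
def IsRecord (ℓ : EuclideanSpace ℝ (Fin d)) (x : ℕ → Fin d → ℤ) (s : ℕ) : Prop :=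
  ∀ k < s, height ℓ x k < height ℓ x s

/-- After time `s` the trajectory stays above its position at time `s`. -/
def NoBacktrack (ℓ : EuclideanSpace ℝ (Fin d)) (x : ℕ → Fin d → ℤ) (s : ℕ) : Prop :=
  ∀ m, height ℓ x s ≤ height ℓ x (s + m)

/-- Time `s + j` is the first one, from time `s` on, at which the trajectory is strictly below its
position at time `t`. -/
def FirstBelow (ℓ : EuclideanSpace ℝ (Fin d)) (x : ℕ → Fin d → ℤ) (t s j : ℕ) : Prop :=
  (∀ i < j, height ℓ x t ≤ height ℓ x (s + i)) ∧ height ℓ x (s + j) < height ℓ x t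

/-- Take the first visit within the window to a site. If it is not fresh, the site was seen before
time `s`, and not before `t`, since all those positions lie strictly below the record. So at most
the `s - t` positions of `[t, s)` fail to give drift. -/
theorem card_siteRange_le_of_isRecord {x : ℕ → Fin d → ℤ} {t s n : ℕ} (hrec : IsRecord ℓ x t)
    (hst : ∀ i < n, height ℓ x t ≤ height ℓ x (s + i)) :
    (siteRange x s n).card ≤ (freshTimes x s n).card + (s - t) := by
  classical
  have hsub : siteRange x s n ⊆
      (freshTimes x s n).image (fun i => x (s + i)) ∪ (Finset.Ico t s).image x := by
    intro v hv
    obtain ⟨i0, hi0, hiv⟩ := Finset.mem_image.1 hv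
    have hex : ∃ i, i < n ∧ x (s + i) = v := ⟨i0, Finset.mem_range.1 hi0, hiv⟩
    obtain ⟨hin, hixv⟩ := Nat.find_spec hex
    set i := Nat.find hex with hi
    rw [Finset.mem_union]
    by_cases hf : IsFresh x (s + i)
    · exact Or.inl (Finset.mem_image.2
        ⟨i, Finset.mem_filter.2 ⟨Finset.mem_range.2 hin, hf⟩, hixv⟩)
    · right
      unfold IsFresh at hf
      push Not at hf
      obtain ⟨k, hk, hkx⟩ := hf
      refine Finset.mem_image.2 ⟨k, Finset.mem_Ico.2 ⟨?_, ?_⟩, hkx.trans hixv⟩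
      · by_contra hkt
        have h1 := hrec k (not_le.1 hkt)
        have h2 := hst i hin
        have h3 : height ℓ x k = height ℓ x (s + i) := by rw [height, height, hkx]
        linarith
      · by_contra hks
        have hks' : s ≤ k := not_lt.1 hks
        have h1 : k - s < i := by omega
        refine Nat.find_min hex h1 ⟨by omega, ?_⟩
        rw [← hixv, ← hkx]; congr 1; omega
  refine (Finset.card_le_card hsub).trans ((Finset.card_union_le _ _).trans ?_)
  refine add_le_add Finset.card_image_le (Finset.card_image_le.trans ?_)
  rw [Nat.card_Ico]

open Filter in
/-- First passages below a record, late in time, are unlikely. -/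
theorem WalkBounds.exists_firstBelow_bound (hd : 2 ≤ d) (hw : WalkBounds μ ℱ ℓ X K lam h r) :
    ∃ a γ : ℝ, 0 < a ∧ a < 1 / 2 ∧ 0 < γ ∧ ∀ᶠ n : ℕ in atTop, ∀ (s t : ℕ) (A : Set Ω),
      MeasurableSet[ℱ s] A → (∀ ω ∈ A, IsRecord ℓ (traj X ω) t) →
      2 * ((s - t : ℕ) : ℝ) ≤ (n : ℝ) ^ (1 / 2 + a) →
      μ.real (A ∩ {ω | FirstBelow ℓ (traj X ω) t s n}) ≤ Real.exp (-(n : ℝ) ^ γ) * μ.real A := by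
  obtain ⟨a, γ, ha0, ha, hγ, hh⟩ := hw.exists_height_bound hd
  refine ⟨a, γ, ha0, ha, hγ, ?_⟩
  filter_upwards [hh, eventually_ge_atTop 1] with n hn hn1 s t A hA hrec hm
  refine (measureReal_mono ?_ (measure_ne_top _ _)).trans (hn s A hA (s - t) hm)
  rintro ω ⟨hωA, h1, h2⟩
  refine ⟨hωA, card_siteRange_le_of_isRecord (hrec ω hωA) h1, ?_⟩
  rw [height_sub]
  -- At relative time 0 the walk is not yet below the record, so undercutting it at time `n` means a
  -- negative displacement.
  have h3 := h1 0 hn1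
  rw [add_zero] at h3
  have := Real.sqrt_nonneg n
  linarith

open Filter in
/-- A walk at a record either backtracks soon or never. -/
theorem WalkBounds.exists_lateBacktrack_bound (hd : 2 ≤ d) (hw : WalkBounds μ ℱ ℓ X K lam h r) :
    ∃ γ : ℝ, 0 < γ ∧ ∀ᶠ n : ℕ in atTop, ∀ (s : ℕ) (A : Set Ω),
      MeasurableSet[ℱ s] A → (∀ ω ∈ A, IsRecord ℓ (traj X ω) s) →
      μ.real (A ∩ {ω | ∃ j > n, FirstBelow ℓ (traj X ω) s s j}) ≤
        Real.exp (-(n : ℝ) ^ γ) * μ.real A := by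
  obtain ⟨a, γ, ha0, ha, hγ, hh⟩ := hw.exists_firstBelow_bound hd
  obtain ⟨N, hN⟩ := eventually_atTop.1 hh
  set S := ∑' j : ℕ, Real.exp (-(1 / 2 * (j : ℝ) ^ γ)) with hS
  have hsum := summable_exp_neg_rpow (by norm_num : (0 : ℝ) < 1 / 2) hγ
  refine ⟨γ / 2, half_pos hγ, ?_⟩
  filter_upwards [eventually_ge_atTop N, eventually_mul_rpow_mul_exp_le S 0
    (by norm_num : (0 : ℝ) < 1 / 2) (half_pos hγ) (half_lt_self hγ)] with n hn hSn s A hA hrec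
  have hsub : A ∩ {ω | ∃ j > n, FirstBelow ℓ (traj X ω) s s j} ⊆
      ⋃ j, A ∩ {ω | n < j ∧ FirstBelow ℓ (traj X ω) s s j} := by
    rintro ω ⟨hωA, j, hj, hb⟩
    exact Set.mem_iUnion.2 ⟨j, hωA, hj, hb⟩
  -- For `j > n` the exponent is split in two: one half is summable in `j`, the other gives the
  -- decay in `n`.
  set b : ℕ → ℝ := fun j => Real.exp (-(1 / 2 * (j : ℝ) ^ γ)) *
    (Real.exp (-(1 / 2 * (n : ℝ) ^ γ)) * μ.real A) with hb
  have hle : ∀ j, μ.real (A ∩ {ω | n < j ∧ FirstBelow ℓ (traj X ω) s s j}) ≤ b j := by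
    intro j
    by_cases hj : n < j
    · refine (measureReal_mono (Set.inter_subset_inter_right A fun ω h => h.2)
        (measure_ne_top _ _)).trans ?_
      refine (hN j (by omega) s s A hA hrec ?_).trans ?_
      · rw [Nat.sub_self, Nat.cast_zero, mul_zero]; positivity
      · simp only [hb]
        rw [← mul_assoc, ← Real.exp_add]
        refine mul_le_mul_of_nonneg_right (Real.exp_le_exp.2 ?_) measureReal_nonneg
        have : (n : ℝ) ^ γ ≤ (j : ℝ) ^ γ :=
          Real.rpow_le_rpow (by positivity) (by exact_mod_cast hj.le) hγ.le
        linarith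
    · have : A ∩ {ω | n < j ∧ FirstBelow ℓ (traj X ω) s s j} = ∅ := by
        ext ω; simp [hj]
      rw [this, measureReal_empty]
      exact mul_nonneg (Real.exp_pos _).le (mul_nonneg (Real.exp_pos _).le measureReal_nonneg)
  calc _ ≤ μ.real (⋃ j, A ∩ {ω | n < j ∧ FirstBelow ℓ (traj X ω) s s j}) :=
        measureReal_mono hsub (measure_ne_top _ _)
    _ ≤ ∑' j, b j := measureReal_iUnion_le_tsum (hsum.mul_right _) hle
    _ = S * Real.exp (-(1 / 2 * (n : ℝ) ^ γ)) * μ.real A := by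
        rw [hb, tsum_mul_right, ← hS]; ring
    _ ≤ _ := by
        refine mul_le_mul_of_nonneg_right ?_ measureReal_nonneg
        rwa [Real.rpow_zero, mul_one] at hSn

/-- The first `m` steps from time `t` on all go up by more than `r`. -/
def StepsUp (ℓ : EuclideanSpace ℝ (Fin d)) (r : ℝ) (x : ℕ → Fin d → ℤ) (t m : ℕ) : Prop :=
  ∀ i < m, r < height ℓ x (t + i + 1) - height ℓ x (t + i)

theorem StepsUp.height_ge {x : ℕ → Fin d → ℤ} {t m : ℕ} (hx : StepsUp ℓ r x t m) {i : ℕ}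
    (hi : i ≤ m) : height ℓ x t + r * i ≤ height ℓ x (t + i) := by
  induction i with
  | zero => simp
  | succ i ih =>
    have h1 := ih (by omega)
    have h2 := hx i (by omega)
    rw [← add_assoc]
    push_cast
    linarith

theorem measurableSet_inter_stepsUp (hX : Adapted ℱ X) {t : ℕ} {A : Set Ω}
    (hA : MeasurableSet[ℱ t] A) (r : ℝ) (m : ℕ) :
    MeasurableSet[ℱ (t + m)] (A ∩ {ω | StepsUp ℓ r (traj X ω) t m}) := by
  refine (ℱ.mono (Nat.le_add_right t m) _ hA).inter
    (measurableSet_of_path hX (t + m) (P := fun x => StepsUp ℓ r x t m) fun x y h => ?_)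
  refine forall₂_congr fun i hi => ?_
  rw [height_congr (h (t + i + 1) (by omega)), height_congr (h (t + i) (by omega))]

/-- Ellipticity in direction `ℓ` holds at every site, fresh or not, and contributes a factor `h` per
step. -/
theorem WalkBounds.measureReal_stepsUp_ge (hw : WalkBounds μ ℱ ℓ X K lam h r) {t : ℕ} {A : Set Ω}
    (hA : MeasurableSet[ℱ t] A) (m : ℕ) :
    h ^ m * μ.real A ≤ μ.real (A ∩ {ω | StepsUp ℓ r (traj X ω) t m}) := by
  induction m with
  | zero => simp [StepsUp]
  | succ m ih =>
    set B := A ∩ {ω | StepsUp ℓ r (traj X ω) t m} with hB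
    have hBm := measurableSet_inter_stepsUp (ℓ := ℓ) hw.adapted hA r m
    set S := {ω' | r < inner ℝ (jump X (t + m) ω') ℓ} with hS
    have hjm : Measurable (jump X (t + m)) :=
      (measurable_jump hw.adapted (t + m)).mono (ℱ.le _) le_rfl
    have hSm : MeasurableSet S := measurableSet_lt measurable_const hjm.inner_const
    have hsub : B ∩ S ⊆ A ∩ {ω | StepsUp ℓ r (traj X ω) t (m + 1)} := by
      rintro ω ⟨⟨h1, h2⟩, h3⟩
      refine ⟨h1, fun i hi => ?_⟩
      rcases Nat.lt_succ_iff_lt_or_eq.1 hi with h4 | rfl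
      · exact h2 i h4
      · rw [← height_sub]; exact h3
    have h1 : ∫ ω in B, (μ⟦S | ℱ (t + m)⟧) ω ∂μ = μ.real (B ∩ S) := by
      rw [setIntegral_condExp (ℱ.le _) ((integrable_const _).indicator hSm) hBm,
        setIntegral_indicator hSm, setIntegral_const, smul_eq_mul, mul_one]
    have h2 : h * μ.real B ≤ ∫ ω in B, (μ⟦S | ℱ (t + m)⟧) ω ∂μ := by
      calc h * μ.real B = ∫ ω in B, h ∂μ := by rw [setIntegral_const, smul_eq_mul, mul_comm]
        _ ≤ _ := by
          refine setIntegral_mono_ae (integrable_const _).integrableOn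
            integrable_condExp.integrableOn ?_
          exact hw.elliptic (t + m)
    calc h ^ (m + 1) * μ.real A = h * (h ^ m * μ.real A) := by ring
      _ ≤ h * μ.real B := mul_le_mul_of_nonneg_left ih hw.h_pos.le
      _ ≤ μ.real (B ∩ S) := h2.trans h1.le
      _ ≤ _ := measureReal_mono hsub (measure_ne_top _ _)

open Filter Topology in
/-- A walk at a record never backtracks with probability bounded below. -/
theorem WalkBounds.exists_noBacktrack_bound (hd : 2 ≤ d) (hw : WalkBounds μ ℱ ℓ X K lam h r) :
    ∃ p : ℝ, 0 < p ∧ ∀ (t : ℕ) (A : Set Ω),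
      MeasurableSet[ℱ t] A → (∀ ω ∈ A, IsRecord ℓ (traj X ω) t) →
      p * μ.real A ≤ μ.real (A ∩ {ω | NoBacktrack ℓ (traj X ω) t}) := by
  obtain ⟨a, γ, ha0, ha, hγ, hh⟩ := hw.exists_firstBelow_bound hd
  obtain ⟨N, hN⟩ := eventually_atTop.1 hh
  have hK := hw.one_le_K
  have hK0 : 0 < K := by linarith
  have hr := hw.r_pos
  set f : ℕ → ℝ := fun j => Real.exp (-(1 * (j : ℝ) ^ γ)) with hf
  have hsum : Summable f := summable_exp_neg_rpow one_pos hγ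
  have htail : Tendsto (fun J => ∑' k, f (k + J)) atTop (𝓝 0) := tendsto_sum_nat_add f
  have hexp0 : Tendsto (fun J : ℕ => Real.exp (-(J : ℝ) ^ (a / 2))) atTop (𝓝 0) :=
    Real.tendsto_exp_neg_atTop_nhds_zero.comp
      ((tendsto_rpow_atTop (half_pos ha0)).comp tendsto_natCast_atTop_atTop)
  obtain ⟨J, hJ1, hJN, hJtail, hJexp, hJsmall, hJM⟩ := ((eventually_ge_atTop 1).and
    ((eventually_ge_atTop N).and ((htail.eventually (gt_mem_nhds (by norm_num : (0 : ℝ) < 1 / 4))).and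
    ((hexp0.eventually (gt_mem_nhds (by norm_num : (0 : ℝ) < 1 / 4))).and
    ((eventually_mul_rpow_mul_exp_le 3 1 (by positivity : 0 < K⁻¹ * (r / 4)) (half_pos ha0)
      (half_lt_self ha0)).and
    (eventually_mul_rpow_le 4 (by linarith : 0 < 1 / 2 + a))))))).exists
  have hJ0 : (0 : ℝ) < J := by exact_mod_cast hJ1
  -- The forced climb has the largest length for which its `M` sites may be disregarded in the range
  -- after `J` steps. It is also long enough that the height `r * M` dominates the fluctuations of
  -- the following `J` steps.
  set M := ⌊(J : ℝ) ^ (1 / 2 + a) / 2⌋₊ with hM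
  have hMle : (M : ℝ) ≤ (J : ℝ) ^ (1 / 2 + a) / 2 := Nat.floor_le (by positivity)
  have hMge : (J : ℝ) ^ (1 / 2 + a) / 4 ≤ M := by
    have h1 := Nat.lt_floor_add_one ((J : ℝ) ^ (1 / 2 + a) / 2)
    rw [Real.rpow_zero] at hJM
    rw [← hM] at h1
    linarith
  refine ⟨h ^ M / 2, by have := hw.h_pos; positivity, fun t A hA hrec => ?_⟩
  set A' := A ∩ {ω | StepsUp ℓ r (traj X ω) t M} with hA'
  have hA'm := measurableSet_inter_stepsUp (ℓ := ℓ) hw.adapted hA r M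
  have hA'ge := hw.measureReal_stepsUp_ge hA M
  rw [← hA'] at hA'ge hA'm
  set E : ℕ → Set Ω := fun j => A' ∩ {ω | FirstBelow ℓ (traj X ω) t (t + M) j} with hE
  -- Undercuts at least `J` steps after the climb are excluded by the drift at new sites.
  have hlate : ∀ k, μ.real (E (k + J)) ≤ f (k + J) * μ.real A' := by
    intro k
    have := hN (k + J) (by omega) (t + M) t A' hA'm (fun ω hω => hrec ω hω.1) (by
      rw [Nat.add_sub_cancel_left]
      have : (J : ℝ) ^ (1 / 2 + a) ≤ ((k + J : ℕ) : ℝ) ^ (1 / 2 + a) :=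
        Real.rpow_le_rpow hJ0.le (by exact_mod_cast Nat.le_add_left J k) (by linarith)
      linarith)
    simpa only [hf, one_mul] using this
  -- Undercuts within `J` steps would need a fall by `r * M` against a nonnegative drift.
  have hearly : ∀ j ∈ Finset.range J,
      μ.real (E j) ≤ 3 * Real.exp (-(K⁻¹ * (r / 4) * (J : ℝ) ^ a)) * μ.real A' := by
    intro j hj
    obtain ⟨θ, h0, h1, h2⟩ := exists_theta hK hJ1 (Finset.mem_range.1 hj).le (r * M)
    have hsub : E j ⊆ A' ∩ {ω |
        inner ℝ (latticeVec (traj X ω (t + M + j) - traj X ω (t + M))) ℓ ≤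
          lam * (freshTimes (traj X ω) (t + M) j).card - r * M} := by
      rintro ω ⟨hω, hb⟩
      refine ⟨hω, ?_⟩
      simp only [Set.mem_ofPred_eq]
      rw [height_sub]
      have h3 := StepsUp.height_ge hω.2 le_rfl
      have h4 := hb.2
      have h5 := hw.lam_pos
      have h6 : 0 ≤ lam * ((freshTimes (traj X ω) (t + M) j).card : ℝ) := by positivity
      linarith
    refine (measureReal_mono hsub (measure_ne_top _ _)).trans
      ((hw.measureReal_height_le_le h0 h1 hA'm j (r * M)).trans
        (mul_le_mul_of_nonneg_right (h2.trans ?_) measureReal_nonneg))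
    refine mul_le_mul_of_nonneg_left (Real.exp_le_exp.2 (neg_le_neg ?_)) (by norm_num)
    rw [mul_assoc]
    refine mul_le_mul_of_nonneg_left ?_ (inv_pos.2 hK0).le
    have h3 : (J : ℝ) ^ a = (J : ℝ) ^ (-(1 / 2) : ℝ) * (J : ℝ) ^ (1 / 2 + a) := by
      rw [← Real.rpow_add hJ0]; congr 1; ring
    have h4 : 0 < (J : ℝ) ^ (-(1 / 2) : ℝ) := by positivity
    rw [h3]
    have h5 := mul_le_mul_of_nonneg_left hMge (mul_pos h4 hr).le
    linarith
  have hbad : A' \ {ω | NoBacktrack ℓ (traj X ω) t} ⊆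
      (⋃ j ∈ Finset.range J, E j) ∪ ⋃ k, E (k + J) := by
    rintro ω ⟨hω, hnb⟩
    simp only [Set.mem_ofPred_eq, NoBacktrack, not_forall, not_le] at hnb
    obtain ⟨m, hm⟩ := hnb
    have hMm : M < m := by
      by_contra hcon
      have := StepsUp.height_ge hω.2 (not_lt.1 hcon)
      have h1 : 0 ≤ r * (m : ℝ) := by positivity
      linarith
    have hex : ∃ j, height ℓ (traj X ω) (t + M + j) < height ℓ (traj X ω) t :=
      ⟨m - M, by rwa [show t + M + (m - M) = t + m by omega]⟩
    classical
    have hfb : FirstBelow ℓ (traj X ω) t (t + M) (Nat.find hex) :=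
      ⟨fun i hi => not_lt.1 (Nat.find_min hex hi), Nat.find_spec hex⟩
    by_cases hj : Nat.find hex < J
    · left
      simp only [Set.mem_iUnion]
      exact ⟨_, Finset.mem_range.2 hj, hω, hfb⟩
    · right
      refine Set.mem_iUnion.2 ⟨Nat.find hex - J, hω, ?_⟩
      rw [Nat.sub_add_cancel (not_lt.1 hj)]
      exact hfb
  have hb1 : μ.real (⋃ j ∈ Finset.range J, E j) ≤ 1 / 4 * μ.real A' := by
    calc _ ≤ ∑ j ∈ Finset.range J, μ.real (E j) := measureReal_biUnion_finset_le _ _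
      _ ≤ ∑ j ∈ Finset.range J, 3 * Real.exp (-(K⁻¹ * (r / 4) * (J : ℝ) ^ a)) * μ.real A' :=
          Finset.sum_le_sum hearly
      _ = 3 * (J : ℝ) ^ (1 : ℝ) * Real.exp (-(K⁻¹ * (r / 4) * (J : ℝ) ^ a)) * μ.real A' := by
          rw [Finset.sum_const, Finset.card_range, nsmul_eq_mul, Real.rpow_one]; ring
      _ ≤ _ := mul_le_mul_of_nonneg_right (hJsmall.trans hJexp.le) measureReal_nonneg
  have hb2 : μ.real (⋃ k, E (k + J)) ≤ 1 / 4 * μ.real A' := by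
    refine (measureReal_iUnion_le_tsum
      (((summable_nat_add_iff J).2 hsum).mul_right _) hlate).trans ?_
    rw [tsum_mul_right]
    exact mul_le_mul_of_nonneg_right hJtail.le measureReal_nonneg
  have hb3 : μ.real (A' \ {ω | NoBacktrack ℓ (traj X ω) t}) ≤ 1 / 2 * μ.real A' := by
    refine (measureReal_mono hbad (measure_ne_top _ _)).trans
      ((measureReal_union_le _ _).trans ?_)
    linarith
  have hb4 : μ.real A' ≤ μ.real (A' ∩ {ω | NoBacktrack ℓ (traj X ω) t}) +
      μ.real (A' \ {ω | NoBacktrack ℓ (traj X ω) t}) := by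
    refine le_trans (measureReal_mono ?_ (measure_ne_top _ _)) (measureReal_union_le _ _)
    rw [Set.inter_union_sdiff]
  have hb5 : μ.real (A' ∩ {ω | NoBacktrack ℓ (traj X ω) t}) ≤
      μ.real (A ∩ {ω | NoBacktrack ℓ (traj X ω) t}) :=
    measureReal_mono (Set.inter_subset_inter_left _ Set.inter_subset_left) (measure_ne_top _ _)
  linarith

end
end ExcitedWalk

namespace ExcitedWalk
noncomputable section

/-! ### Regeneration times of a path -/

section Path

/-- The common form of `hitTime`, `backtrackTime` and `successIndex`; with it their finite values
become statements about natural numbers. -/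
theorem sInf_coe_eq_coe {P : ℕ → Prop} {n : ℕ} :
    sInf {t : ℕ∞ | ∃ k : ℕ, t = k ∧ P k} = n ↔ P n ∧ ∀ k < n, ¬ P k := by
  constructor
  · intro h
    have hne : {t : ℕ∞ | ∃ k : ℕ, t = k ∧ P k}.Nonempty := by
      by_contra hcon
      rw [Set.not_nonempty_iff_eq_empty.1 hcon, sInf_empty] at h
      exact ENat.top_ne_natCast n h
    obtain ⟨k, hk, hPk⟩ := csInf_mem hne
    rw [h] at hk
    have hkn : n = k := by exact_mod_cast hk
    refine ⟨hkn ▸ hPk, fun j hj hPj => ?_⟩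
    have h1 : sInf {t : ℕ∞ | ∃ k : ℕ, t = k ∧ P k} ≤ j := sInf_le ⟨j, rfl, hPj⟩
    rw [h] at h1
    have : n ≤ j := by exact_mod_cast h1
    omega
  · rintro ⟨hn, hmin⟩
    refine le_antisymm (sInf_le ⟨n, rfl, hn⟩) (le_sInf ?_)
    rintro t ⟨k, rfl, hk⟩
    have : n ≤ k := not_lt.1 fun h => hmin k h hk
    exact_mod_cast this

theorem sInf_coe_eq_top {P : ℕ → Prop} :
    sInf {t : ℕ∞ | ∃ k : ℕ, t = k ∧ P k} = ⊤ ↔ ∀ k, ¬ P k := by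
  constructor
  · intro h k hk
    have h1 : sInf {t : ℕ∞ | ∃ k : ℕ, t = k ∧ P k} ≤ k := sInf_le ⟨k, rfl, hk⟩
    rw [h, top_le_iff] at h1
    exact ENat.natCast_ne_top k h1
  · intro h
    rw [sInf_eq_top]
    rintro t ⟨k, -, hk⟩
    exact absurd hk (h k)

variable {p q : ℕ → ℝ}

theorem runningSup_add_one_le (p : ℕ → ℝ) (t : ℕ∞) (n : ℕ) :
    runningSup p t + 1 ≤ (p n : EReal) ↔ ∀ i : ℕ, (i : ℕ∞) ≤ t → p i + 1 ≤ p n := by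
  constructor
  · intro h i hi
    have h1 : (p i : EReal) ≤ runningSup p t := le_iSup₂_of_le i hi le_rfl
    have h2 : (p i : EReal) + 1 ≤ p n := (add_le_add_left h1 1).trans h
    exact_mod_cast h2
  · intro h
    have h1 : runningSup p t ≤ ((p n - 1 : ℝ) : EReal) :=
      iSup₂_le fun i hi => EReal.coe_le_coe_iff.2 (by linarith [h i hi])
    refine (add_le_add_left h1 1).trans (le_of_eq ?_)
    have : ((p n - 1 : ℝ) : EReal) + ((1 : ℝ) : EReal) = p n := by
      rw [← EReal.coe_add, sub_add_cancel]
    exact_mod_cast this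

theorem attempt_succ_fst_eq {k n : ℕ} : (attempt p (k + 1)).1 = n ↔
    (1 ≤ n ∧ ∀ i : ℕ, (i : ℕ∞) ≤ (attempt p k).2 → p i + 1 ≤ p n) ∧
      ∀ m < n, ¬ (1 ≤ m ∧ ∀ i : ℕ, (i : ℕ∞) ≤ (attempt p k).2 → p i + 1 ≤ p m) := by
  simp only [← runningSup_add_one_le]
  exact sInf_coe_eq_coe

theorem attempt_succ_fst_eq_top {k : ℕ} : (attempt p (k + 1)).1 = ⊤ ↔
    ∀ n, ¬ (1 ≤ n ∧ ∀ i : ℕ, (i : ℕ∞) ≤ (attempt p k).2 → p i + 1 ≤ p n) := by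
  simp only [← runningSup_add_one_le]
  exact sInf_coe_eq_top

theorem attempt_succ_snd (p : ℕ → ℝ) (k : ℕ) : (attempt p (k + 1)).2 =
    backtrackTime (shift (attempt p (k + 1)).1.toNat p) + (attempt p (k + 1)).1 := rfl

/-- The path never goes below its position at time `n` afterwards. -/
def StaysAbove (p : ℕ → ℝ) (n : ℕ) : Prop := ∀ m, p n ≤ p (n + m)

theorem attempt_succ_snd_eq_top {k n : ℕ} (h : (attempt p (k + 1)).1 = n) :
    (attempt p (k + 1)).2 = ⊤ ↔ StaysAbove p n := by
  rw [attempt_succ_snd, h, ENat.add_eq_top, or_iff_left (ENat.natCast_ne_top n), ENat.toNat_natCast]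
  refine sInf_coe_eq_top.trans (forall_congr' fun m => ?_)
  simp [shift]

theorem attempt_succ_snd_eq_add {k n j : ℕ} (h : (attempt p (k + 1)).1 = n) :
    (attempt p (k + 1)).2 = (n + j : ℕ) ↔ p (n + j) < p n ∧ ∀ i < j, p n ≤ p (n + i) := by
  have h1 : (attempt p (k + 1)).2 = (n + j : ℕ) ↔ backtrackTime (shift n p) = j := by
    rw [attempt_succ_snd, h, ENat.toNat_natCast, Nat.add_comm n j, Nat.cast_add]
    exact (ENat.add_left_injective_of_ne_top (ENat.natCast_ne_top n)).eq_iff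
  rw [h1]
  refine sInf_coe_eq_coe.trans ?_
  simp [shift]

/-- Otherwise the maximum defining the new level would include time `n` itself, which would have to
exceed its own height by one. -/
theorem snd_lt_of_fst_eq {k n : ℕ} (h : (attempt p (k + 1)).1 = n) : (attempt p k).2 < n := by
  by_contra hcon
  have := (attempt_succ_fst_eq.1 h).1.2 n (not_lt.1 hcon)
  linarith

theorem fst_le_snd (p : ℕ → ℝ) (k : ℕ) : (attempt p k).1 ≤ (attempt p k).2 := by
  cases k with
  | zero => exact le_rfl
  | succ k => rw [attempt_succ_snd]; exact le_add_self

/-- After a success the running supremum is taken over the whole path, and no point exceeds it by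
one. Hence there is at most one success. -/
theorem attempt_eq_top_of_lt {k j : ℕ} (h : (attempt p k).2 = ⊤) (hkj : k < j) :
    (attempt p j).1 = ⊤ ∧ (attempt p j).2 = ⊤ := by
  have step : ∀ i, (attempt p i).2 = ⊤ →
      (attempt p (i + 1)).1 = ⊤ ∧ (attempt p (i + 1)).2 = ⊤ := by
    intro i hi
    have h1 : (attempt p (i + 1)).1 = ⊤ := by
      rw [attempt_succ_fst_eq_top, hi]
      rintro n ⟨-, hn⟩
      linarith [hn n le_top]
    refine ⟨h1, ?_⟩
    have := fst_le_snd p (i + 1)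
    rwa [h1, top_le_iff] at this
  induction j with
  | zero => omega
  | succ j ih =>
    rcases Nat.lt_succ_iff_lt_or_eq.1 hkj with h1 | rfl
    · exact step j (ih h1).2
    · exact step k h

/-- Time `n` is one of the times `S_k`, `k ≥ 1`. -/
def IsCandidate (p : ℕ → ℝ) (n : ℕ) : Prop := ∃ k, (attempt p (k + 1)).1 = n

theorem fst_add_one_le {k n : ℕ} (h : (attempt p (k + 1)).1 = n) : p 0 + 1 ≤ p n :=
  (attempt_succ_fst_eq.1 h).1.2 0 (by simp)

/-- Candidates are strict records: points up to `D_k` lie at least one below, and a later point `i`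
missed the level, which the path attains at time `n`. -/
theorem lt_of_fst_eq {k n i : ℕ} (h : (attempt p (k + 1)).1 = n) (hi : i < n) : p i < p n := by
  obtain ⟨⟨-, h1⟩, h2⟩ := attempt_succ_fst_eq.1 h
  by_cases hD : (i : ℕ∞) ≤ (attempt p k).2
  · linarith [h1 i hD]
  · have hi1 : 1 ≤ i := by
      by_contra hcon
      have : i = 0 := by omega
      subst this
      exact hD (by simp)
    have h3 := h2 i hi
    push Not at h3
    obtain ⟨i0, hi0, hlt⟩ := h3 hi1
    linarith [h1 i0 hi0]

theorem IsCandidate.lt {n i : ℕ} (h : IsCandidate p n) (hi : i < n) : p i < p n := by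
  obtain ⟨k, hk⟩ := h
  exact lt_of_fst_eq hk hi

/-- The stopping time property. A finite `S_{k+1}` is preceded by a finite `D_k`, and both are
decided by the path up to their own value. -/
theorem attempt_congr {T : ℕ} (hpq : ∀ i ≤ T, p i = q i) (k : ℕ) :
    (∀ n ≤ T, (attempt p k).1 = n → (attempt q k).1 = n) ∧
      ∀ e ≤ T, (attempt p k).2 = e → (attempt q k).2 = e := by
  induction k with
  | zero => exact ⟨fun n _ h => h, fun n _ h => h⟩
  | succ k ih =>
    have hS : ∀ n ≤ T, (attempt p (k + 1)).1 = n → (attempt q (k + 1)).1 = n := by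
      intro n hn h
      have hD := snd_lt_of_fst_eq h
      obtain ⟨e, he⟩ := ENat.ne_top_iff_exists.1 (ne_top_of_lt hD)
      rw [← he] at hD
      have hen : e < n := by exact_mod_cast hD
      have heq := ih.2 e (by omega) he.symm
      rw [attempt_succ_fst_eq, ← he] at h
      rw [attempt_succ_fst_eq, heq]
      obtain ⟨⟨h1, h2⟩, h3⟩ := h
      refine ⟨⟨h1, fun i hi => ?_⟩, fun m hm hcon => h3 m hm ⟨hcon.1, fun i hi => ?_⟩⟩
      · have hie : i ≤ e := by exact_mod_cast hi
        rw [← hpq i (by omega), ← hpq n hn]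
        exact h2 i hi
      · have hie : i ≤ e := by exact_mod_cast hi
        rw [hpq i (by omega), hpq m (by omega)]
        exact hcon.2 i hi
    refine ⟨hS, fun e he h => ?_⟩
    have hfin : (attempt p (k + 1)).1 ≠ ⊤ := by
      intro htop
      have := fst_le_snd p (k + 1)
      rw [htop, h, top_le_iff] at this
      exact ENat.natCast_ne_top e this
    obtain ⟨n, hn⟩ := ENat.ne_top_iff_exists.1 hfin
    have hne : n ≤ e := by
      have := fst_le_snd p (k + 1)
      rw [← hn, h] at this
      exact_mod_cast this
    obtain ⟨j, rfl⟩ := Nat.exists_eq_add_of_le hne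
    have h1 := (attempt_succ_snd_eq_add hn.symm).1 h
    refine (attempt_succ_snd_eq_add (hS n (by omega) hn.symm)).2 ⟨?_, fun i hi => ?_⟩
    · rw [← hpq _ he, ← hpq n (by omega)]; exact h1.1
    · rw [← hpq n (by omega), ← hpq (n + i) (by omega)]; exact h1.2 i hi

theorem fst_eq_congr {T n : ℕ} (hpq : ∀ i ≤ T, p i = q i) (hn : n ≤ T) (k : ℕ) :
    (attempt p k).1 = n ↔ (attempt q k).1 = n :=
  ⟨(attempt_congr hpq k).1 n hn, (attempt_congr (fun i hi => (hpq i hi).symm) k).1 n hn⟩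

theorem isCandidate_congr {n : ℕ} (hpq : ∀ i ≤ n, p i = q i) :
    IsCandidate p n ↔ IsCandidate q n :=
  exists_congr fun _ => fst_eq_congr hpq le_rfl _

/-- By `attempt_eq_top_of_lt` a success can have no earlier one, so the index `κ` disappears. Index
0 is never a success as `D_0 = 0`; hence only the `S_k` with `k ≥ 1` are candidates. -/
theorem firstRegeneration_eq_coe {n : ℕ} :
    firstRegeneration p = n ↔ IsCandidate p n ∧ StaysAbove p n := by
  constructor
  · intro h
    unfold firstRegeneration at h
    split_ifs at h with hs
    · exact absurd h (ENat.top_ne_natCast n)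
    · obtain ⟨κ, hκ⟩ := ENat.ne_top_iff_exists.1 hs
      obtain ⟨⟨-, hD⟩, -⟩ := sInf_coe_eq_coe.1 hκ.symm
      rw [← hκ, ENat.toNat_natCast] at h
      cases κ with
      | zero => exact absurd hD (by simp [attempt])
      | succ k => exact ⟨⟨k, h⟩, (attempt_succ_snd_eq_top h).1 hD⟩
  · rintro ⟨⟨k, hk⟩, hn⟩
    have hκ : successIndex p = (k + 1 : ℕ) := by
      refine sInf_coe_eq_coe.2 ⟨⟨?_, (attempt_succ_snd_eq_top hk).2 hn⟩, fun j hj hcon => ?_⟩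
      · rw [hk]; exact ENat.natCast_lt_top n
      · have := (attempt_eq_top_of_lt hcon.2 hj).1
        rw [hk] at this
        exact ENat.natCast_ne_top n this
    unfold firstRegeneration
    rw [hκ, if_neg (ENat.natCast_ne_top _), ENat.toNat_natCast, hk]

/-- If the path climbs high enough by time `m` and failed attempts are short, then either there is
a regeneration by time `m` or the first `N` attempts fail. -/
theorem exists_regeneration_le {K : ℝ} (hK : 0 ≤ K) (hp : ∀ i, |p (i + 1) - p i| ≤ K)
    {N L m : ℕ} (hm : p 0 + N * (K * L + K + 1) + 1 ≤ p m)
    (hshort : ∀ k < N, ∀ n j : ℕ, (attempt p (k + 1)).1 = n → p (n + j) < p n →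
      (∀ i < j, p n ≤ p (n + i)) → j ≤ L) :
    firstRegeneration p ≤ m ∨ (attempt p N).2 < ⊤ := by
  have hstep : ∀ n i, p (n + i) ≤ p n + K * i := by
    intro n i
    induction i with
    | zero => simp
    | succ i ih =>
      have := (abs_le.1 (hp (n + i))).2
      rw [← add_assoc]
      push_cast
      linarith
  -- The rise of the running maximum in one failed attempt: 1 for the new level, `K` for the
  -- overshoot, `K * L` during the attempt.
  set B := K * L + K + 1 with hB
  have hB0 : 0 ≤ B := by positivity
  have key : ∀ k ≤ N, firstRegeneration p ≤ m ∨
      ∃ e : ℕ, (attempt p k).2 = e ∧ ∀ i ≤ e, p i ≤ p 0 + k * B := by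
    intro k
    induction k with
    | zero => exact fun _ => Or.inr ⟨0, rfl, fun i hi => by simp [Nat.le_zero.1 hi]⟩
    | succ k ih =>
      intro hk
      rcases ih (by omega) with h | ⟨e, he, hbound⟩
      · exact Or.inl h
      have hkN : (k : ℝ) * B ≤ N * B :=
        mul_le_mul_of_nonneg_right (by exact_mod_cast (by omega : k ≤ N)) hB0
      have hhit : 1 ≤ m ∧ ∀ i : ℕ, (i : ℕ∞) ≤ (attempt p k).2 → p i + 1 ≤ p m := by
        refine ⟨?_, fun i hi => ?_⟩
        · by_contra hcon
          have h0 : m = 0 := by omega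
          rw [h0] at hm
          have : (0 : ℝ) ≤ N * B := by positivity
          linarith
        · rw [he] at hi
          have := hbound i (by exact_mod_cast hi)
          linarith
      have hfin : (attempt p (k + 1)).1 ≠ ⊤ := fun h => attempt_succ_fst_eq_top.1 h m hhit
      obtain ⟨n, hn⟩ := ENat.ne_top_iff_exists.1 hfin
      obtain ⟨⟨hn1, hnh⟩, hmin⟩ := attempt_succ_fst_eq.1 hn.symm
      have hnm : n ≤ m := not_lt.1 fun h => hmin m h hhit
      by_cases hsa : StaysAbove p n
      · left
        rw [firstRegeneration_eq_coe.2 ⟨⟨k, hn.symm⟩, hsa⟩]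
        exact_mod_cast hnm
      · right
        classical
        have hex : ∃ j, p (n + j) < p n := by
          unfold StaysAbove at hsa
          push Not at hsa
          exact hsa
        set j := Nat.find hex with hj
        have hj1 : p (n + j) < p n := Nat.find_spec hex
        have hj2 : ∀ i < j, p n ≤ p (n + i) := fun i hi => not_lt.1 (Nat.find_min hex hi)
        have hjL := hshort k (by omega) n j hn.symm hj1 hj2
        refine ⟨n + j, (attempt_succ_snd_eq_add hn.symm).2 ⟨hj1, hj2⟩, fun i hi => ?_⟩
        -- One step before the candidate time the new level was not yet reached, which bounds the
        -- overshoot by a single jump.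
        have hprev : p (n - 1) ≤ p 0 + k * B + 1 := by
          by_cases h1 : n - 1 ≤ e
          · linarith [hbound _ h1]
          · have h2 := hmin (n - 1) (by omega)
            push Not at h2
            obtain ⟨i0, hi0, hlt⟩ := h2 (by omega)
            rw [he] at hi0
            linarith [hbound i0 (by exact_mod_cast hi0)]
        have hpn : p n ≤ p 0 + k * B + 1 + K := by
          have := (abs_le.1 (hp (n - 1))).2
          rw [Nat.sub_add_cancel hn1] at this
          linarith
        have hpi : p i ≤ p n + K * L := by
          rcases lt_or_ge i n with h1 | h1
          · have h2 := lt_of_fst_eq hn.symm h1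
            have : 0 ≤ K * L := by positivity
            linarith
          · obtain ⟨l, rfl⟩ := Nat.exists_eq_add_of_le h1
            have hl : (l : ℝ) ≤ L := by exact_mod_cast (by omega : l ≤ L)
            have := mul_le_mul_of_nonneg_left hl hK
            linarith [hstep n l]
        push_cast
        linarith
  rcases key N le_rfl with h | ⟨e, he, -⟩
  · exact Or.inl h
  · right; rw [he]; exact ENat.natCast_lt_top e

end Path

end
end ExcitedWalk

namespace ExcitedWalk
noncomputable section

variable {d : ℕ} {Ω : Type*} {mΩ : MeasurableSpace Ω} {μ : Measure Ω} [IsProbabilityMeasure μ]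
  {ℱ : Filtration ℕ mΩ} {ℓ : EuclideanSpace ℝ (Fin d)} {X : ℕ → Ω → Fin d → ℤ} {K lam h r : ℝ}

/-! ### The tail of the first regeneration time -/

/-- A bound relative to each member of a countable partition holds for the union. -/
theorem measureReal_iUnion_le_mul {ι : Type*} [Countable ι] {B E : ι → Set Ω} {c : ℝ}
    (hc : 0 ≤ c) (hB : ∀ i, MeasurableSet (B i)) (hdis : Pairwise (Function.onFun Disjoint B))
    (h : ∀ i, μ.real (E i) ≤ c * μ.real (B i)) :
    μ.real (⋃ i, E i) ≤ c * μ.real (⋃ i, B i) := by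
  refine ENNReal.toReal_le_of_le_ofReal (mul_nonneg hc measureReal_nonneg) ?_
  rw [ENNReal.ofReal_mul hc, ofReal_measureReal (measure_ne_top _ _), measure_iUnion hdis hB,
    ← ENNReal.tsum_mul_left]
  refine (measure_iUnion_le E).trans (ENNReal.tsum_le_tsum fun i => ?_)
  rw [← ofReal_measureReal (measure_ne_top μ (E i)), ← ofReal_measureReal (measure_ne_top μ (B i)),
    ← ENNReal.ofReal_mul hc]
  exact ENNReal.ofReal_le_ofReal (h i)

theorem staysAbove_shift {x : ℕ → Fin d → ℤ} {s n : ℕ} :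
    StaysAbove (shift s (height ℓ x)) n ↔ NoBacktrack ℓ x (s + n) := by
  simp only [StaysAbove, NoBacktrack, shift, add_assoc]

theorem measurableSet_noBacktrack (hX : Adapted ℱ X) (n : ℕ) :
    MeasurableSet {ω | NoBacktrack ℓ (traj X ω) n} := by
  have hheight : ∀ m, Measurable fun ω => height ℓ (traj X ω) m := fun m =>
    (measurable_of_countable fun v : Fin d → ℤ => inner ℝ (latticeVec v) ℓ).comp
      ((hX m).mono (ℱ.le m) le_rfl)
  simp only [NoBacktrack, Set.ofPred_forall]
  exact MeasurableSet.iInter fun m => measurableSet_le (hheight n) (hheight (n + m))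

/-- The event that `s + n` is the `(k+1)`-st candidate after `s`. -/
def attemptAt (ℓ : EuclideanSpace ℝ (Fin d)) (s k n : ℕ) : Set (ℕ → Fin d → ℤ) :=
  {x | (attempt (shift s (height ℓ x)) (k + 1)).1 = n}

theorem measurableSet_attemptAt (hX : Adapted ℱ X) {s : ℕ} {A : Set Ω}
    (hA : MeasurableSet[ℱ s] A) (k n : ℕ) :
    MeasurableSet[ℱ (s + n)] (A ∩ {ω | traj X ω ∈ attemptAt ℓ s k n}) := by
  refine (ℱ.mono (Nat.le_add_right s n) _ hA).inter
    (measurableSet_of_path hX (s + n) (P := fun x => x ∈ attemptAt ℓ s k n) fun x y h => ?_)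
  refine fst_eq_congr (fun i hi => ?_) le_rfl _
  exact height_congr (h _ (by omega))

/-- Being a candidate only compares with times from `s` on; earlier positions are below the record
at `s`, which the candidate exceeds. -/
theorem isRecord_of_attemptAt {x : ℕ → Fin d → ℤ} {s k n : ℕ} (hs : IsRecord ℓ x s)
    (hx : x ∈ attemptAt ℓ s k n) : IsRecord ℓ x (s + n) := by
  intro i hi
  have h0 : height ℓ x s + 1 ≤ height ℓ x (s + n) := fst_add_one_le (p := shift s (height ℓ x)) hx
  rcases lt_or_ge i s with h1 | h1
  · linarith [hs i h1]
  · obtain ⟨l, rfl⟩ := Nat.exists_eq_add_of_le h1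
    exact lt_of_fst_eq (p := shift s (height ℓ x)) hx (by omega)

theorem pairwise_disjoint_attemptAt (X : ℕ → Ω → Fin d → ℤ) (A : Set Ω) (s k : ℕ) :
    Pairwise (Function.onFun Disjoint fun n => A ∩ {ω | traj X ω ∈ attemptAt ℓ s k n}) := by
  intro m n hmn
  refine Set.disjoint_left.2 fun ω h1 h2 => hmn ?_
  have h3 : (attempt (shift s (height ℓ (traj X ω))) (k + 1)).1 = m := h1.2
  have h4 : (attempt (shift s (height ℓ (traj X ω))) (k + 1)).1 = n := h2.2
  exact_mod_cast h3.symm.trans h4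

/-- A bound for the failure of each attempt yields a bound for an event on the next attempt. -/
theorem measureReal_attempt_le (hX : Adapted ℱ X) {P : (ℕ → Fin d → ℤ) → ℕ → Prop} {c : ℝ}
    (hc : 0 ≤ c)
    (hP : ∀ (t : ℕ) (B : Set Ω), MeasurableSet[ℱ t] B → (∀ ω ∈ B, IsRecord ℓ (traj X ω) t) →
      μ.real (B ∩ {ω | P (traj X ω) t}) ≤ c * μ.real B)
    {s : ℕ} {A : Set Ω} (hA : MeasurableSet[ℱ s] A) (hrec : ∀ ω ∈ A, IsRecord ℓ (traj X ω) s)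
    (k : ℕ) :
    μ.real (A ∩ {ω | ∃ n, traj X ω ∈ attemptAt ℓ s k n ∧ P (traj X ω) (s + n)}) ≤
      c * μ.real (A ∩ {ω | (attempt (shift s (height ℓ (traj X ω))) k).2 < ⊤}) := by
  set B : ℕ → Set Ω := fun n => A ∩ {ω | traj X ω ∈ attemptAt ℓ s k n} with hB
  have hBm : ∀ n, MeasurableSet[ℱ (s + n)] (B n) := fun n => measurableSet_attemptAt hX hA k n
  have h1 := measureReal_iUnion_le_mul (μ := μ) (B := B)
    (E := fun n => B n ∩ {ω | P (traj X ω) (s + n)}) hc (fun n => ℱ.le _ _ (hBm n))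
    (pairwise_disjoint_attemptAt X A s k)
    (fun n => hP (s + n) (B n) (hBm n) fun ω hω => isRecord_of_attemptAt (hrec ω hω.1) hω.2)
  refine le_trans (measureReal_mono ?_ (measure_ne_top _ _)) (h1.trans
    (mul_le_mul_of_nonneg_left (measureReal_mono ?_ (measure_ne_top _ _)) hc))
  · rintro ω ⟨hω, n, h2, h3⟩
    exact Set.mem_iUnion.2 ⟨n, ⟨hω, h2⟩, h3⟩
  -- A further candidate exists only if the previous attempt ended, so the union of all its possible
  -- times lies in `{D_k < ⊤}`; this lets the bound be iterated.
  · refine Set.iUnion_subset fun n ω hω => ⟨hω.1, ?_⟩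
    exact (snd_lt_of_fst_eq (p := shift s (height ℓ (traj X ω))) hω.2).trans
      (ENat.natCast_lt_top n)

/-- The first `N` attempts all fail with exponentially small probability. -/
theorem measureReal_attempts_fail_le (hX : Adapted ℱ X) {p : ℝ} (hp1 : p ≤ 1)
    (hp : ∀ (t : ℕ) (B : Set Ω), MeasurableSet[ℱ t] B → (∀ ω ∈ B, IsRecord ℓ (traj X ω) t) →
      p * μ.real B ≤ μ.real (B ∩ {ω | NoBacktrack ℓ (traj X ω) t}))
    {s : ℕ} {A : Set Ω} (hA : MeasurableSet[ℱ s] A) (hrec : ∀ ω ∈ A, IsRecord ℓ (traj X ω) s)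
    (N : ℕ) :
    μ.real (A ∩ {ω | (attempt (shift s (height ℓ (traj X ω))) N).2 < ⊤}) ≤
      (1 - p) ^ N * μ.real A := by
  induction N with
  | zero =>
    rw [pow_zero, one_mul]
    exact measureReal_mono Set.inter_subset_left (measure_ne_top _ _)
  | succ k ih =>
    have h1 := measureReal_attempt_le (μ := μ) (ℓ := ℓ) (c := 1 - p)
      (P := fun x t => ¬ NoBacktrack ℓ x t) hX (by linarith) (fun t B hB hBr => by
        have h2 := measureReal_inter_add_sdiff (μ := μ) (s := B)
          (measurableSet_noBacktrack (ℓ := ℓ) hX t)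
        have h3 := hp t B hB hBr
        have h4 : B ∩ {ω | ¬ NoBacktrack ℓ (traj X ω) t} =
            B \ {ω | NoBacktrack ℓ (traj X ω) t} := rfl
        rw [h4]
        linarith) hA hrec k
    calc _ ≤ μ.real (A ∩ {ω | ∃ n, traj X ω ∈ attemptAt ℓ s k n ∧
          ¬ NoBacktrack ℓ (traj X ω) (s + n)}) := by
          refine measureReal_mono ?_ (measure_ne_top _ _)
          rintro ω ⟨hω, hlt⟩
          change (attempt (shift s (height ℓ (traj X ω))) (k + 1)).2 < ⊤ at hlt
          have hfin := ((fst_le_snd (shift s (height ℓ (traj X ω))) (k + 1)).trans_lt hlt).ne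
          obtain ⟨n, hn⟩ := ENat.ne_top_iff_exists.1 hfin
          refine ⟨hω, n, hn.symm, fun hnb => hlt.ne ?_⟩
          exact (attempt_succ_snd_eq_top hn.symm).2 (staysAbove_shift.2 hnb)
      _ ≤ (1 - p) * ((1 - p) ^ k * μ.real A) :=
          h1.trans (mul_le_mul_of_nonneg_left ih (by linarith))
      _ = _ := by rw [pow_succ]; ring

open Filter in
/-- The tail of the first regeneration time of a walk at a record, as long as every visited site
that is new for the walk after time `s` gives a drift. -/
theorem WalkBounds.exists_regeneration_bound (hd : 2 ≤ d) (hw : WalkBounds μ ℱ ℓ X K lam h r) :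
    ∃ γ : ℝ, 0 < γ ∧ ∀ᶠ m : ℕ in atTop, ∀ (s : ℕ) (A : Set Ω),
      MeasurableSet[ℱ s] A → (∀ ω ∈ A, IsRecord ℓ (traj X ω) s) →
      μ.real (A ∩ {ω | (siteRange (traj X ω) s m).card ≤ (freshTimes (traj X ω) s m).card ∧
        (m : ℕ∞) < firstRegeneration (shift s (height ℓ (traj X ω)))}) ≤
        Real.exp (-(m : ℝ) ^ γ) * μ.real A := by
  obtain ⟨a, γ1, ha0, -, hγ1, hheight⟩ := hw.exists_height_bound hd
  obtain ⟨γ2, hγ2, hlate⟩ := hw.exists_lateBacktrack_bound hd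
  obtain ⟨p, hp0, hp⟩ := hw.exists_noBacktrack_bound hd
  have hK := hw.one_le_K
  have hK0 : 0 < K := by linarith
  have hp1 : p ≤ 1 := by
    have h1 := hp 0 Set.univ MeasurableSet.univ fun ω _ k hk => absurd hk (Nat.not_lt_zero k)
    rw [probReal_univ, mul_one] at h1
    exact h1.trans measureReal_le_one
  -- Strictly below the three exponents `γ1`, `γ2 / 8` and `1 / 8`, which come from too small a
  -- climb, a long failed attempt, and too many failures.
  set γ := min (γ1 / 2) (min (γ2 / 16) (1 / 16)) with hγ
  have hγ0 : 0 < γ := lt_min (by positivity) (lt_min (by positivity) (by norm_num))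
  have hγa : γ < γ1 := lt_of_le_of_lt (min_le_left _ _) (by linarith)
  have hγb : γ < γ2 / 8 := lt_of_le_of_lt ((min_le_right _ _).trans (min_le_left _ _)) (by linarith)
  have hγc : γ < 1 / 8 := lt_of_le_of_lt ((min_le_right _ _).trans (min_le_right _ _)) (by norm_num)
  have hfloor : Tendsto (fun m : ℕ => ⌊(m : ℝ) ^ (1 / 8 : ℝ)⌋₊) atTop atTop :=
    tendsto_nat_floor_atTop.comp
      ((tendsto_rpow_atTop (by norm_num)).comp tendsto_natCast_atTop_atTop)
  have hc2 : (0 : ℝ) < (1 / 2) ^ γ2 := by positivity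
  refine ⟨γ, hγ0, ?_⟩
  filter_upwards [hheight, hfloor.eventually hlate, eventually_ge_atTop 1,
    eventually_mul_rpow_mul_exp_le 3 0 one_pos hγ0 hγa,
    eventually_mul_rpow_mul_exp_le 3 1 hc2 hγ0 hγb,
    eventually_mul_rpow_mul_exp_le 3 0 (half_pos hp0) hγ0 hγc,
    eventually_mul_rpow_le 2 (by norm_num : (0 : ℝ) < 1 / 8),
    eventually_mul_rpow_le (2 * K + 2) (by norm_num : (1 / 4 : ℝ) < 1 / 2)]
    with m e1 e2 hm e3 e4 e5 e6 e7 s A hA hrec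
  have hm1 : (1 : ℝ) ≤ m := by exact_mod_cast hm
  have hm0 : (0 : ℝ) < m := by linarith
  set y := (m : ℝ) ^ (1 / 8 : ℝ) with hy
  -- `N` is both the number of attempts and the admissible length of a failed one. Their total rise
  -- is `O(N²) = O(m^(1/4))`, below `√m`.
  set N := ⌊y⌋₊ with hN
  have hy1 : 1 ≤ y := Real.one_le_rpow hm1 (by norm_num)
  have hNy : (N : ℝ) ≤ y := Nat.floor_le (zero_le_one.trans hy1)
  have hyN : y / 2 ≤ N := by
    have h1 := Nat.lt_floor_add_one y
    rw [← hN] at h1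
    rw [Real.rpow_zero] at e6
    linarith
  set E0 := A ∩ {ω | (siteRange (traj X ω) s m).card ≤ (freshTimes (traj X ω) s m).card + 0 ∧
        inner ℝ (latticeVec (traj X ω (s + m) - traj X ω s)) ℓ ≤ √m} with hE0
  set E1 : ℕ → Set Ω := fun k => A ∩ {ω | ∃ n, traj X ω ∈ attemptAt ℓ s k n ∧
    ∃ j > N, FirstBelow ℓ (traj X ω) (s + n) (s + n) j} with hE1
  set E2 := A ∩ {ω | (attempt (shift s (height ℓ (traj X ω))) N).2 < ⊤} with hE2
  set E3 := {ω | ¬ ∀ n, ‖jump X n ω‖ ≤ K} with hE3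
  have hsub : A ∩ {ω | (siteRange (traj X ω) s m).card ≤ (freshTimes (traj X ω) s m).card ∧
        (m : ℕ∞) < firstRegeneration (shift s (height ℓ (traj X ω)))} ⊆
      (E0 ∪ ⋃ k ∈ Finset.range N, E1 k) ∪ (E2 ∪ E3) := by
    rintro ω ⟨hωA, hcard, hlt⟩
    by_cases h0 : ω ∈ E0
    · exact Or.inl (Or.inl h0)
    by_cases h1 : ω ∈ ⋃ k ∈ Finset.range N, E1 k
    · exact Or.inl (Or.inr h1)
    by_cases h3 : ω ∈ E3
    · exact Or.inr (Or.inr h3)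
    refine Or.inr (Or.inl ⟨hωA, ?_⟩)
    have hjump : ∀ n, ‖jump X n ω‖ ≤ K := not_not.1 h3
    have hclimb : √m < height ℓ (traj X ω) (s + m) - height ℓ (traj X ω) s := by
      rw [← height_sub]
      by_contra hcon
      exact h0 ⟨hωA, hcard, not_lt.1 hcon⟩
    -- Off the other exceptional events the deterministic lemma applies, and the absence of a
    -- regeneration by time `m` leaves only `N` failed attempts.
    refine (exists_regeneration_le (K := K) (L := N) (N := N) (m := m) hK0.le (fun i => ?_) ?_
      ?_).resolve_left (not_le.2 hlt)
    · have h4 : shift s (height ℓ (traj X ω)) (i + 1) - shift s (height ℓ (traj X ω)) i =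
          inner ℝ (jump X (s + i) ω) ℓ := by
        simp only [shift, ← add_assoc, ← height_sub]; rfl
      rw [h4]
      refine (abs_real_inner_le_norm _ _).trans ?_
      rw [hw.direction, mul_one]
      exact hjump _
    · have h5 : (N : ℝ) * (K * N + K + 1) + 1 ≤ (2 * K + 2) * (m : ℝ) ^ (1 / 4 : ℝ) := by
        have h6 : (m : ℝ) ^ (1 / 4 : ℝ) = y * y := by
          rw [hy, ← Real.rpow_add hm0]; norm_num
        rw [h6]
        have h7 : (N : ℝ) * (K * N + K + 1) ≤ y * (K * y + K + 1) := by gcongr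
        have h8 : y ≤ y * y := le_mul_of_one_le_left (zero_le_one.trans hy1) hy1
        have h9 : K * y ≤ K * (y * y) := mul_le_mul_of_nonneg_left h8 hK0.le
        linarith only [h7, h8, h9, hy1]
      rw [← Real.sqrt_eq_rpow] at e7
      simp only [shift, add_zero]
      linarith
    · intro k hk n j hn hj1 hj2
      by_contra hcon
      refine h1 ?_
      simp only [Set.mem_iUnion]
      refine ⟨k, Finset.mem_range.2 hk, hωA, n, hn, j, not_le.1 hcon, fun i hi => ?_, ?_⟩
      · simpa only [shift, add_assoc] using hj2 i hi
      · simpa only [shift, add_assoc] using hj1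
  have hb0 : μ.real E0 ≤ Real.exp (-(m : ℝ) ^ γ) / 3 * μ.real A := by
    refine (e1 s A hA 0 ?_).trans (mul_le_mul_of_nonneg_right ?_ measureReal_nonneg)
    · rw [Nat.cast_zero, mul_zero]; positivity
    · rw [Real.rpow_zero, one_mul] at e3; linarith
  have hb1 : ∀ k ∈ Finset.range N, μ.real (E1 k) ≤
      Real.exp (-((1 / 2) ^ γ2 * (m : ℝ) ^ (γ2 / 8))) * μ.real A := by
    intro k _
    have h1 := measureReal_attempt_le (μ := μ) (ℓ := ℓ) (c := Real.exp (-(N : ℝ) ^ γ2))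
      (P := fun x t => ∃ j > N, FirstBelow ℓ x t t j) hw.adapted (Real.exp_pos _).le
      e2 hA hrec k
    refine h1.trans (mul_le_mul (Real.exp_le_exp.2 (neg_le_neg ?_))
      (measureReal_mono Set.inter_subset_left (measure_ne_top _ _)) measureReal_nonneg
      (Real.exp_pos _).le)
    calc (1 / 2) ^ γ2 * (m : ℝ) ^ (γ2 / 8) = (y / 2) ^ γ2 := by
          rw [div_eq_mul_one_div y, Real.mul_rpow (by positivity) (by norm_num), hy,
            ← Real.rpow_mul hm0.le, mul_comm]
          congr 2; ring
      _ ≤ (N : ℝ) ^ γ2 := Real.rpow_le_rpow (by positivity) hyN hγ2.le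
  have hb2 : μ.real (⋃ k ∈ Finset.range N, E1 k) ≤ Real.exp (-(m : ℝ) ^ γ) / 3 * μ.real A := by
    calc _ ≤ ∑ k ∈ Finset.range N, μ.real (E1 k) := measureReal_biUnion_finset_le _ _
      _ ≤ ∑ k ∈ Finset.range N, Real.exp (-((1 / 2) ^ γ2 * (m : ℝ) ^ (γ2 / 8))) * μ.real A :=
          Finset.sum_le_sum hb1
      _ = N * Real.exp (-((1 / 2) ^ γ2 * (m : ℝ) ^ (γ2 / 8))) * μ.real A := by
          rw [Finset.sum_const, Finset.card_range, nsmul_eq_mul]; ring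
      _ ≤ m * Real.exp (-((1 / 2) ^ γ2 * (m : ℝ) ^ (γ2 / 8))) * μ.real A := by
          have : (N : ℝ) ≤ m := by
            refine hNy.trans ?_
            calc y ≤ (m : ℝ) ^ (1 : ℝ) := Real.rpow_le_rpow_of_exponent_le hm1 (by norm_num)
              _ = m := Real.rpow_one _
          exact mul_le_mul_of_nonneg_right (mul_le_mul_of_nonneg_right this (Real.exp_pos _).le)
            measureReal_nonneg
      _ ≤ _ := by
          refine mul_le_mul_of_nonneg_right ?_ measureReal_nonneg
          rw [Real.rpow_one] at e4
          linarith
  have hb3 : μ.real E2 ≤ Real.exp (-(m : ℝ) ^ γ) / 3 * μ.real A := by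
    refine (measureReal_attempts_fail_le hw.adapted hp1 hp hA hrec N).trans
      (mul_le_mul_of_nonneg_right ?_ measureReal_nonneg)
    have h1 : (1 - p) ^ N ≤ Real.exp (-(p / 2 * y)) := by
      calc (1 - p) ^ N ≤ Real.exp (-p) ^ N :=
            pow_le_pow_left₀ (by linarith) (Real.one_sub_le_exp_neg p) N
        _ = Real.exp (-(p * N)) := by rw [← Real.exp_nat_mul]; congr 1; ring
        _ ≤ _ := Real.exp_le_exp.2 (by
          have := mul_le_mul_of_nonneg_left hyN hp0.le
          linarith)
    rw [Real.rpow_zero] at e5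
    linarith
  have hb4 : μ.real E3 = 0 := by
    rw [measureReal_def, ae_iff.1 hw.bound, ENNReal.toReal_zero]
  calc _ ≤ μ.real ((E0 ∪ ⋃ k ∈ Finset.range N, E1 k) ∪ (E2 ∪ E3)) :=
        measureReal_mono hsub (measure_ne_top _ _)
    _ ≤ (μ.real E0 + μ.real (⋃ k ∈ Finset.range N, E1 k)) + (μ.real E2 + μ.real E3) :=
        (measureReal_union_le _ _).trans
          (add_le_add (measureReal_union_le _ _) (measureReal_union_le _ _))
    _ ≤ _ := by linarith

end
end ExcitedWalk

namespace ExcitedWalk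
noncomputable section

/-- A conditional probability is bounded as soon as the probability of the event is bounded
relative to every event of the σ-algebra. -/
theorem condExp_indicator_le {Ω : Type*} {m mΩ : MeasurableSpace Ω} {μ : Measure Ω}
    [IsFiniteMeasure μ] (hm : m ≤ mΩ) {E : Set Ω} (hE : MeasurableSet E) {c : ℝ}
    (h : ∀ G, MeasurableSet[m] G → μ.real (G ∩ E) ≤ c * μ.real G) :
    ∀ᵐ ω ∂μ, (μ⟦E | m⟧) ω ≤ c := by
  have hint : Integrable (E.indicator fun _ => (1 : ℝ)) μ :=
    (integrable_const 1).indicator hE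
  have hsm : StronglyMeasurable[m] (μ⟦E | m⟧) := stronglyMeasurable_condExp
  refine ae_le_of_ae_le_trim (hm := hm) (f₂ := fun _ => c) ?_
  refine ae_le_of_forall_setIntegral_le (integrable_condExp.trim hm hsm) (integrable_const c)
    fun G hG _ => ?_
  rw [← setIntegral_trim hm hsm hG, setIntegral_condExp hm hint hG,
    ← setIntegral_trim hm stronglyMeasurable_const hG, setIntegral_const,
    setIntegral_indicator hE, setIntegral_const]
  simpa [mul_comm] using h G hG

variable {d : ℕ} {Ω : Type*} {mΩ : MeasurableSpace Ω} {μ : Measure Ω} [IsProbabilityMeasure μ]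
  {ℱ : Filtration ℕ mΩ} {ℓ : EuclideanSpace ℝ (Fin d)} {X : ℕ → Ω → Fin d → ℤ} {K lam h r : ℝ}

/-! ### The events at a regeneration time -/

/-- The event `S` is the intersection of an event `B` of the past of time `n`, on which `n` is a
record, with the event that the walk never goes back below its position at time `n`. -/
def IsRegenerationEvent (ℱ : Filtration ℕ mΩ) (ℓ : EuclideanSpace ℝ (Fin d))
    (X : ℕ → Ω → Fin d → ℤ) (n : ℕ) (S : Set Ω) : Prop :=
  ∃ B, MeasurableSet[ℱ n] B ∧ (∀ ω ∈ B, IsRecord ℓ (traj X ω) n) ∧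
    S = B ∩ {ω | NoBacktrack ℓ (traj X ω) n}

namespace IsRegenerationEvent

variable {n : ℕ} {S T : Set Ω}

protected theorem empty : IsRegenerationEvent ℱ ℓ X n ∅ :=
  ⟨∅, (ℱ n).measurableSet_empty, fun _ h => absurd h (Set.notMem_empty _), (Set.empty_inter _).symm⟩

theorem iUnion {S : ℕ → Set Ω} (hS : ∀ i, IsRegenerationEvent ℱ ℓ X n (S i)) :
    IsRegenerationEvent ℱ ℓ X n (⋃ i, S i) := by
  choose B hB hrec hSB using hS
  refine ⟨⋃ i, B i, MeasurableSet.iUnion hB, fun ω hω => ?_, ?_⟩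
  · obtain ⟨i, hi⟩ := Set.mem_iUnion.1 hω
    exact hrec i ω hi
  · rw [Set.iUnion_inter]
    exact Set.iUnion_congr hSB

theorem inter (hS : IsRegenerationEvent ℱ ℓ X n S) {A : Set Ω} (hA : MeasurableSet[ℱ n] A) :
    IsRegenerationEvent ℱ ℓ X n (S ∩ A) := by
  obtain ⟨B, hB, hrec, rfl⟩ := hS
  exact ⟨B ∩ A, hB.inter hA, fun ω hω => hrec ω hω.1, Set.inter_right_comm _ _ _⟩

/-- The two events share the same condition on the future, so the difference only affects the past.
This yields complements within `{τ_k = n}`. -/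
theorem sdiff (hT : IsRegenerationEvent ℱ ℓ X n T) (hS : IsRegenerationEvent ℱ ℓ X n S) :
    IsRegenerationEvent ℱ ℓ X n (T \ S) := by
  obtain ⟨B, hB, hrec, rfl⟩ := hT
  obtain ⟨B', hB', -, rfl⟩ := hS
  refine ⟨B \ B', hB.diff hB', fun ω hω => hrec ω hω.1, ?_⟩
  ext ω
  simp only [Set.mem_sdiff, Set.mem_inter_iff]
  tauto

theorem measurableSet (hX : Adapted ℱ X) (hS : IsRegenerationEvent ℱ ℓ X n S) :
    MeasurableSet S := by
  obtain ⟨B, hB, -, rfl⟩ := hS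
  exact (ℱ.le _ _ hB).inter (measurableSet_noBacktrack hX n)

/-- The event that a regeneration at time `n` is followed by the next one at time `n + j`. -/
theorem inter_firstRegeneration (hX : Adapted ℱ X) (hS : IsRegenerationEvent ℱ ℓ X n S) (j : ℕ) :
    IsRegenerationEvent ℱ ℓ X (n + j)
      (S ∩ {ω | firstRegeneration (shift n (height ℓ (traj X ω))) = j}) := by
  obtain ⟨B, hB, hrec, rfl⟩ := hS
  -- The old no-backtracking condition is truncated at time `n + j` to become an event of the past.
  -- Its remaining part follows from the new one, because the new record is higher.
  refine ⟨B ∩ {ω | IsCandidate (shift n (height ℓ (traj X ω))) j ∧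
    ∀ i < j, height ℓ (traj X ω) n ≤ height ℓ (traj X ω) (n + i)},
    (ℱ.mono (Nat.le_add_right n j) _ hB).inter
      (measurableSet_of_path hX (n + j) (P := fun x => IsCandidate (shift n (height ℓ x)) j ∧
        ∀ i < j, height ℓ x n ≤ height ℓ x (n + i)) fun x y hxy => ?_), ?_, ?_⟩
  · refine and_congr (isCandidate_congr fun i hi => height_congr (hxy _ (by omega)))
      (forall₂_congr fun i hi => ?_)
    rw [height_congr (hxy n (by omega)), height_congr (hxy (n + i) (by omega))]
  · rintro ω ⟨hωB, ⟨k, hk⟩, -⟩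
    exact isRecord_of_attemptAt (hrec ω hωB) hk
  · ext ω
    have hreg : firstRegeneration (shift n (height ℓ (traj X ω))) = j ↔
        IsCandidate (shift n (height ℓ (traj X ω))) j ∧ NoBacktrack ℓ (traj X ω) (n + j) :=
      firstRegeneration_eq_coe.trans (and_congr_right fun _ => staysAbove_shift)
    simp only [Set.mem_inter_iff, Set.mem_ofPred_eq, hreg]
    constructor
    · rintro ⟨⟨h1, h2⟩, h3, h4⟩
      exact ⟨⟨h1, h3, fun i _ => h2 i⟩, h4⟩
    · rintro ⟨⟨h1, h3, h2⟩, h4⟩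
      refine ⟨⟨h1, fun i => ?_⟩, h3, h4⟩
      rcases lt_or_ge i j with hi | hi
      · exact h2 i hi
      · obtain ⟨k, hk⟩ := h3
        have h5 : height ℓ (traj X ω) n + 1 ≤ height ℓ (traj X ω) (n + j) :=
          fst_add_one_le (p := shift n (height ℓ (traj X ω))) hk
        obtain ⟨l, rfl⟩ := Nat.exists_eq_add_of_le hi
        have h6 := h4 l
        rw [add_assoc] at h6
        linarith

end IsRegenerationEvent

/-! ### Regeneration times and the σ-algebras of their past -/

theorem regTime_succ {k n : ℕ} {ω : Ω} (h : regTime ℓ X k ω = n) :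
    regTime ℓ X (k + 1) ω = n + firstRegeneration (shift n (height ℓ (traj X ω))) := by
  have h1 : regTime ℓ X (k + 1) ω = regTime ℓ X k ω +
      firstRegeneration (shift (regTime ℓ X k ω).toNat (height ℓ (traj X ω))) := rfl
  rw [h1, h, ENat.toNat_natCast]

theorem regTime_succ_sub {k n : ℕ} {ω : Ω} (h : regTime ℓ X k ω = n) :
    regTime ℓ X (k + 1) ω - regTime ℓ X k ω =
      firstRegeneration (shift n (height ℓ (traj X ω))) := by
  rw [regTime_succ h, h, (ENat.addLECancellable_natCast n).add_tsub_cancel_left]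

theorem regTime_succ_eq_add {k n j : ℕ} {ω : Ω} (h : regTime ℓ X k ω = n) :
    regTime ℓ X (k + 1) ω = (n + j : ℕ) ↔
      firstRegeneration (shift n (height ℓ (traj X ω))) = j := by
  rw [regTime_succ h, Nat.cast_add]
  exact (ENat.add_right_injective_of_ne_top (ENat.natCast_ne_top n)).eq_iff

theorem isRegenerationEvent_regTime_one (hX : Adapted ℱ X) (n : ℕ) :
    IsRegenerationEvent ℱ ℓ X n {ω | regTime ℓ X 1 ω = n} := by
  refine ⟨{ω | IsCandidate (height ℓ (traj X ω)) n}, measurableSet_of_path hX n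
    (P := fun x => IsCandidate (height ℓ x) n) fun x y hxy =>
      isCandidate_congr fun i hi => height_congr (hxy i hi), fun ω hω i hi => hω.lt hi, ?_⟩
  ext ω
  have h1 : regTime ℓ X 1 ω = firstRegeneration (height ℓ (traj X ω)) := regeneration_one _
  simp only [Set.mem_ofPred_eq, h1, firstRegeneration_eq_coe]
  rfl

theorem isRegenerationEvent_regTime (hX : Adapted ℱ X) (k n : ℕ) :
    IsRegenerationEvent ℱ ℓ X n {ω | regTime ℓ X (k + 1) ω = n} := by
  induction k generalizing n with
  | zero => exact isRegenerationEvent_regTime_one hX n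
  | succ k ih =>
    -- A finite regeneration time has a finite predecessor; its value `m` is summed out.
    have h1 : {ω | regTime ℓ X (k + 1 + 1) ω = n} = ⋃ m : ℕ,
        {ω | regTime ℓ X (k + 1) ω = m} ∩ {ω | regTime ℓ X (k + 1 + 1) ω = n} := by
      ext ω
      simp only [Set.mem_ofPred_eq, Set.mem_iUnion, Set.mem_inter_iff, exists_and_right]
      refine ⟨fun hω => ⟨?_, hω⟩, fun hω => hω.2⟩
      have hle : regTime ℓ X (k + 1) ω ≤ n := hω ▸ le_self_add
      obtain ⟨m, hm⟩ := ENat.ne_top_iff_exists.1 (ne_top_of_le_ne_top (ENat.natCast_ne_top n) hle)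
      exact ⟨m, hm.symm⟩
    rw [h1]
    refine IsRegenerationEvent.iUnion fun m => ?_
    rcases le_or_gt m n with hmn | hmn
    · obtain ⟨j, rfl⟩ := Nat.exists_eq_add_of_le hmn
      convert (ih m).inter_firstRegeneration hX j using 1
      ext ω
      exact and_congr_right fun hω => regTime_succ_eq_add hω
    · convert IsRegenerationEvent.empty using 1
      refine Set.eq_empty_of_forall_notMem fun ω hω => ?_
      have hle : regTime ℓ X (k + 1) ω ≤ regTime ℓ X (k + 1 + 1) ω := le_self_add
      rw [hω.1, hω.2] at hle
      have : m ≤ n := by exact_mod_cast hle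
      omega

theorem isRegenerationEvent_regTimes (hX : Adapted ℱ X) {k : ℕ} {n : ℕ → ℕ}
    (hn : StrictMonoOn n (Set.Icc 1 (k + 1))) :
    IsRegenerationEvent ℱ ℓ X (n (k + 1))
      {ω | ∀ i ∈ Set.Icc 1 (k + 1), regTime ℓ X i ω = n i} := by
  induction k with
  | zero =>
    convert isRegenerationEvent_regTime_one (ℓ := ℓ) hX (n 1) using 3 with ω
    simp
  | succ k ih =>
    have hlt : n (k + 1) < n (k + 1 + 1) :=
      hn ⟨by omega, by omega⟩ ⟨by omega, by omega⟩ (Nat.lt_succ_self _)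
    obtain ⟨j, hj⟩ := Nat.exists_eq_add_of_le hlt.le
    have h1 := (ih (hn.mono (Set.Icc_subset_Icc_right (by omega)))).inter_firstRegeneration hX j
    rw [hj]
    convert h1 using 1
    ext ω
    constructor
    · intro hω
      refine ⟨fun i hi => hω i ⟨hi.1, hi.2.trans (by omega)⟩, ?_⟩
      have h2 := hω (k + 1 + 1) ⟨by omega, le_rfl⟩
      rw [hj] at h2
      exact (regTime_succ_eq_add (hω (k + 1) ⟨by omega, by omega⟩)).1 h2
    · rintro ⟨h2, h3⟩ i ⟨hi1, hi2⟩
      rcases Nat.lt_or_ge i (k + 1 + 1) with hi | hi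
      · exact h2 i ⟨hi1, by omega⟩
      · obtain rfl : i = k + 1 + 1 := by omega
        rw [hj]
        exact (regTime_succ_eq_add (h2 (k + 1) ⟨by omega, le_rfl⟩)).2 h3

/-- Induction over the generated σ-algebra: a generator either prescribes `τ_{k+1} = n`, and then
has the required form, or is disjoint from `{τ_{k+1} = n}`; the form is stable under relative
complements and countable unions. -/
theorem isRegenerationEvent_of_regSigma (hX : Adapted ℱ X) {k : ℕ} {G : Set Ω}
    (hG : MeasurableSet[regSigma ℱ ℓ X (k + 1)] G) (n : ℕ) :
    IsRegenerationEvent ℱ ℓ X n ({ω | regTime ℓ X (k + 1) ω = n} ∩ G) := by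
  refine MeasurableSpace.generateFrom_induction _
    (fun G _ => IsRegenerationEvent ℱ ℓ X n ({ω | regTime ℓ X (k + 1) ω = n} ∩ G))
    ?_ ?_ ?_ ?_ G hG
  · rintro _ ⟨t, A, ht, hA, rfl⟩ -
    by_cases htn : t (k + 1) = n
    · subst htn
      convert (isRegenerationEvent_regTimes (ℓ := ℓ) hX ht).inter hA using 1
      refine Set.inter_eq_right.2 fun ω hω => hω.1 (k + 1) ⟨by omega, le_rfl⟩
    · convert IsRegenerationEvent.empty using 1
      refine Set.eq_empty_of_forall_notMem fun ω hω => htn ?_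
      have h1 := hω.2.1 (k + 1) ⟨by omega, le_rfl⟩
      rw [hω.1] at h1
      exact_mod_cast h1.symm
  · rw [Set.inter_empty]
    exact IsRegenerationEvent.empty
  · intro G _ hG
    convert (isRegenerationEvent_regTime hX k n).sdiff hG using 1
    rw [Set.sdiff_self_inter]
    rfl
  · intro G _ hG
    rw [Set.inter_iUnion]
    exact IsRegenerationEvent.iUnion hG

/-! ### The tail of the regeneration times -/

open Filter in
/-- The tail of the time between a regeneration and the next one. -/
theorem WalkBounds.exists_next_regeneration_bound (hd : 2 ≤ d)
    (hw : WalkBounds μ ℱ ℓ X K lam h r) :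
    ∃ C γ : ℝ, 0 < C ∧ 0 < γ ∧ ∀ᶠ m : ℕ in atTop, ∀ (n : ℕ) (S : Set Ω),
      IsRegenerationEvent ℱ ℓ X n S →
      μ.real (S ∩ {ω | (m : ℕ∞) < firstRegeneration (shift n (height ℓ (traj X ω)))}) ≤
        C * Real.exp (-(m : ℝ) ^ γ) * μ.real S := by
  obtain ⟨γ, hγ, hreg⟩ := hw.exists_regeneration_bound hd
  obtain ⟨p, hp0, hp⟩ := hw.exists_noBacktrack_bound hd
  refine ⟨p⁻¹, γ, inv_pos.2 hp0, hγ, ?_⟩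
  filter_upwards [hreg] with m hm n S hS
  obtain ⟨B, hB, hrec, rfl⟩ := hS
  -- Without backtracking no site from before time `n` is revisited, so every new site is fresh.
  -- Keeping only this consequence leaves the past event `B`, for which the tail bound holds;
  -- returning from `B` to `S` costs the factor `p⁻¹`.
  calc _ ≤ μ.real (B ∩ {ω | (siteRange (traj X ω) n m).card ≤ (freshTimes (traj X ω) n m).card ∧
        (m : ℕ∞) < firstRegeneration (shift n (height ℓ (traj X ω)))}) := by
        refine measureReal_mono ?_ (measure_ne_top _ _)
        rintro ω ⟨⟨h1, h2⟩, h3⟩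
        have h4 := card_siteRange_le_of_isRecord (hrec ω h1) (n := m) fun i _ => h2 i
        rw [Nat.sub_self] at h4
        exact ⟨h1, h4, h3⟩
    _ ≤ Real.exp (-(m : ℝ) ^ γ) * μ.real B := hm n B hB hrec
    _ ≤ Real.exp (-(m : ℝ) ^ γ) *
        (p⁻¹ * μ.real (B ∩ {ω | NoBacktrack ℓ (traj X ω) n})) := by
        refine mul_le_mul_of_nonneg_left ?_ (Real.exp_pos _).le
        rw [le_inv_mul_iff₀ hp0]
        exact hp n B hB hrec
    _ = _ := by ring

theorem tendsto_exp_neg_rpow_atTop {γ : ℝ} (hγ : 0 < γ) :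
    Filter.Tendsto (fun m : ℕ => Real.exp (-(m : ℝ) ^ γ)) Filter.atTop (nhds 0) :=
  Real.tendsto_exp_neg_atTop_nhds_zero.comp
    ((tendsto_rpow_atTop hγ).comp tendsto_natCast_atTop_atTop)

theorem WalkBounds.regTime_one_lt_top (hd : 2 ≤ d) (hw : WalkBounds μ ℱ ℓ X K lam h r) :
    ∀ᵐ ω ∂μ, regTime ℓ X 1 ω < ⊤ := by
  obtain ⟨γ, hγ, hreg⟩ := hw.exists_regeneration_bound hd
  have h0 : μ.real {ω | ¬ regTime ℓ X 1 ω < ⊤} = 0 := by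
    refine le_antisymm (ge_of_tendsto (tendsto_exp_neg_rpow_atTop hγ) ?_) measureReal_nonneg
    filter_upwards [hreg] with m hm
    have h1 := hm 0 Set.univ MeasurableSet.univ fun ω _ k hk => absurd hk (Nat.not_lt_zero k)
    rw [probReal_univ, mul_one] at h1
    refine (measureReal_mono ?_ (measure_ne_top _ _)).trans h1
    intro ω hω
    have h2 : firstRegeneration (shift 0 (height ℓ (traj X ω))) = ⊤ := by
      have h3 : regTime ℓ X 1 ω = 0 + firstRegeneration (shift 0 (height ℓ (traj X ω))) := rfl
      rw [zero_add] at h3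
      rw [← h3]
      exact not_lt_top_iff.1 hω
    -- From time 0 every visited site is fresh at its first visit. The direction `0` makes the
    -- height conditions of the lemma trivial.
    have h4 := card_siteRange_le_of_isRecord (ℓ := (0 : EuclideanSpace ℝ (Fin d)))
      (x := traj X ω) (t := 0) (s := 0) (n := m) (fun k hk => absurd hk (Nat.not_lt_zero k))
      fun i _ => by simp [height]
    refine ⟨Set.mem_univ _, h4, ?_⟩
    rw [h2]
    exact ENat.natCast_lt_top m
  exact ae_iff.2 ((measureReal_eq_zero_iff (measure_ne_top _ _)).1 h0)

/-- A bound on the next regeneration after a deterministic time gives one after `τ_{k+1}`. -/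
theorem measureReal_inter_regTime_le (hX : Adapted ℱ X) {c : ℝ} (hc : 0 ≤ c) {m : ℕ}
    (hm : ∀ (n : ℕ) (S : Set Ω), IsRegenerationEvent ℱ ℓ X n S →
      μ.real (S ∩ {ω | (m : ℕ∞) < firstRegeneration (shift n (height ℓ (traj X ω)))}) ≤
        c * μ.real S)
    {k : ℕ} {G : Set Ω} (hG : MeasurableSet[regSigma ℱ ℓ X (k + 1)] G) :
    μ.real (G ∩ {ω | regTime ℓ X (k + 1) ω < ⊤ ∧
      (m : ℕ∞) < regTime ℓ X (k + 1 + 1) ω - regTime ℓ X (k + 1) ω}) ≤ c * μ.real G := by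
  have hS := isRegenerationEvent_of_regSigma hX hG
  have hdis : Pairwise (Function.onFun Disjoint
      fun n : ℕ => {ω | regTime ℓ X (k + 1) ω = n} ∩ G) := by
    intro i j hij
    refine Set.disjoint_left.2 fun ω h1 h2 => hij ?_
    have h3 : (i : ℕ∞) = j := h1.1.symm.trans h2.1
    exact_mod_cast h3
  have h1 := measureReal_iUnion_le_mul (μ := μ) hc (fun n => (hS n).measurableSet hX) hdis
    fun n => hm n _ (hS n)
  refine (measureReal_mono ?_ (measure_ne_top _ _)).trans (h1.trans
    (mul_le_mul_of_nonneg_left (measureReal_mono ?_ (measure_ne_top _ _)) hc))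
  · rintro ω ⟨hωG, hfin, hlt⟩
    obtain ⟨n, hn⟩ := ENat.ne_top_iff_exists.1 hfin.ne
    refine Set.mem_iUnion.2 ⟨n, ⟨hn.symm, hωG⟩, ?_⟩
    rwa [regTime_succ_sub hn.symm] at hlt
  · exact Set.iUnion_subset fun n ω hω => hω.2

theorem WalkBounds.regTime_lt_top (hd : 2 ≤ d) (hw : WalkBounds μ ℱ ℓ X K lam h r) (k : ℕ) :
    ∀ᵐ ω ∂μ, regTime ℓ X (k + 1) ω < ⊤ := by
  induction k with
  | zero => exact hw.regTime_one_lt_top hd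
  | succ k ih =>
    obtain ⟨C, γ, hC, hγ, hreg⟩ := hw.exists_next_regeneration_bound hd
    have h0 : μ.real {ω | regTime ℓ X (k + 1) ω < ⊤ ∧ regTime ℓ X (k + 1 + 1) ω = ⊤} = 0 := by
      have hlim := (tendsto_exp_neg_rpow_atTop hγ).const_mul C
      rw [mul_zero] at hlim
      -- An infinite gap exceeds every `m`, so the tail bound may be taken to its limit.
      refine le_antisymm (ge_of_tendsto hlim ?_) measureReal_nonneg
      filter_upwards [hreg] with m hm
      have h1 := measureReal_inter_regTime_le hw.adapted (by positivity) hm (k := k)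
        (G := Set.univ) MeasurableSet.univ
      rw [probReal_univ, mul_one] at h1
      refine (measureReal_mono ?_ (measure_ne_top _ _)).trans h1
      rintro ω ⟨hfin, htop⟩
      refine ⟨Set.mem_univ _, hfin, ?_⟩
      obtain ⟨n, hn⟩ := ENat.ne_top_iff_exists.1 hfin.ne
      rw [htop, ← hn, ENat.top_sub_natCast]
      exact ENat.natCast_lt_top m
    have h1 : ∀ᵐ ω ∂μ, ¬ (regTime ℓ X (k + 1) ω < ⊤ ∧ regTime ℓ X (k + 1 + 1) ω = ⊤) := by
      refine ae_iff.2 ?_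
      simp only [not_not]
      exact (measureReal_eq_zero_iff (measure_ne_top _ _)).1 h0
    filter_upwards [ih, h1] with ω h2 h3
    exact lt_top_iff_ne_top.2 fun h4 => h3 ⟨h2, h4⟩

theorem WalkBounds.condExp_regTime_le (hd : 2 ≤ d) (hw : WalkBounds μ ℱ ℓ X K lam h r) {c : ℝ}
    (hc : 0 ≤ c) {m : ℕ}
    (hm : ∀ (n : ℕ) (S : Set Ω), IsRegenerationEvent ℱ ℓ X n S →
      μ.real (S ∩ {ω | (m : ℕ∞) < firstRegeneration (shift n (height ℓ (traj X ω)))}) ≤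
        c * μ.real S) (k : ℕ) :
    ∀ᵐ ω ∂μ, (μ⟦{ω' | (m : ℕ∞) < regTime ℓ X (k + 1 + 1) ω' - regTime ℓ X (k + 1) ω'} |
      regSigma ℱ ℓ X (k + 1)⟧) ω ≤ c := by
  refine condExp_indicator_le (regSigma_le ℓ hw.adapted (k + 1)) ?_ fun G hG => ?_
  · have h1 : Measurable fun ω => regTime ℓ X (k + 1 + 1) ω - regTime ℓ X (k + 1) ω :=
      (measurable_of_countable fun x : ℕ∞ × ℕ∞ => x.1 - x.2).comp
        ((measurable_regTime ℓ hw.adapted (k + 1 + 1)).prodMk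
          (measurable_regTime ℓ hw.adapted (k + 1)))
    exact h1 (MeasurableSet.of_discrete (s := Set.Ioi (m : ℕ∞)))
  · refine le_trans (le_of_eq (measureReal_congr ?_))
      (measureReal_inter_regTime_le hw.adapted hc hm hG)
    -- The finiteness clause in `measureReal_inter_regTime_le` is free of charge because `τ_{k+1}`
    -- is almost surely finite.
    filter_upwards [hw.regTime_lt_top hd k] with ω hω
    refine propext (and_congr_right fun _ => ?_)
    exact ⟨fun h1 => ⟨hω, h1⟩, fun h1 => h1.2⟩

end
end ExcitedWalk

/-! ### The main theorem -/

theorem mainTheorem4 {d : ℕ} (hd : 2 ≤ d) {Ω : Type*} {mΩ : MeasurableSpace Ω}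
    (μ : Measure Ω) [IsProbabilityMeasure μ] (ℱ : Filtration ℕ mΩ)
    (ℓ : EuclideanSpace ℝ (Fin d)) (X : ℕ → Ω → Fin d → ℤ)
    (hX : ExcitedWalk.IsGeneralizedExcitedWalk μ ℱ ℓ X) :
    (∃ C' α' : ℝ, 0 < C' ∧ 0 < α' ∧ ∀ n : ℕ, 1 ≤ n → ∀ᵐ ω ∂μ, ∀ k : ℕ, 1 ≤ k →
      (μ⟦{ω' | (n : ℕ∞) < ExcitedWalk.regTime ℓ X (k + 1) ω' - ExcitedWalk.regTime ℓ X k ω'} |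
          ExcitedWalk.regSigma ℱ ℓ X k⟧) ω ≤ C' * Real.exp (-(n : ℝ) ^ α')) ∧
    ∀ k : ℕ, 1 ≤ k → ∀ᵐ ω ∂μ, ExcitedWalk.regTime ℓ X k ω < ⊤ := by
  obtain ⟨K, lam, h, r, hw⟩ := hX.exists_walkBounds
  refine ⟨?_, fun k hk => ?_⟩
  · obtain ⟨C, γ, hC, hγ, hreg⟩ := hw.exists_next_regeneration_bound hd
    obtain ⟨N, hN⟩ := Filter.eventually_atTop.1 hreg
    -- The second constant makes the right-hand side at least one for `n < N`, where the asymptotic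
    -- tail bound is not available.
    refine ⟨max C (Real.exp ((N : ℝ) ^ γ)), γ, lt_max_of_lt_left hC, hγ, fun n _ => ?_⟩
    refine ae_all_iff.2 fun k => ?_
    rcases Nat.eq_zero_or_eq_succ_pred k with rfl | hk
    · exact Filter.Eventually.of_forall fun ω hω => absurd hω (by norm_num)
    rw [hk]
    refine (hw.condExp_regTime_le hd (by positivity) (fun t S hS => ?_) _).mono fun ω hω _ => hω
    rcases le_or_gt N n with hn | hn
    · refine (hN n hn t S hS).trans ?_
      gcongr
      exact le_max_left _ _
    · refine (measureReal_mono Set.inter_subset_left (measure_ne_top _ _)).trans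
        (le_mul_of_one_le_left measureReal_nonneg ?_)
      calc (1 : ℝ) = Real.exp ((N : ℝ) ^ γ) * Real.exp (-(N : ℝ) ^ γ) := by
            rw [← Real.exp_add, add_neg_cancel, Real.exp_zero]
        _ ≤ _ := by
            gcongr
            exact le_max_right _ _
  · obtain ⟨j, rfl⟩ := Nat.exists_eq_add_of_le' hk
    exact hw.regTime_lt_top hd j
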